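/- Let $0<p\le q<1$ with $p+q<1$ (a monotonic bandit), let $\mathbf P=\begin{pmatrix}1-p&q\\p&1-q\end{pmatrix}$, and let $p^{(n)}=(\mathbf P^n)_{10}$, $q^{(n)}=(\mathbf P^n)_{01}$ be the $n$-step probabilities of moving from $0$ to $1$ and from $1$ to $0$. Put $\tau(\omega)=p+\omega(1-p-q)$, $\omega^*=p/(p+q)$ and $H(\omega)=-\omega\log_2\omega-(1-\omega)\log_2(1-\omega)$. In the single-bandit problem with service charge $\lambda\ge0$ on the belief space $(0,1)$, each slot costs $H(\omega)+\lambda u$; the active action $u=1$ leads from $\omega$ to $1-q$ with probability $\omega$ and to $p$ with probability $1-\omega$, and the passive action $u=0$ leads to $\tau(\omega)$. The passive set $E_0(\lambda)$ is the set of $\omega\in(0,1)$ at which the passive action attains the minimum in the average-penalty Bellman equation $$V(\omega)+g=H(\omega)+\min\{\lambda+\omega V(1-q)+(1-\omega)V(p),\,V(\tau(\omega))\}$$ ($g$ constant, $V$ bounded and continuous), the sampling region is $(0,1)\setminus E_0(\lambda)$, and the Whittle index is $W(\omega)=\inf\{\lambda\ge0:\omega\in E_0(\lambda)\}$. For $F\ge1$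 let $E=\{p^{(k)}:1\le k\le F\}\cup\{\omega^*\}\cup\{1-q^{(k)}:1\le k\le F\}$, with $|E|=2F+1$, let $(x_1,\dots,x_{|E|})$ be any ordering of $E$ with $W(x_i)\le W(x_{i+1})$, and let $x_e=\omega^*$. Let $E_1(n)=\{x_i:i\ge n+1\}$, $L_n=T(p,E_1(n))+1$ and $K_n=T(1-q,E_1(n))+1$, where $T(x,S)$ is the number of passive slots needed to reach $S$ from $x$ in the truncated space $E$, in which $p^{(F)}$ and $1-q^{(F)}$ are followed by $\omega^*$. Put $\tau_{n+1}=\tau(x_{n+1})$ and $$B_n=K_np^{(L_n)}+L_nq^{(K_n)},\qquad C_n=L_n\sum_{k=1}^{K_n}H(1-q^{(k)})-K_n\sum_{k=1}^{L_n}H(p^{(k)}),$$ $$G_n=p^{(L_n)}\sum_{k=1}^{K_n}H(1-q^{(k)})+q^{(K_n)}\sum_{k=1}^{L_n}H(p^{(k)}).$$ Then the bandit is indexable ($E_0(\lambda)$ increases from $\emptyset$ at $\lambda=0$ to all of $(0,1)$ for large $\lambda$), and the following formulas hold for $W(x_{n+1})$, in the sense stated after them. 1. For $0\le n\le e-1$,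 $L_n$ and $K_n$ are finite and $$W(x_{n+1})=\frac{B_nH(\tau_{n+1})-G_n-(x_{n+1}-\tau_{n+1})C_n}{(x_{n+1}-\tau_{n+1})(L_n-K_n)+q^{(K_n)}+p^{(L_n)}}.$$ 2. For $e\le n<|E|-1$, $K_n$ is finite, the sampling region at $\lambda=W(x_{n+1})$ is a nonempty open interval $(\omega^l,\omega^u)$, and $x_{n+1}\in\{\omega^l,\omega^u\}$. If $x_{n+1}=\omega^l$, then $$W(x_{n+1})=\frac{q^{(K_n)}\sum_{k=1}^F\left[H(\tau^k(x_{n+1}))-H(p^{(k)})\right]-x_{n+1}\sum_{k=1}^{K_n}\left[H(1-q^{(k)})-H(\omega^*)\right]}{q^{(K_n)}+x_{n+1}}.\qquad(\mathrm a)$$ If $x_{n+1}=\omega^u$, then $$W(x_{n+1})=\frac{q^{(K_n)}\left[H(\tau_{n+1})-H(\omega^*)\right]-(x_{n+1}-\tau_{n+1})\sum_{k=1}^{K_n}\left[H(1-q^{(k)})-H(\omega^*)\right]}{x_{n+1}-\tau_{n+1}}.\qquad(\mathrm b)$$ 3. For $n=|E|-1$, $K_n$ is finite and $W(x_{|E|})$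 is given by (a). The finiteness and threshold assertions in 1 and 2 hold for every $F\ge1$. So do, exactly, formula (b), and the formula in 1 whenever $L_n\le F$ and $K_n\le F$. All formulas hold up to the truncation error: for every $\eta>0$ there is an $\varepsilon>0$ such that, if $|p^{(F)}-\omega^*|<\varepsilon$ and $|1-q^{(F)}-\omega^*|<\varepsilon$, then for every such ordering and every $n$ the two sides of each applicable formula differ by less than $\eta$, and $K_n$ in 3 is finite. -/

import Mathlib

open Set Filter Topology

namespace Bandit

noncomputable section

/-- The Shannon entropy (in bits) of a binary variable; the penalty per slot. -/
def entropy (w : ℝ) : ℝ := -w * Real.logb 2 w - (1 - w) * Real.logb 2 (1 - w)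

/-- Column-stochastic one-step transition matrix: entry `(i, j)` is the probability of moving
from state `j` to state `i`. -/
def transitionMatrix (p q : ℝ) : Matrix (Fin 2) (Fin 2) ℝ := !![1 - p, q; p, 1 - q]

/-- The `n`-step transition probability from state 0 to state 1. -/
def pStep (p q : ℝ) (n : ℕ) : ℝ := (transitionMatrix p q ^ n) 1 0

/-- The `n`-step transition probability from state 1 to state 0. -/
def qStep (p q : ℝ) (n : ℕ) : ℝ := (transitionMatrix p q ^ n) 0 1

/-- One-step evolution of the belief state under the passive action. -/
def evolve (p q w : ℝ) : ℝ := p + w * (1 - p - q)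

/-- The equilibrium belief state. -/
def equilibrium (p q : ℝ) : ℝ := p / (p + q)

/-- `(g, V)` solves the average-penalty Bellman equation of the single-bandit problem with service
charge `lam` on the belief space `(0, 1)`: the active action costs `lam` and leads from `w` to
`1 - q` with probability `w` and to `p` with probability `1 - w`, the passive action leads to
`evolve p q w`. The relative value function `V` is bounded and continuous. -/
structure IsBellmanSolution (p q lam g : ℝ) (V : ℝ → ℝ) : Prop where
  continuousOn : ContinuousOn V (Ioo 0 1)
  bounded : ∃ C : ℝ, ∀ w ∈ Ioo (0 : ℝ) 1, |V w| ≤ C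
  bellman : ∀ w ∈ Ioo (0 : ℝ) 1,
    V w + g = entropy w + min (lam + w * V (1 - q) + (1 - w) * V p) (V (evolve p q w))

/-- The passive set: belief states in which the passive action is optimal (ties included). -/
def passiveSet (p q lam : ℝ) : Set ℝ :=
  {w | w ∈ Ioo (0 : ℝ) 1 ∧ ∃ (g : ℝ) (V : ℝ → ℝ), IsBellmanSolution p q lam g V ∧
    V (evolve p q w) ≤ lam + w * V (1 - q) + (1 - w) * V p}

/-- The sampling region: belief states in which the optimal policy is active. -/
def samplingRegion (p q lam : ℝ) : Set ℝ := Ioo 0 1 \ passiveSet p q lam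

/-- The passive set expands monotonically from the empty set to the whole belief space as the
service charge increases from `0` to infinity. -/
structure Indexable (p q : ℝ) : Prop where
  empty : passiveSet p q 0 = ∅
  monotone : MonotoneOn (passiveSet p q) (Ici 0)
  whole : ∃ Λ : ℝ, ∀ lam, Λ ≤ lam → passiveSet p q lam = Ioo 0 1

/-- The Whittle index: the infimum of the service charges for which passivity is optimal. -/
def whittleIndex (p q w : ℝ) : ℝ := sInf {lam : ℝ | 0 ≤ lam ∧ w ∈ passiveSet p q lam}

/-- The truncated belief space with `2 F + 1` states. -/
def beliefStates (p q : ℝ) (F : ℕ) : Set ℝ :=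
  {equilibrium p q} ∪ pStep p q '' Icc 1 F ∪ (fun k => 1 - qStep p q k) '' Icc 1 F

open Classical in
/-- Passive evolution on the truncated space: a state whose successor is not in the space moves to
the equilibrium. -/
def truncEvolve (p q : ℝ) (F : ℕ) (w : ℝ) : ℝ :=
  if evolve p q w ∈ beliefStates p q F then evolve p q w else equilibrium p q

/-- Number of passive slots needed on the truncated space to get from `w` into `S`
(`⊤` if this never happens). -/
def hittingTime (p q : ℝ) (F : ℕ) (w : ℝ) (S : Set ℝ) : ℕ∞ :=
  ⨅ (k : ℕ) (_ : (truncEvolve p q F)^[k] w ∈ S), (k : ℕ∞)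

/-- `x 0, …, x (2 F)` lists the states of the truncated space in the order of nondecreasing
Whittle index. -/
structure IsWhittleOrdering (p q : ℝ) (F : ℕ) (x : Fin (2 * F + 1) → ℝ) : Prop where
  injective : Function.Injective x
  range_eq : range x = beliefStates p q F
  monotone : Monotone fun i => whittleIndex p q (x i)

/-- The active set of the policy that is passive exactly in the first `n` listed states. -/
def activeStates {F : ℕ} (x : Fin (2 * F + 1) → ℝ) (n : Fin (2 * F + 1)) : Set ℝ := x '' Ici n

/-- Slots from belief `p` up to and including the next active slot. -/
def cycleL (p q : ℝ) {F : ℕ} (x : Fin (2 * F + 1) → ℝ) (n : Fin (2 * F + 1)) : ℕ∞ :=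
  hittingTime p q F p (activeStates x n) + 1

/-- Slots from belief `1 - q` up to and including the next active slot. -/
def cycleK (p q : ℝ) {F : ℕ} (x : Fin (2 * F + 1) → ℝ) (n : Fin (2 * F + 1)) : ℕ∞ :=
  hittingTime p q F (1 - q) (activeStates x n) + 1

/-- `H(p^(1)) + … + H(p^(L))`. -/
def sumP (p q : ℝ) (L : ℕ) : ℝ := ∑ k ∈ Finset.Icc 1 L, entropy (pStep p q k)

/-- `H(1 - q^(1)) + … + H(1 - q^(K))`. -/
def sumQ (p q : ℝ) (K : ℕ) : ℝ := ∑ k ∈ Finset.Icc 1 K, entropy (1 - qStep p q k)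

def coeffB (p q : ℝ) (L K : ℕ) : ℝ := K * pStep p q L + L * qStep p q K

def coeffC (p q : ℝ) (L K : ℕ) : ℝ := L * sumQ p q K - K * sumP p q L

def coeffG (p q : ℝ) (L K : ℕ) : ℝ := pStep p q L * sumQ p q K + qStep p q K * sumP p q L

/-- The index formula while the equilibrium is still in the sampling region. -/
def centralIndex (p q : ℝ) (L K : ℕ) (w : ℝ) : ℝ :=
  (coeffB p q L K * entropy (evolve p q w) - coeffG p q L K
      - (w - evolve p q w) * coeffC p q L K) /
    ((w - evolve p q w) * ((L : ℝ) - K) + qStep p q K + pStep p q L)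

/-- The index formula at a lower threshold. -/
def lowerIndex (p q : ℝ) (F K : ℕ) (w : ℝ) : ℝ :=
  (qStep p q K *
        ∑ k ∈ Finset.Icc 1 F, (entropy ((evolve p q)^[k] w) - entropy (pStep p q k))
      - w * ∑ k ∈ Finset.Icc 1 K, (entropy (1 - qStep p q k) - entropy (equilibrium p q))) /
    (qStep p q K + w)

/-- The index formula at an upper threshold. -/
def upperIndex (p q : ℝ) (K : ℕ) (w : ℝ) : ℝ :=
  (qStep p q K * (entropy (evolve p q w) - entropy (equilibrium p q))
      - (w - evolve p q w) *
        ∑ k ∈ Finset.Icc 1 K, (entropy (1 - qStep p q k) - entropy (equilibrium p q))) /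
    (w - evolve p q w)

end

end Bandit

/-!
Write `H` for `entropy`, `τ` for `evolve p q` and `ω*` for `equilibrium p q`. Along the trajectory
that stays passive forever, the excess entropies `H(τ^k w) - H(ω*)` decay geometrically and sum to
`passiveValue p q w`; all values are measured against this one. A solution `(g, V)` is then
described by the two numbers `saving = H(ω*) - g` and `spread = V (1 - q) - V p`, and the behaviour
on the orbit of `p` (respectively `1 - q`) by the inequalities `0 ≤ slackP n` (`0 ≤ slackQ n`),
which are equalities at the first sampled point of that orbit. Everything is read off from the
function `advantage`, by how much sampling is cheaper than passivity.

*One charge.* Passive evolution tends to the equilibrium, so `V` is a limit of finite-horizon minima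
of concave functions; hence `V` is concave and `advantage` is strictly concave, and the sampling
region is an open interval. Solutions exist for every charge: each orbit gives a Lipschitz function
of the spread, the smallest saving it permits, and the intermediate value theorem makes the two
agree (`IsMonotonic.exists_solution`). All solutions have the same advantage (`advantage_unique`).

*The role of `p ≤ q`.* The entropy lies below its tangent at the equilibrium by a relative entropy,
`deficit`. For `p ≤ q` the total deficit along the orbit of `1 - q` is at least the one along the
orbit of `p`, and if the equilibrium is passive, then so are all beliefs to its left
(`advantage_neg_of_lt_eq`).

*Two charges.* Comparing the stopping inequalities of the two orbits bounds the changes of saving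
and spread in terms of the change of the charge; consequently a passive belief becomes strictly
passive when the charge grows (`advantage_neg_of_lt`). With continuity in the charge this yields
indexability, and the Whittle index of `w` is at most `λ`, at least `λ`, exactly when the advantage
at `w` for the charge `λ` is nonpositive, respectively nonnegative (`whittleIndex_le_iff`,
`le_whittleIndex_iff`).

*The formulas.* At the charge `W(x)` the advantage vanishes at `x`. The states listed before `x` are
passive, the others sampled, so the hitting times `L` and `K` are the first sampled times of the two
orbits. The two cycle equations and the indifference at `x` are linear in charge, saving and spread,
and Cramer's rule gives the formulas. When an orbit is cut off by the truncation, its cycle equation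
holds with a slack, and the truncated sums lack a tail; both are of order `(1 - p - q) ^ F`, while
the denominators stay bounded below.
-/

namespace Bandit

/-! ### Beliefs and their passive evolution -/

/-- The parameters of a monotonic bandit, without the normalisation `p ≤ q`: both transition
probabilities are positive and the belief contracts towards the equilibrium without oscillating. -/
structure IsMonotonic (p q : ℝ) : Prop where
  hp : 0 < p
  hq : 0 < q
  hsum : p + q < 1

/-- The factor by which one passive slot contracts the distance to the equilibrium. -/
noncomputable def decay (p q : ℝ) : ℝ := 1 - p - q

namespace IsMonotonic

variable {p q : ℝ} (h : IsMonotonic p q)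
include h

lemma decay_pos : 0 < decay p q := by unfold decay; linarith [h.hsum]

lemma decay_lt_one : decay p q < 1 := by unfold decay; linarith [h.hp, h.hq]

lemma eq_pos : 0 < equilibrium p q := div_pos h.hp (add_pos h.hp h.hq)

lemma eq_lt_one : equilibrium p q < 1 := by
  rw [equilibrium, div_lt_one (add_pos h.hp h.hq)]; linarith [h.hq]

lemma eq_mem : equilibrium p q ∈ Ioo (0 : ℝ) 1 := ⟨h.eq_pos, h.eq_lt_one⟩

lemma p_eq : p = equilibrium p q * (1 - decay p q) := by
  have := h.hp; have := h.hq
  unfold equilibrium decay; field_simp; ring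

lemma q_eq : q = (1 - equilibrium p q) * (1 - decay p q) := by
  have := h.hp; have := h.hq
  unfold equilibrium decay; field_simp; ring

lemma evolve_eq (w : ℝ) :
    evolve p q w = equilibrium p q + decay p q * (w - equilibrium p q) := by
  have := h.p_eq
  have h2 : evolve p q w = p + w * decay p q := by unfold evolve decay; ring
  rw [h2]; linear_combination this

lemma iterate_eq (k : ℕ) (w : ℝ) :
    (evolve p q)^[k] w = equilibrium p q + decay p q ^ k * (w - equilibrium p q) := by
  induction k with
  | zero => simp
  | succ k ih => rw [Function.iterate_succ_apply', ih, h.evolve_eq]; ring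

lemma evolve_equilibrium : evolve p q (equilibrium p q) = equilibrium p q := by
  rw [h.evolve_eq]; ring

lemma pow_pos (k : ℕ) : 0 < decay p q ^ k := _root_.pow_pos h.decay_pos k

lemma pow_le_one (k : ℕ) : decay p q ^ k ≤ 1 := pow_le_one₀ h.decay_pos.le h.decay_lt_one.le

lemma pow_lt_one {k : ℕ} (hk : 1 ≤ k) : decay p q ^ k < 1 :=
  pow_lt_one₀ h.decay_pos.le h.decay_lt_one (by omega)

lemma tendsto_pow : Tendsto (fun k : ℕ => decay p q ^ k) atTop (𝓝 0) :=
  tendsto_pow_atTop_nhds_zero_of_lt_one h.decay_pos.le h.decay_lt_one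

lemma iterate_mem (k : ℕ) {w : ℝ} (hw : w ∈ Ioo (0 : ℝ) 1) :
    (evolve p q)^[k] w ∈ Ioo (0 : ℝ) 1 := by
  have h1 := h.pow_pos k
  have h2 := h.pow_le_one k
  have hc := h.eq_mem
  rw [h.iterate_eq]
  exact ⟨by nlinarith [hw.1, hc.1, mul_pos h1 hw.1],
    by nlinarith [hw.2, hc.2, mul_pos h1 (sub_pos.2 hw.2)]⟩

lemma evolve_mem {w : ℝ} (hw : w ∈ Ioo (0 : ℝ) 1) : evolve p q w ∈ Ioo (0 : ℝ) 1 :=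
  h.iterate_mem 1 hw

lemma tendsto_iterate (w : ℝ) :
    Tendsto (fun k => (evolve p q)^[k] w) atTop (𝓝 (equilibrium p q)) := by
  simp only [h.iterate_eq]
  simpa using (h.tendsto_pow.mul_const (w - equilibrium p q)).const_add (equilibrium p q)

lemma transitionMatrix_pow (n : ℕ) :
    transitionMatrix p q ^ n =
      !![1 - equilibrium p q * (1 - decay p q ^ n), (1 - equilibrium p q) * (1 - decay p q ^ n);
        equilibrium p q * (1 - decay p q ^ n), 1 - (1 - equilibrium p q) * (1 - decay p q ^ n)] := by
  induction n with
  | zero => simp [Matrix.one_fin_two]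
  | succ n ih =>
    have h1 : transitionMatrix p q =
        !![1 - equilibrium p q * (1 - decay p q), (1 - equilibrium p q) * (1 - decay p q);
          equilibrium p q * (1 - decay p q), 1 - (1 - equilibrium p q) * (1 - decay p q)] := by
      rw [← h.p_eq, ← h.q_eq]; rfl
    rw [pow_succ, ih, h1, Matrix.mul_fin_two]
    congr 1
    simp only [Matrix.vecCons_inj, and_true]
    refine ⟨⟨?_, ?_⟩, ?_, ?_⟩ <;> ring

lemma pStep_eq (n : ℕ) : pStep p q n = equilibrium p q * (1 - decay p q ^ n) := by
  simp [pStep, h.transitionMatrix_pow]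

lemma qStep_eq (n : ℕ) : qStep p q n = (1 - equilibrium p q) * (1 - decay p q ^ n) := by
  simp [qStep, h.transitionMatrix_pow]

lemma pStep_one : pStep p q 1 = p := by rw [h.pStep_eq, pow_one, ← h.p_eq]

lemma qStep_one : qStep p q 1 = q := by rw [h.qStep_eq, pow_one, ← h.q_eq]

lemma iterate_pStep (k n : ℕ) : (evolve p q)^[k] (pStep p q n) = pStep p q (n + k) := by
  rw [h.iterate_eq, h.pStep_eq, h.pStep_eq, pow_add]; ring

lemma iterate_qStep (k n : ℕ) : (evolve p q)^[k] (1 - qStep p q n) = 1 - qStep p q (n + k) := by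
  rw [h.iterate_eq, h.qStep_eq, h.qStep_eq, pow_add]; ring

lemma iterate_p (k : ℕ) : (evolve p q)^[k] p = pStep p q (k + 1) := by
  have := h.iterate_pStep k 1
  rwa [h.pStep_one, add_comm] at this

lemma iterate_q (k : ℕ) : (evolve p q)^[k] (1 - q) = 1 - qStep p q (k + 1) := by
  have := h.iterate_qStep k 1
  rwa [h.qStep_one, add_comm] at this

lemma p_mem : p ∈ Ioo (0 : ℝ) 1 := ⟨h.hp, by linarith [h.hq, h.hsum]⟩

lemma q_mem : 1 - q ∈ Ioo (0 : ℝ) 1 := ⟨by linarith [h.hp, h.hsum], by linarith [h.hq]⟩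

lemma pStep_lt (n : ℕ) : pStep p q n < equilibrium p q := by
  rw [h.pStep_eq]; nlinarith [h.eq_pos, h.pow_pos n, mul_pos h.eq_pos (h.pow_pos n)]

lemma lt_one_sub_qStep (n : ℕ) : equilibrium p q < 1 - qStep p q n := by
  rw [h.qStep_eq]; nlinarith [mul_pos (sub_pos.2 h.eq_lt_one) (h.pow_pos n)]

lemma p_le_pStep {n : ℕ} (hn : 1 ≤ n) : p ≤ pStep p q n := by
  conv_lhs => rw [h.p_eq]
  rw [h.pStep_eq]
  have : decay p q ^ n ≤ decay p q := pow_le_of_le_one h.decay_pos.le h.decay_lt_one.le (by omega)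
  nlinarith [h.eq_pos]

lemma q_le_qStep {n : ℕ} (hn : 1 ≤ n) : q ≤ qStep p q n := by
  conv_lhs => rw [h.q_eq]
  rw [h.qStep_eq]
  have : decay p q ^ n ≤ decay p q := pow_le_of_le_one h.decay_pos.le h.decay_lt_one.le (by omega)
  nlinarith [h.eq_lt_one]

lemma pStep_mem {n : ℕ} (hn : 1 ≤ n) : pStep p q n ∈ Ioo (0 : ℝ) 1 :=
  ⟨h.hp.trans_le (h.p_le_pStep hn), (h.pStep_lt n).trans h.eq_lt_one⟩

lemma qStep_lt_one (n : ℕ) : qStep p q n < 1 := by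
  linarith [h.lt_one_sub_qStep n, h.eq_pos]

lemma qStep_mem {n : ℕ} (hn : 1 ≤ n) : 1 - qStep p q n ∈ Ioo (0 : ℝ) 1 :=
  ⟨by linarith [h.qStep_lt_one n], by linarith [h.hq, h.q_le_qStep hn]⟩

lemma pStep_strictMono : StrictMono (pStep p q) := by
  refine strictMono_nat_of_lt_succ fun n => ?_
  rw [h.pStep_eq, h.pStep_eq, pow_succ]
  nlinarith [mul_pos h.eq_pos (mul_pos (h.pow_pos n) (sub_pos.2 h.decay_lt_one))]

lemma qStep_strictMono : StrictMono (qStep p q) := by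
  refine strictMono_nat_of_lt_succ fun n => ?_
  rw [h.qStep_eq, h.qStep_eq, pow_succ]
  nlinarith [mul_pos (sub_pos.2 h.eq_lt_one) (mul_pos (h.pow_pos n) (sub_pos.2 h.decay_lt_one))]

lemma one_sub_pow_le (k : ℕ) : 1 - decay p q ^ k ≤ k * (1 - decay p q) := by
  have := one_add_mul_le_pow (a := decay p q - 1) (by linarith [h.decay_pos]) k
  rw [add_sub_cancel] at this
  linarith

/-- The chord of `1 - β ^ L` over `[0, L]` is steeper than its last increment. -/
lemma mul_pow_le {L : ℕ} (hL : 1 ≤ L) :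
    L * ((1 - decay p q) * decay p q ^ (L - 1)) ≤ 1 - decay p q ^ L := by
  have h1 : (1 - decay p q) * ∑ i ∈ Finset.range L, decay p q ^ i = 1 - decay p q ^ L := by
    have := geom_sum_mul (decay p q) L
    linarith
  rw [← h1, ← mul_assoc, mul_comm (L : ℝ), mul_assoc]
  refine mul_le_mul_of_nonneg_left ?_ (by linarith [h.decay_lt_one])
  have : ∑ i ∈ Finset.range L, decay p q ^ (L - 1) ≤ ∑ i ∈ Finset.range L, decay p q ^ i := by
    refine Finset.sum_le_sum fun i hi => ?_
    exact pow_le_pow_of_le_one h.decay_pos.le h.decay_lt_one.le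
      (by have := Finset.mem_range.1 hi; omega)
  simpa using this

end IsMonotonic

/-! ### The entropy and its tangent at the equilibrium -/

lemma entropy_eq (w : ℝ) : entropy w = Real.binEntropy w / Real.log 2 := by
  rw [entropy, Real.binEntropy, Real.logb, Real.logb, Real.log_inv, Real.log_inv]; ring

lemma log_two_pos : 0 < Real.log 2 := Real.log_pos one_lt_two

lemma strictConcaveOn_entropy : StrictConcaveOn ℝ (Ioo 0 1) entropy := by
  have h1 : StrictConcaveOn ℝ (Ioo 0 1) Real.binEntropy :=
    Real.strictConcave_binEntropy.subset Ioo_subset_Icc_self (convex_Ioo 0 1)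
  refine ⟨h1.1, fun x hx y hy hxy a b ha hb hab => ?_⟩
  have h2 := h1.2 hx hy hxy ha hb hab
  simp only [entropy_eq, smul_eq_mul] at h2 ⊢
  rw [← mul_div_assoc, ← mul_div_assoc, ← add_div]
  exact div_lt_div_of_pos_right h2 log_two_pos

/-- The slope of the entropy at the equilibrium. -/
noncomputable def tangentSlope (p q : ℝ) : ℝ :=
  (Real.log (1 - equilibrium p q) - Real.log (equilibrium p q)) / Real.log 2

/-- How far the entropy lies below its tangent at the equilibrium: the relative entropy (in bits)
of `w` with respect to the equilibrium. -/
noncomputable def deficit (p q w : ℝ) : ℝ :=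
  entropy (equilibrium p q) + tangentSlope p q * (w - equilibrium p q) - entropy w

lemma log_two_mul_deficit (p q w : ℝ) :
    Real.log 2 * deficit p q w = w * (Real.log w - Real.log (equilibrium p q))
      + (1 - w) * (Real.log (1 - w) - Real.log (1 - equilibrium p q)) := by
  have := log_two_pos.ne'
  simp only [deficit, entropy, tangentSlope, Real.logb]
  field_simp
  ring

lemma deficit_equilibrium (p q : ℝ) : deficit p q (equilibrium p q) = 0 := by simp [deficit]

/-- The constant in the chi-square bound on `deficit`. -/
noncomputable def deficitConst (p q : ℝ) : ℝ :=
  1 / (equilibrium p q * (1 - equilibrium p q) * Real.log 2)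

lemma mul_log_sub_ge {w c : ℝ} (hw : 0 < w) (hc : 0 < c) :
    w - c ≤ w * (Real.log w - Real.log c) := by
  have h1 := Real.log_le_sub_one_of_pos (div_pos hc hw)
  rw [Real.log_div hc.ne' hw.ne'] at h1
  have h2 : w * (c / w - 1) = c - w := by field_simp
  nlinarith

lemma mul_log_sub_le {w c : ℝ} (hw : 0 < w) (hc : 0 < c) :
    w * (Real.log w - Real.log c) ≤ w * (w / c - 1) := by
  have h1 := Real.log_le_sub_one_of_pos (div_pos hw hc)
  rw [Real.log_div hw.ne' hc.ne'] at h1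
  exact mul_le_mul_of_nonneg_left h1 hw.le

namespace IsMonotonic

variable {p q : ℝ} (h : IsMonotonic p q)
include h

lemma deficit_nonneg {w : ℝ} (hw : w ∈ Ioo (0 : ℝ) 1) : 0 ≤ deficit p q w := by
  have h1 := mul_log_sub_ge hw.1 h.eq_pos
  have h2 := mul_log_sub_ge (sub_pos.2 hw.2) (sub_pos.2 h.eq_lt_one)
  have h3 := log_two_mul_deficit p q w
  by_contra hneg
  have := mul_neg_of_pos_of_neg log_two_pos (not_le.1 hneg)
  linarith

lemma deficitConst_pos : 0 < deficitConst p q :=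
  one_div_pos.2 (mul_pos (mul_pos h.eq_pos (sub_pos.2 h.eq_lt_one)) log_two_pos)

lemma deficit_le {w : ℝ} (hw : w ∈ Ioo (0 : ℝ) 1) :
    deficit p q w ≤ deficitConst p q * (w - equilibrium p q) ^ 2 := by
  have hc := h.eq_pos
  have hc1 : 0 < 1 - equilibrium p q := sub_pos.2 h.eq_lt_one
  have h1 := mul_log_sub_le hw.1 hc
  have h2 := mul_log_sub_le (sub_pos.2 hw.2) hc1
  have h3 := log_two_mul_deficit p q w
  have h4 : w * (w / equilibrium p q - 1) + (1 - w) * ((1 - w) / (1 - equilibrium p q) - 1)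
      = Real.log 2 * (deficitConst p q * (w - equilibrium p q) ^ 2) := by
    have := log_two_pos.ne'
    unfold deficitConst
    field_simp
    ring
  exact le_of_mul_le_mul_left (by linarith) log_two_pos

/-- If the equilibrium is at most one half, then the entropy falls further below its tangent on the
way to `1` than on the proportional way to `0`. The derivative in `t` of the difference is a
combination of logarithms with an obvious sign. -/
lemma deficit_left_le_right (hc : equilibrium p q ≤ 1 / 2) {t : ℝ} (ht0 : 0 ≤ t) (ht1 : t < 1) :
    deficit p q (equilibrium p q - equilibrium p q * t) ≤
      deficit p q (equilibrium p q + (1 - equilibrium p q) * t) := by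
  set c := equilibrium p q with hcdef
  have c0 : 0 < c := h.eq_pos
  have c1 : 0 < 1 - c := sub_pos.2 h.eq_lt_one
  let f : ℝ → ℝ := fun t => (c + (1 - c) * t) * Real.log (c + (1 - c) * t)
    - (1 - c + c * t) * Real.log (1 - c + c * t) + (1 - 2 * c) * ((1 - t) * Real.log (1 - t))
    - (c + (1 - c) * t) * Real.log c + (1 - c + c * t) * Real.log (1 - c)
  have key : ∀ t ∈ Ico (0 : ℝ) 1, HasDerivAt f
      ((1 - c) * (Real.log (c + (1 - c) * t) - Real.log c)
        - c * (Real.log (1 - c + c * t) - Real.log (1 - c))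
        - (1 - 2 * c) * Real.log (1 - t)) t := by
    intro t ht
    have p1 : 0 < c + (1 - c) * t := by nlinarith [mul_nonneg c1.le ht.1]
    have p2 : 0 < 1 - c + c * t := by nlinarith [mul_nonneg c0.le ht.1]
    have p3 : 0 < 1 - t := sub_pos.2 ht.2
    have i1 : HasDerivAt (fun t => c + (1 - c) * t) (1 - c) t := by
      simpa using ((hasDerivAt_id t).const_mul (1 - c)).const_add c
    have i2 : HasDerivAt (fun t => 1 - c + c * t) c t := by
      simpa using ((hasDerivAt_id t).const_mul c).const_add (1 - c)
    have i3 : HasDerivAt (fun t => 1 - t) (-1) t := by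
      simpa using (hasDerivAt_id t).const_sub 1
    have d1 := (Real.hasDerivAt_mul_log p1.ne').comp t i1
    have d2 := (Real.hasDerivAt_mul_log p2.ne').comp t i2
    have d3 := ((Real.hasDerivAt_mul_log p3.ne').comp t i3).const_mul (1 - 2 * c)
    have := (((d1.sub d2).add d3).sub (i1.mul_const (Real.log c))).add
      (i2.mul_const (Real.log (1 - c)))
    refine this.congr_deriv ?_
    ring
  have hmono : MonotoneOn f (Ico 0 1) := by
    refine monotoneOn_of_deriv_nonneg (convex_Ico 0 1)
      (fun t ht => (key t ht).continuousAt.continuousWithinAt)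
      (fun t ht => (key t (interior_subset ht)).differentiableAt.differentiableWithinAt) ?_
    intro t ht
    have ht' : t ∈ Ico (0 : ℝ) 1 := interior_subset ht
    rw [(key t ht').deriv]
    have l1 : Real.log (1 - t) ≤ 0 := Real.log_nonpos (sub_pos.2 ht'.2).le (by linarith [ht'.1])
    have p1 : 0 < c + (1 - c) * t := by nlinarith [mul_nonneg c1.le ht'.1]
    have p2 : 0 < 1 - c + c * t := by nlinarith [mul_nonneg c0.le ht'.1]
    have l2 : 0 ≤ Real.log (1 - c + c * t) - Real.log (1 - c) :=
      sub_nonneg.2 (Real.log_le_log c1 (by nlinarith [mul_nonneg c0.le ht'.1]))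
    have l3 : Real.log (1 - c + c * t) - Real.log (1 - c)
        ≤ Real.log (c + (1 - c) * t) - Real.log c := by
      rw [← Real.log_div p2.ne' c1.ne', ← Real.log_div p1.ne' c0.ne']
      refine Real.log_le_log (div_pos p2 c1) ?_
      rw [div_le_div_iff₀ c1 c0]
      nlinarith [mul_nonneg (by linarith : 0 ≤ 1 - 2 * c) ht'.1]
    nlinarith
  have h0 : f 0 ≤ f t := hmono ⟨le_refl _, one_pos⟩ ⟨ht0, ht1⟩ ht0
  have e0 : f 0 = 0 := by simp [f]
  have e1 := log_two_mul_deficit p q (c - c * t)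
  have e2 := log_two_mul_deficit p q (c + (1 - c) * t)
  rw [← hcdef] at e1 e2
  have p3 : 0 < 1 - t := sub_pos.2 ht1
  have r1 : Real.log (c - c * t) = Real.log c + Real.log (1 - t) := by
    rw [← Real.log_mul c0.ne' p3.ne']; congr 1; ring
  have r2 : Real.log (1 - (c + (1 - c) * t)) = Real.log (1 - c) + Real.log (1 - t) := by
    rw [← Real.log_mul c1.ne' p3.ne']; congr 1; ring
  have r3 : 1 - (c - c * t) = 1 - c + c * t := by ring
  rw [r1, r3] at e1
  rw [r2] at e2
  have : Real.log 2 * deficit p q (c + (1 - c) * t) - Real.log 2 * deficit p q (c - c * t)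
      = f t := by
    rw [e1, e2]; simp only [f]; ring
  exact le_of_mul_le_mul_left (by linarith) log_two_pos

end IsMonotonic

/-! ### The value of passive evolution towards the equilibrium -/

lemma concaveOn_of_tendsto {s : Set ℝ} (hs : Convex ℝ s) {f : ℕ → ℝ → ℝ} {F : ℝ → ℝ}
    (hf : ∀ n, ConcaveOn ℝ s (f n)) (hF : ∀ x ∈ s, Tendsto (fun n => f n x) atTop (𝓝 (F x))) :
    ConcaveOn ℝ s F := by
  refine ⟨hs, fun x hx y hy a b ha hb hab => ?_⟩
  have hz := hs hx hy ha hb hab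
  exact le_of_tendsto_of_tendsto' (((hF x hx).const_smul a).add ((hF y hy).const_smul b))
    (hF _ hz) fun n => (hf n).2 hx hy ha hb hab

/-- The total deficit accumulated along the passive orbit of `w`. -/
noncomputable def totalDeficit (p q w : ℝ) : ℝ := ∑' j : ℕ, deficit p q ((evolve p q)^[j] w)

/-- The sum over the passive orbit of `w` of the entropy minus its value at the equilibrium. It is
written as the contribution of the tangent minus a total deficit, which is a series of nonnegative
terms. -/
noncomputable def passiveValue (p q w : ℝ) : ℝ :=
  tangentSlope p q * (w - equilibrium p q) / (1 - decay p q) - totalDeficit p q w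

/-- A Lipschitz constant of `passiveValue` at the equilibrium. -/
noncomputable def passiveConst (p q : ℝ) : ℝ :=
  (|tangentSlope p q| + deficitConst p q) / (1 - decay p q)

lemma evolve_combo (p q : ℝ) {a b : ℝ} (hab : a + b = 1) (x y : ℝ) :
    evolve p q (a * x + b * y) = a * evolve p q x + b * evolve p q y := by
  unfold evolve; linear_combination -p * hab

lemma evolve_eq_mix (p q w : ℝ) : evolve p q w = w * (1 - q) + (1 - w) * p := by
  unfold evolve; ring

namespace IsMonotonic

variable {p q : ℝ} (h : IsMonotonic p q)
include h

lemma one_sub_decay_pos : 0 < 1 - decay p q := sub_pos.2 h.decay_lt_one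

lemma passiveConst_nonneg : 0 ≤ passiveConst p q :=
  div_nonneg (add_nonneg (abs_nonneg _) h.deficitConst_pos.le) h.one_sub_decay_pos.le

lemma deficit_iterate_le (j : ℕ) {w : ℝ} (hw : w ∈ Ioo (0 : ℝ) 1) :
    deficit p q ((evolve p q)^[j] w)
      ≤ deficitConst p q * (w - equilibrium p q) ^ 2 * decay p q ^ j := by
  refine (h.deficit_le (h.iterate_mem j hw)).trans ?_
  rw [h.iterate_eq, add_sub_cancel_left, mul_pow]
  have h1 : (decay p q ^ j) ^ 2 ≤ decay p q ^ j :=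
    pow_le_of_le_one (h.pow_pos j).le (h.pow_le_one j) two_ne_zero
  have h2 : 0 ≤ deficitConst p q * (w - equilibrium p q) ^ 2 :=
    mul_nonneg h.deficitConst_pos.le (sq_nonneg _)
  nlinarith [mul_le_mul_of_nonneg_left h1 h2]

lemma summable_deficit {w : ℝ} (hw : w ∈ Ioo (0 : ℝ) 1) :
    Summable fun j => deficit p q ((evolve p q)^[j] w) :=
  Summable.of_nonneg_of_le (fun j => h.deficit_nonneg (h.iterate_mem j hw))
    (fun j => h.deficit_iterate_le j hw)
    ((summable_geometric_of_lt_one h.decay_pos.le h.decay_lt_one).mul_left _)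

lemma totalDeficit_nonneg {w : ℝ} (hw : w ∈ Ioo (0 : ℝ) 1) : 0 ≤ totalDeficit p q w :=
  tsum_nonneg fun j => h.deficit_nonneg (h.iterate_mem j hw)

lemma totalDeficit_le {w : ℝ} (hw : w ∈ Ioo (0 : ℝ) 1) :
    totalDeficit p q w
      ≤ deficitConst p q / (1 - decay p q) * (w - equilibrium p q) ^ 2 := by
  have h1 := (h.summable_deficit hw).tsum_le_tsum (fun j => h.deficit_iterate_le j hw)
    ((summable_geometric_of_lt_one h.decay_pos.le h.decay_lt_one).mul_left _)
  rw [tsum_mul_left, tsum_geometric_of_lt_one h.decay_pos.le h.decay_lt_one] at h1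
  refine h1.trans_eq ?_
  have := h.one_sub_decay_pos.ne'
  field_simp

lemma passiveValue_step {w : ℝ} (hw : w ∈ Ioo (0 : ℝ) 1) :
    passiveValue p q w
      = entropy w - entropy (equilibrium p q) + passiveValue p q (evolve p q w) := by
  have h1 : totalDeficit p q w = deficit p q w + totalDeficit p q (evolve p q w) := by
    rw [totalDeficit, (h.summable_deficit hw).tsum_eq_zero_add]
    rfl
  rw [passiveValue, passiveValue, h1, h.evolve_eq, add_sub_cancel_left, deficit]
  have := h.one_sub_decay_pos.ne'
  field_simp
  ring

lemma passiveValue_equilibrium : passiveValue p q (equilibrium p q) = 0 := by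
  have h1 : ∀ j, (evolve p q)^[j] (equilibrium p q) = equilibrium p q := fun j => by
    rw [h.iterate_eq]; ring
  simp [passiveValue, totalDeficit, h1, deficit_equilibrium]

lemma abs_passiveValue_le {w : ℝ} (hw : w ∈ Ioo (0 : ℝ) 1) :
    |passiveValue p q w| ≤ passiveConst p q * |w - equilibrium p q| := by
  have h0 := h.one_sub_decay_pos
  have h1 := h.totalDeficit_nonneg hw
  have h2 := h.totalDeficit_le hw
  have hlt : |w - equilibrium p q| ≤ 1 := by
    rw [abs_le]; constructor <;> linarith [hw.1, hw.2, h.eq_pos, h.eq_lt_one]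
  have h3 : (w - equilibrium p q) ^ 2 ≤ |w - equilibrium p q| := by
    rw [← sq_abs]; exact pow_le_of_le_one (abs_nonneg _) hlt two_ne_zero
  have h4 : 0 ≤ deficitConst p q / (1 - decay p q) := div_nonneg h.deficitConst_pos.le h0.le
  have h5 := mul_le_mul_of_nonneg_left h3 h4
  calc |passiveValue p q w|
      ≤ |tangentSlope p q * (w - equilibrium p q) / (1 - decay p q)| + |totalDeficit p q w| :=
        abs_sub _ _
    _ ≤ |tangentSlope p q| * |w - equilibrium p q| / (1 - decay p q)
        + deficitConst p q / (1 - decay p q) * |w - equilibrium p q| := by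
        rw [abs_div, abs_mul, abs_of_pos h0, abs_of_nonneg h1]
        linarith
    _ = passiveConst p q * |w - equilibrium p q| := by
        unfold passiveConst; field_simp

lemma abs_iterate_sub (n : ℕ) (w : ℝ) :
    |(evolve p q)^[n] w - equilibrium p q| = decay p q ^ n * |w - equilibrium p q| := by
  rw [h.iterate_eq, add_sub_cancel_left, abs_mul, abs_of_pos (h.pow_pos n)]

lemma abs_sub_eq_le_one {w : ℝ} (hw : w ∈ Ioo (0 : ℝ) 1) : |w - equilibrium p q| ≤ 1 := by
  rw [abs_le]; constructor <;> linarith [hw.1, hw.2, h.eq_pos, h.eq_lt_one]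

lemma abs_passiveValue_le_const {w : ℝ} (hw : w ∈ Ioo (0 : ℝ) 1) :
    |passiveValue p q w| ≤ passiveConst p q :=
  (h.abs_passiveValue_le hw).trans
    (mul_le_of_le_one_right h.passiveConst_nonneg (h.abs_sub_eq_le_one hw))

lemma abs_passiveValue_iterate_le (n : ℕ) {w : ℝ} (hw : w ∈ Ioo (0 : ℝ) 1) :
    |passiveValue p q ((evolve p q)^[n] w)| ≤ passiveConst p q * decay p q ^ n := by
  refine (h.abs_passiveValue_le (h.iterate_mem n hw)).trans ?_
  rw [h.abs_iterate_sub]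
  exact mul_le_mul_of_nonneg_left
    (mul_le_of_le_one_right (h.pow_pos n).le (h.abs_sub_eq_le_one hw)) h.passiveConst_nonneg

lemma tendsto_passiveValue_iterate {w : ℝ} (hw : w ∈ Ioo (0 : ℝ) 1) :
    Tendsto (fun n => passiveValue p q ((evolve p q)^[n] w)) atTop (𝓝 0) :=
  squeeze_zero_norm (fun n => h.abs_passiveValue_iterate_le n hw)
    (by simpa using h.tendsto_pow.const_mul (passiveConst p q))

/-- Telescoping: partial sums of the entropy along a passive orbit. -/
lemma sum_entropy_iterate (g : ℝ) (n : ℕ) {w : ℝ} (hw : w ∈ Ioo (0 : ℝ) 1) :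
    ∑ j ∈ Finset.range n, (entropy ((evolve p q)^[j] w) - g)
      = n * (entropy (equilibrium p q) - g) + passiveValue p q w
        - passiveValue p q ((evolve p q)^[n] w) := by
  induction n with
  | zero => simp
  | succ n ih =>
    rw [Finset.sum_range_succ, ih, Function.iterate_succ_apply',
      h.passiveValue_step (h.iterate_mem n hw)]
    push_cast; ring

omit h in
lemma iterate_combo (n : ℕ) {a b : ℝ} (hab : a + b = 1) (x y : ℝ) :
    (evolve p q)^[n] (a * x + b * y) = a * (evolve p q)^[n] x + b * (evolve p q)^[n] y := by
  induction n with
  | zero => rfl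
  | succ n ih => simp only [Function.iterate_succ_apply', ih, evolve_combo p q hab]

lemma concaveOn_comp_iterate {f : ℝ → ℝ} (hf : ConcaveOn ℝ (Ioo 0 1) f) (n : ℕ) :
    ConcaveOn ℝ (Ioo 0 1) fun w => f ((evolve p q)^[n] w) := by
  refine ⟨convex_Ioo 0 1, fun x hx y hy a b ha hb hab => ?_⟩
  have := hf.2 (h.iterate_mem n hx) (h.iterate_mem n hy) ha hb hab
  simp only [smul_eq_mul] at this ⊢
  rwa [iterate_combo n hab]

lemma concaveOn_sum_entropy (g : ℝ) (n : ℕ) :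
    ConcaveOn ℝ (Ioo 0 1)
      fun w => ∑ j ∈ Finset.range n, (entropy ((evolve p q)^[j] w) - g) := by
  induction n with
  | zero => simpa using concaveOn_const (0 : ℝ) (convex_Ioo 0 1)
  | succ n ih =>
    simp only [Finset.sum_range_succ]
    exact ih.add ((h.concaveOn_comp_iterate strictConcaveOn_entropy.concaveOn n).sub
      (convexOn_const g (convex_Ioo 0 1)))

lemma concaveOn_passiveValue : ConcaveOn ℝ (Ioo 0 1) (passiveValue p q) := by
  refine concaveOn_of_tendsto (convex_Ioo 0 1)
    (h.concaveOn_sum_entropy (entropy (equilibrium p q))) fun w hw => ?_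
  have := (h.tendsto_passiveValue_iterate hw).const_sub (passiveValue p q w)
  simp only [sub_zero] at this
  refine this.congr fun n => ?_
  rw [h.sum_entropy_iterate _ _ hw]; ring

lemma totalDeficit_p_le_q (hpq : p ≤ q) : totalDeficit p q p ≤ totalDeficit p q (1 - q) := by
  have hc : equilibrium p q ≤ 1 / 2 := by
    rw [equilibrium, div_le_div_iff₀ (by linarith [h.hp, h.hq]) two_pos]; linarith
  refine (h.summable_deficit h.p_mem).tsum_le_tsum (fun j => ?_) (h.summable_deficit h.q_mem)
  have := h.deficit_left_le_right hc (h.pow_pos (j + 1)).le (h.pow_lt_one (by omega : 1 ≤ j + 1))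
  have e1 : equilibrium p q * (1 - decay p q ^ (j + 1))
      = equilibrium p q - equilibrium p q * decay p q ^ (j + 1) := by ring
  have e2 : 1 - (1 - equilibrium p q) * (1 - decay p q ^ (j + 1))
      = equilibrium p q + (1 - equilibrium p q) * decay p q ^ (j + 1) := by ring
  rwa [h.iterate_p, h.iterate_q, h.pStep_eq, h.qStep_eq, e1, e2]

end IsMonotonic

/-! ### A solution of the Bellman equation -/

/-- The cost of sampling at `w`, not counting the entropy and the average penalty of the slot. -/
noncomputable def sampleCost (p q lam : ℝ) (V : ℝ → ℝ) (w : ℝ) : ℝ :=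
  lam + w * V (1 - q) + (1 - w) * V p

/-- The amount by which sampling is cheaper than passivity at `w`; passivity is optimal where it is
nonpositive and sampling where it is nonnegative. -/
noncomputable def advantage (p q lam : ℝ) (V : ℝ → ℝ) (w : ℝ) : ℝ :=
  V (evolve p q w) - sampleCost p q lam V w

/-- The difference of the relative values of the two beliefs reached by sampling. -/
noncomputable def spread (p q : ℝ) (V : ℝ → ℝ) : ℝ := V (1 - q) - V p

/-- The amount by which the average penalty `g` is lower than under permanent passivity. -/
noncomputable def saving (p q g : ℝ) : ℝ := entropy (equilibrium p q) - g

/-- For average penalty `H(ω*) - G` and spread `D`, the extra cost of the cycle from `p` that samples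
in slot `n`, compared to the optimal continuation. -/
noncomputable def slackP (p q lam G D : ℝ) (n : ℕ) : ℝ :=
  n * G + (passiveValue p q p - passiveValue p q (pStep p q (n + 1))) + lam + pStep p q n * D

/-- The analogue of `slackP` for the cycle from `1 - q`. -/
noncomputable def slackQ (p q lam G D : ℝ) (n : ℕ) : ℝ :=
  n * G + (passiveValue p q (1 - q) - passiveValue p q (1 - qStep p q (n + 1))) + lam
    - qStep p q n * D

lemma sampleCost_eq (p q lam : ℝ) (V : ℝ → ℝ) (w : ℝ) :
    sampleCost p q lam V w = lam + V p + w * spread p q V := by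
  unfold sampleCost spread; ring

lemma concaveOn_sampleCost (p q lam : ℝ) (V : ℝ → ℝ) :
    ConcaveOn ℝ (Ioo 0 1) (sampleCost p q lam V) := by
  refine ⟨convex_Ioo 0 1, fun x _ y _ a b _ _ hab => le_of_eq ?_⟩
  simp only [sampleCost_eq, smul_eq_mul]
  linear_combination (lam + V p) * hab

namespace IsBellmanSolution

variable {p q lam g : ℝ} {V : ℝ → ℝ}

section
variable (S : IsBellmanSolution p q lam g V) {w : ℝ} (hw : w ∈ Ioo (0 : ℝ) 1)
include S hw

lemma value_eq : V w = entropy w - g + min (sampleCost p q lam V w) (V (evolve p q w)) := by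
  have := S.bellman w hw
  unfold sampleCost; linarith

lemma value_le_passive : V w ≤ entropy w - g + V (evolve p q w) := by
  rw [S.value_eq hw]; linarith [min_le_right (sampleCost p q lam V w) (V (evolve p q w))]

lemma value_le_active : V w ≤ entropy w - g + sampleCost p q lam V w := by
  rw [S.value_eq hw]; linarith [min_le_left (sampleCost p q lam V w) (V (evolve p q w))]

lemma value_eq_passive (ha : advantage p q lam V w ≤ 0) :
    V w = entropy w - g + V (evolve p q w) := by
  rw [S.value_eq hw, min_eq_right (sub_nonpos.1 ha)]

lemma value_eq_active (ha : 0 ≤ advantage p q lam V w) :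
    V w = entropy w - g + sampleCost p q lam V w := by
  rw [S.value_eq hw, min_eq_left (sub_nonneg.1 ha)]

lemma value_lt_active (ha : advantage p q lam V w < 0) :
    V w < entropy w - g + sampleCost p q lam V w := by
  rw [S.value_eq_passive hw ha.le]; linarith [sub_neg.1 ha]

end

variable (h : IsMonotonic p q) (S : IsBellmanSolution p q lam g V)
include h S

lemma unroll_le (n : ℕ) {w : ℝ} (hw : w ∈ Ioo (0 : ℝ) 1) :
    V w ≤ n * saving p q g + passiveValue p q w - passiveValue p q ((evolve p q)^[n] w)
      + V ((evolve p q)^[n] w) := by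
  rw [saving, ← h.sum_entropy_iterate g n hw]
  induction n with
  | zero => simp
  | succ n ih =>
    have := S.value_le_passive (h.iterate_mem n hw)
    rw [Finset.sum_range_succ, Function.iterate_succ_apply']
    linarith

lemma unroll_eq (n : ℕ) {w : ℝ} (hw : w ∈ Ioo (0 : ℝ) 1)
    (ha : ∀ j < n, advantage p q lam V ((evolve p q)^[j] w) ≤ 0) :
    V w = n * saving p q g + passiveValue p q w - passiveValue p q ((evolve p q)^[n] w)
      + V ((evolve p q)^[n] w) := by
  rw [saving, ← h.sum_entropy_iterate g n hw]
  induction n with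
  | zero => simp
  | succ n ih =>
    have := S.value_eq_passive (h.iterate_mem n hw) (ha n (Nat.lt_succ_self n))
    rw [Finset.sum_range_succ, Function.iterate_succ_apply']
    linarith [ih fun j hj => ha j (by omega)]

omit S in
lemma entropy_sub (n : ℕ) {w : ℝ} (hw : w ∈ Ioo (0 : ℝ) 1) :
    entropy ((evolve p q)^[n] w) - g = saving p q g + passiveValue p q ((evolve p q)^[n] w)
      - passiveValue p q ((evolve p q)^[n + 1] w) := by
  rw [h.passiveValue_step (h.iterate_mem n hw), Function.iterate_succ_apply', saving]; ring

lemma stop_le (n : ℕ) {w : ℝ} (hw : w ∈ Ioo (0 : ℝ) 1) :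
    V w ≤ (n + 1) * saving p q g + passiveValue p q w - passiveValue p q ((evolve p q)^[n + 1] w)
      + sampleCost p q lam V ((evolve p q)^[n] w) := by
  linarith [S.unroll_le h n hw, S.value_le_active (h.iterate_mem n hw), entropy_sub (g := g) h n hw]

lemma stop_lt (n : ℕ) {w : ℝ} (hw : w ∈ Ioo (0 : ℝ) 1)
    (ha : advantage p q lam V ((evolve p q)^[n] w) < 0) :
    V w < (n + 1) * saving p q g + passiveValue p q w - passiveValue p q ((evolve p q)^[n + 1] w)
      + sampleCost p q lam V ((evolve p q)^[n] w) := by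
  linarith [S.unroll_le h n hw, S.value_lt_active (h.iterate_mem n hw) ha, entropy_sub (g := g) h n hw]

lemma stop_eq (n : ℕ) {w : ℝ} (hw : w ∈ Ioo (0 : ℝ) 1)
    (hn : ∀ j < n, advantage p q lam V ((evolve p q)^[j] w) ≤ 0)
    (ha : 0 ≤ advantage p q lam V ((evolve p q)^[n] w)) :
    V w = (n + 1) * saving p q g + passiveValue p q w - passiveValue p q ((evolve p q)^[n + 1] w)
      + sampleCost p q lam V ((evolve p q)^[n] w) := by
  linarith [S.unroll_eq h n hw hn, S.value_eq_active (h.iterate_mem n hw) ha,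
    entropy_sub (g := g) h n hw]

omit h in
lemma continuousAt {w : ℝ} (hw : w ∈ Ioo (0 : ℝ) 1) : ContinuousAt V w :=
  S.continuousOn.continuousAt (isOpen_Ioo.mem_nhds hw)

lemma tendsto_value_iterate (w : ℝ) :
    Tendsto (fun n => V ((evolve p q)^[n] w)) atTop (𝓝 (V (equilibrium p q))) :=
  (S.continuousAt h.eq_mem).tendsto.comp (h.tendsto_iterate w)

/-- The relative value function is concave: it is the limit of the value functions of the problems
that end after `N` slots with a constant terminal cost. -/
lemma concaveOn : ConcaveOn ℝ (Ioo 0 1) V := by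
  let f : ℕ → ℝ → ℝ := fun N => Nat.rec (fun _ => V (equilibrium p q))
    (fun _ F w => entropy w - g + min (sampleCost p q lam V w) (F (evolve p q w))) N
  have fs : ∀ N w, f (N + 1) w
      = entropy w - g + min (sampleCost p q lam V w) (f N (evolve p q w)) := fun N w => rfl
  have hconc : ∀ N, ConcaveOn ℝ (Ioo 0 1) (f N) := by
    intro N
    induction N with
    | zero => exact concaveOn_const (V (equilibrium p q)) (convex_Ioo 0 1)
    | succ N ih =>
      have h1 := (concaveOn_sampleCost p q lam V).inf (h.concaveOn_comp_iterate ih 1)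
      exact (strictConcaveOn_entropy.concaveOn.sub (convexOn_const g (convex_Ioo 0 1))).add h1
  have hdist : ∀ N, ∀ w ∈ Ioo (0 : ℝ) 1,
      |f N w - V w| ≤ |V (equilibrium p q) - V ((evolve p q)^[N] w)| := by
    intro N
    induction N with
    | zero => intro w _; exact le_rfl
    | succ N ih =>
      intro w hw
      rw [fs, S.value_eq hw, add_sub_add_left_eq_sub, Function.iterate_succ_apply]
      refine le_trans ?_ (ih _ (h.evolve_mem hw))
      refine (abs_min_sub_min_le_max _ _ _ _).trans ?_
      simp
  refine concaveOn_of_tendsto (convex_Ioo 0 1) hconc fun w hw => ?_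
  have h0 : Tendsto (fun N => |V (equilibrium p q) - V ((evolve p q)^[N] w)|) atTop (𝓝 0) := by
    have := ((S.tendsto_value_iterate h w).const_sub (V (equilibrium p q))).abs
    simpa using this
  have h1 := squeeze_zero_norm (f := fun N => f N w - V w) (fun N => hdist N w hw) h0
  simpa using h1.add_const (V w)

lemma strictConcaveOn : StrictConcaveOn ℝ (Ioo 0 1) V := by
  have h1 : ConcaveOn ℝ (Ioo 0 1)
      fun w => min (sampleCost p q lam V w) (V (evolve p q w)) - g :=
    ((concaveOn_sampleCost p q lam V).inf (h.concaveOn_comp_iterate (S.concaveOn h) 1)).sub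
      (convexOn_const g (convex_Ioo 0 1))
  have h2 := strictConcaveOn_entropy.add_concaveOn h1
  refine h2.congr fun w hw => ?_
  rw [S.value_eq hw, Pi.add_apply]; ring

lemma strictConcaveOn_advantage : StrictConcaveOn ℝ (Ioo 0 1) (advantage p q lam V) := by
  refine ⟨convex_Ioo 0 1, fun x hx y hy hxy a b ha hb hab => ?_⟩
  have hne : evolve p q x ≠ evolve p q y := by
    rw [h.evolve_eq, h.evolve_eq]
    intro he
    have := mul_left_cancel₀ h.decay_pos.ne' (add_left_cancel he)
    exact hxy (by linarith)
  have h1 := (S.strictConcaveOn h).2 (h.evolve_mem hx) (h.evolve_mem hy) hne ha hb hab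
  simp only [smul_eq_mul] at h1 ⊢
  rw [← evolve_combo p q hab] at h1
  simp only [advantage, sampleCost_eq]
  linear_combination h1 - (lam + V p) * hab

lemma min_lt_advantage {x y z : ℝ} (hx : x ∈ Ioo (0 : ℝ) 1) (hy : y ∈ Ioo (0 : ℝ) 1) (hxz : x < z)
    (hzy : z < y) : min (advantage p q lam V x) (advantage p q lam V y) < advantage p q lam V z :=
  (S.strictConcaveOn_advantage h).lt_on_openSegment hx hy (hxz.trans hzy).ne
    (by rw [openSegment_eq_Ioo (hxz.trans hzy)]; exact ⟨hxz, hzy⟩)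

lemma advantage_nonneg_of_between {x y z : ℝ} (hx : x ∈ Ioo (0 : ℝ) 1) (hy : y ∈ Ioo (0 : ℝ) 1)
    (hxz : x ≤ z) (hzy : z ≤ y) (ax : 0 ≤ advantage p q lam V x) (ay : 0 ≤ advantage p q lam V y) :
    0 ≤ advantage p q lam V z := by
  rcases hxz.eq_or_lt with rfl | h1
  · exact ax
  rcases hzy.eq_or_lt with rfl | h2
  · exact ay
  exact (le_min ax ay).trans (S.min_lt_advantage h hx hy h1 h2).le

lemma neg_charge_le_advantage {w : ℝ} (hw : w ∈ Ioo (0 : ℝ) 1) : -lam ≤ advantage p q lam V w := by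
  have h1 := (S.concaveOn h).2 h.q_mem h.p_mem hw.1.le (sub_pos.2 hw.2).le (by ring)
  simp only [smul_eq_mul] at h1
  rw [advantage, sampleCost, evolve_eq_mix]
  linarith

lemma neg_charge_lt_advantage {w : ℝ} (hw : w ∈ Ioo (0 : ℝ) 1) : -lam < advantage p q lam V w := by
  have h1 := (S.strictConcaveOn h).2 h.q_mem h.p_mem (by linarith [h.hsum]) hw.1 (sub_pos.2 hw.2)
    (by ring)
  simp only [smul_eq_mul] at h1
  rw [advantage, sampleCost, evolve_eq_mix]
  linarith

lemma saving_eq_zero (ha : advantage p q lam V (equilibrium p q) ≤ 0) : saving p q g = 0 := by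
  have := S.value_eq_passive h.eq_mem ha
  rw [h.evolve_equilibrium] at this
  unfold saving; linarith

lemma saving_eq_advantage (ha : 0 ≤ advantage p q lam V (equilibrium p q)) :
    saving p q g = advantage p q lam V (equilibrium p q) := by
  have := S.value_eq_active h.eq_mem ha
  rw [advantage, h.evolve_equilibrium, saving]; linarith

lemma saving_nonneg : 0 ≤ saving p q g := by
  rcases le_total (advantage p q lam V (equilibrium p q)) 0 with ha | ha
  · exact (S.saving_eq_zero h ha).ge
  · rw [S.saving_eq_advantage h ha]; exact ha

lemma advantage_eq_pos_iff : 0 < advantage p q lam V (equilibrium p q) ↔ 0 < saving p q g := by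
  constructor
  · intro ha; rwa [S.saving_eq_advantage h ha.le]
  · intro ha
    by_contra hn
    rw [S.saving_eq_zero h (not_lt.1 hn)] at ha
    exact ha.false

omit h S in
lemma orbit_dichotomy (f : ℝ → ℝ) (w : ℝ) :
    (∃ n, (∀ j < n, f ((evolve p q)^[j] w) < 0) ∧ 0 ≤ f ((evolve p q)^[n] w)) ∨
      ∀ n, f ((evolve p q)^[n] w) < 0 := by
  classical
  by_cases hex : ∃ n, 0 ≤ f ((evolve p q)^[n] w)
  · exact Or.inl ⟨Nat.find hex, fun j hj => not_le.1 (Nat.find_min hex hj), Nat.find_spec hex⟩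
  · push Not at hex
    exact Or.inr hex

lemma continuousAt_advantage {w : ℝ} (hw : w ∈ Ioo (0 : ℝ) 1) :
    ContinuousAt (advantage p q lam V) w := by
  have h1 : ContinuousAt (evolve p q) w := by unfold evolve; fun_prop
  have h2 : ContinuousAt (sampleCost p q lam V) w := by unfold sampleCost; fun_prop
  exact (ContinuousAt.comp (S.continuousAt (h.evolve_mem hw)) h1).sub h2

lemma advantage_eq_nonpos_of_forever {w : ℝ}
    (ha : ∀ n, advantage p q lam V ((evolve p q)^[n] w) ≤ 0) :
    advantage p q lam V (equilibrium p q) ≤ 0 :=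
  le_of_tendsto' ((S.continuousAt_advantage h h.eq_mem).tendsto.comp (h.tendsto_iterate w)) ha

lemma value_le_forever (hG : saving p q g = 0) {w : ℝ} (hw : w ∈ Ioo (0 : ℝ) 1) :
    V w ≤ passiveValue p q w + V (equilibrium p q) := by
  have h1 := ((h.tendsto_passiveValue_iterate hw).const_sub (passiveValue p q w)).add
    (S.tendsto_value_iterate h w)
  rw [sub_zero] at h1
  refine ge_of_tendsto' h1 fun n => ?_
  have := S.unroll_le h n hw
  rw [hG] at this
  linarith

lemma value_eq_forever {w : ℝ} (hw : w ∈ Ioo (0 : ℝ) 1)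
    (ha : ∀ n, advantage p q lam V ((evolve p q)^[n] w) ≤ 0) :
    saving p q g = 0 ∧ V w = passiveValue p q w + V (equilibrium p q) := by
  have hG := S.saving_eq_zero h (S.advantage_eq_nonpos_of_forever h ha)
  refine ⟨hG, ?_⟩
  have h1 := ((h.tendsto_passiveValue_iterate hw).const_sub (passiveValue p q w)).add
    (S.tendsto_value_iterate h w)
  rw [sub_zero] at h1
  refine tendsto_nhds_unique (tendsto_const_nhds.congr fun n => ?_) h1
  have := S.unroll_eq h n hw fun j _ => ha j
  rw [hG] at this
  linarith

omit S in
lemma sampleCost_iterate_sub (lam : ℝ) (V : ℝ → ℝ) (k : ℕ) (w : ℝ) :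
    sampleCost p q lam V ((evolve p q)^[k] w) - sampleCost p q lam V w
      = -((1 - decay p q ^ k) * (w - equilibrium p q) * spread p q V) := by
  rw [sampleCost_eq, sampleCost_eq, h.iterate_eq]; ring

/-- Bound on the advantage of sampling now, from sampling after `k` passive slots instead. The
service charge is paid in both cases and cancels. -/
lemma advantage_le {k : ℕ} (hk : 1 ≤ k) {w : ℝ} (hw : w ∈ Ioo (0 : ℝ) 1) :
    advantage p q lam V w ≤ k * saving p q g + passiveValue p q (evolve p q w)
      - passiveValue p q ((evolve p q)^[k + 1] w)
      - (1 - decay p q ^ k) * (w - equilibrium p q) * spread p q V := by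
  obtain ⟨n, rfl⟩ := Nat.exists_eq_add_of_le' hk
  have h1 := S.stop_le h n (h.evolve_mem hw)
  have h2 := sampleCost_iterate_sub h lam V (n + 1) w
  rw [← Function.iterate_succ_apply, ← Function.iterate_succ_apply] at h1
  rw [advantage]; push_cast; linarith

lemma advantage_lt {k : ℕ} (hk : 1 ≤ k) {w : ℝ} (hw : w ∈ Ioo (0 : ℝ) 1)
    (ha : advantage p q lam V ((evolve p q)^[k] w) < 0) :
    advantage p q lam V w < k * saving p q g + passiveValue p q (evolve p q w)
      - passiveValue p q ((evolve p q)^[k + 1] w)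
      - (1 - decay p q ^ k) * (w - equilibrium p q) * spread p q V := by
  obtain ⟨n, rfl⟩ := Nat.exists_eq_add_of_le' hk
  have h1 := S.stop_lt h n (h.evolve_mem hw) ha
  have h2 := sampleCost_iterate_sub h lam V (n + 1) w
  rw [← Function.iterate_succ_apply, ← Function.iterate_succ_apply] at h1
  rw [advantage]; push_cast; linarith

/-- Either the optimal policy after one passive slot samples at some time, or never. -/
lemma advantage_dichotomy {w : ℝ} (hw : w ∈ Ioo (0 : ℝ) 1) :
    (∃ k, 1 ≤ k ∧ 0 ≤ advantage p q lam V ((evolve p q)^[k] w) ∧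
      advantage p q lam V w = k * saving p q g + passiveValue p q (evolve p q w)
        - passiveValue p q ((evolve p q)^[k + 1] w)
        - (1 - decay p q ^ k) * (w - equilibrium p q) * spread p q V) ∨
    (saving p q g = 0 ∧ advantage p q lam V w = passiveValue p q (evolve p q w)
        + V (equilibrium p q) - sampleCost p q lam V w) := by
  rcases orbit_dichotomy (p := p) (q := q) (advantage p q lam V) (evolve p q w) with ⟨n, h1, h2⟩ | h1
  · left
    have h3 := S.stop_eq h n (h.evolve_mem hw) (fun j hj => (h1 j hj).le) h2
    have h4 := sampleCost_iterate_sub h lam V (n + 1) w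
    rw [← Function.iterate_succ_apply] at h2
    rw [← Function.iterate_succ_apply, ← Function.iterate_succ_apply] at h3
    refine ⟨n + 1, by omega, h2, ?_⟩
    rw [advantage]; push_cast; linarith
  · right
    obtain ⟨h2, h3⟩ := S.value_eq_forever h (h.evolve_mem hw) fun n => (h1 n).le
    exact ⟨h2, by rw [advantage, h3]⟩

lemma slackP_nonneg {n : ℕ} (hn : 1 ≤ n) :
    0 ≤ slackP p q lam (saving p q g) (spread p q V) n := by
  obtain ⟨m, rfl⟩ := Nat.exists_eq_add_of_le' hn
  have h1 := S.stop_le h m h.p_mem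
  rw [h.iterate_p, h.iterate_p, sampleCost_eq] at h1
  rw [slackP]; push_cast; linarith

lemma slackQ_nonneg {n : ℕ} (hn : 1 ≤ n) :
    0 ≤ slackQ p q lam (saving p q g) (spread p q V) n := by
  obtain ⟨m, rfl⟩ := Nat.exists_eq_add_of_le' hn
  have h1 := S.stop_le h m h.q_mem
  rw [h.iterate_q, h.iterate_q, sampleCost_eq] at h1
  rw [slackQ]; push_cast
  have : V (1 - q) = V p + spread p q V := by unfold spread; ring
  linarith

lemma slackP_eq_max {n : ℕ} (hn : 1 ≤ n)
    (ha : ∀ k, 1 ≤ k → k < n → advantage p q lam V (pStep p q k) ≤ 0) :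
    slackP p q lam (saving p q g) (spread p q V) n
      = max 0 (-advantage p q lam V (pStep p q n)) := by
  obtain ⟨m, rfl⟩ := Nat.exists_eq_add_of_le' hn
  have h0 : ∀ j < m, advantage p q lam V ((evolve p q)^[j] p) ≤ 0 := fun j hj => by
    rw [h.iterate_p]; exact ha _ (by omega) (by omega)
  have e1 := h.iterate_p m
  have e2 := h.iterate_p (m + 1)
  rcases le_total 0 (advantage p q lam V (pStep p q (m + 1))) with h1 | h1
  · have h2 := S.stop_eq h m h.p_mem h0 (by rwa [e1])
    rw [e1, e2, sampleCost_eq] at h2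
    rw [max_eq_left (by linarith), slackP]; push_cast; linarith
  · have h2 := S.unroll_eq h (m + 1) h.p_mem fun j hj => by
      rcases Nat.lt_succ_iff_lt_or_eq.1 hj with h3 | rfl
      · exact h0 j h3
      · rwa [e1]
    have e3 : evolve p q (pStep p q (m + 1)) = pStep p q (m + 1 + 1) := h.iterate_pStep 1 (m + 1)
    rw [e2] at h2
    rw [max_eq_right (by linarith), slackP, advantage, sampleCost_eq, e3]
    push_cast at h2 ⊢; linarith

lemma slackQ_eq_max {n : ℕ} (hn : 1 ≤ n)
    (ha : ∀ k, 1 ≤ k → k < n → advantage p q lam V (1 - qStep p q k) ≤ 0) :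
    slackQ p q lam (saving p q g) (spread p q V) n
      = max 0 (-advantage p q lam V (1 - qStep p q n)) := by
  obtain ⟨m, rfl⟩ := Nat.exists_eq_add_of_le' hn
  have h0 : ∀ j < m, advantage p q lam V ((evolve p q)^[j] (1 - q)) ≤ 0 := fun j hj => by
    rw [h.iterate_q]; exact ha _ (by omega) (by omega)
  have e1 := h.iterate_q m
  have e2 := h.iterate_q (m + 1)
  have e4 : V (1 - q) = V p + spread p q V := by unfold spread; ring
  rcases le_total 0 (advantage p q lam V (1 - qStep p q (m + 1))) with h1 | h1
  · have h2 := S.stop_eq h m h.q_mem h0 (by rwa [e1])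
    rw [e1, e2, sampleCost_eq] at h2
    rw [max_eq_left (by linarith), slackQ]; push_cast; linarith
  · have h2 := S.unroll_eq h (m + 1) h.q_mem fun j hj => by
      rcases Nat.lt_succ_iff_lt_or_eq.1 hj with h3 | rfl
      · exact h0 j h3
      · rwa [e1]
    have e3 : evolve p q (1 - qStep p q (m + 1)) = 1 - qStep p q (m + 1 + 1) :=
      h.iterate_qStep 1 (m + 1)
    rw [e2] at h2
    rw [max_eq_right (by linarith), slackQ, advantage, sampleCost_eq, e3]
    push_cast at h2 ⊢; linarith

lemma dichotomyP :
    (∃ L, 1 ≤ L ∧ (∀ k, 1 ≤ k → k < L → advantage p q lam V (pStep p q k) < 0) ∧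
      0 ≤ advantage p q lam V (pStep p q L) ∧
      slackP p q lam (saving p q g) (spread p q V) L = 0) ∨
    ((∀ k, 1 ≤ k → advantage p q lam V (pStep p q k) < 0) ∧ saving p q g = 0 ∧
      V p = passiveValue p q p + V (equilibrium p q)) := by
  rcases orbit_dichotomy (p := p) (q := q) (advantage p q lam V) p with ⟨n, h1, h2⟩ | h1
  · left
    rw [h.iterate_p] at h2
    have h3 : ∀ k, 1 ≤ k → k < n + 1 → advantage p q lam V (pStep p q k) < 0 := fun k hk hkn => by
      have := h1 (k - 1) (by omega)
      rwa [h.iterate_p, Nat.sub_add_cancel hk] at this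
    refine ⟨n + 1, by omega, h3, h2, ?_⟩
    rw [S.slackP_eq_max h (by omega) fun k hk hkn => (h3 k hk hkn).le, max_eq_left (by linarith)]
  · right
    refine ⟨fun k hk => ?_, S.value_eq_forever h h.p_mem fun n => (h1 n).le⟩
    have := h1 (k - 1)
    rwa [h.iterate_p, Nat.sub_add_cancel hk] at this

lemma dichotomyQ :
    (∃ K, 1 ≤ K ∧ (∀ k, 1 ≤ k → k < K → advantage p q lam V (1 - qStep p q k) < 0) ∧
      0 ≤ advantage p q lam V (1 - qStep p q K) ∧
      slackQ p q lam (saving p q g) (spread p q V) K = 0) ∨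
    ((∀ k, 1 ≤ k → advantage p q lam V (1 - qStep p q k) < 0) ∧ saving p q g = 0 ∧
      V (1 - q) = passiveValue p q (1 - q) + V (equilibrium p q)) := by
  rcases orbit_dichotomy (p := p) (q := q) (advantage p q lam V) (1 - q) with ⟨n, h1, h2⟩ | h1
  · left
    rw [h.iterate_q] at h2
    have h3 : ∀ k, 1 ≤ k → k < n + 1 → advantage p q lam V (1 - qStep p q k) < 0 :=
      fun k hk hkn => by
        have := h1 (k - 1) (by omega)
        rwa [h.iterate_q, Nat.sub_add_cancel hk] at this
    refine ⟨n + 1, by omega, h3, h2, ?_⟩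
    rw [S.slackQ_eq_max h (by omega) fun k hk hkn => (h3 k hk hkn).le, max_eq_left (by linarith)]
  · right
    refine ⟨fun k hk => ?_, S.value_eq_forever h h.q_mem fun n => (h1 n).le⟩
    have := h1 (k - 1)
    rwa [h.iterate_q, Nat.sub_add_cancel hk] at this

end IsBellmanSolution

/-! ### The equilibrium leaves the sampling region before any belief below it -/

namespace IsMonotonic

variable {p q : ℝ} (h : IsMonotonic p q)
include h

lemma eq_sub_pStep (n : ℕ) : equilibrium p q - pStep p q n = equilibrium p q * decay p q ^ n := by
  rw [h.pStep_eq]; ring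

lemma qStep_sub_eq (n : ℕ) :
    1 - qStep p q n - equilibrium p q = (1 - equilibrium p q) * decay p q ^ n := by
  rw [h.qStep_eq]; ring

/-- The value after one passive slot: a linear part, whose slope is that of the tangent at the
equilibrium, minus a total deficit. -/
lemma passiveValue_evolve (w : ℝ) :
    passiveValue p q (evolve p q w) = tangentSlope p q * decay p q / (1 - decay p q)
      * (w - equilibrium p q) - totalDeficit p q (evolve p q w) := by
  rw [passiveValue, h.evolve_eq, add_sub_cancel_left]
  ring

lemma passiveValue_p : passiveValue p q p
    = -(tangentSlope p q * decay p q / (1 - decay p q) * equilibrium p q)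
      - totalDeficit p q p := by
  have : p - equilibrium p q = -(equilibrium p q * decay p q) := by
    have := h.eq_sub_pStep 1
    rw [h.pStep_one, pow_one] at this
    linarith
  rw [passiveValue, this]; ring

lemma passiveValue_q : passiveValue p q (1 - q)
    = tangentSlope p q * decay p q / (1 - decay p q) * (1 - equilibrium p q)
      - totalDeficit p q (1 - q) := by
  have : 1 - q - equilibrium p q = (1 - equilibrium p q) * decay p q := by
    have := h.qStep_sub_eq 1
    rwa [h.qStep_one, pow_one] at this
  rw [passiveValue, this]; ring

lemma passiveValue_pStep_succ (n : ℕ) : passiveValue p q (pStep p q (n + 1))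
    = tangentSlope p q * decay p q / (1 - decay p q) * (pStep p q n - equilibrium p q)
      - totalDeficit p q (pStep p q (n + 1)) := by
  rw [← h.iterate_pStep 1 n, Function.iterate_one, h.passiveValue_evolve]

end IsMonotonic

namespace IsBellmanSolution

variable {p q lam g : ℝ} {V : ℝ → ℝ}
variable (h : IsMonotonic p q) (S : IsBellmanSolution p q lam g V)
include h S

lemma value_eq_forever_of_right
    (hneg : ∀ w ∈ Ioo (equilibrium p q) 1, advantage p q lam V w < 0) {w : ℝ}
    (hw : w ∈ Ioo (equilibrium p q) 1) :
    V w = passiveValue p q w + V (equilibrium p q) := by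
  have hw' : w ∈ Ioo (0 : ℝ) 1 := ⟨h.eq_pos.trans hw.1, hw.2⟩
  refine (S.value_eq_forever h hw' fun n => (hneg _ ⟨?_, (h.iterate_mem n hw').2⟩).le).2
  rw [h.iterate_eq]
  linarith [mul_pos (h.pow_pos n) (sub_pos.2 hw.1)]

/-- If passivity is optimal at the equilibrium, then sampling is strictly worse at every smaller
belief. Otherwise the beliefs above the equilibrium would all be passive, and the advantage would
have a negative right derivative at the equilibrium. That derivative is computed from the total
deficits of the two orbits, and their comparison contradicts its sign. -/
lemma advantage_neg_of_lt_eq (hpq : p ≤ q)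
    (hc : advantage p q lam V (equilibrium p q) ≤ 0) {z : ℝ} (hz0 : 0 < z)
    (hz : z < equilibrium p q) : advantage p q lam V z < 0 := by
  by_contra hcon
  have az : 0 ≤ advantage p q lam V z := not_lt.1 hcon
  set c := equilibrium p q with hcdef
  have zmem : z ∈ Ioo (0 : ℝ) 1 := ⟨hz0, hz.trans h.eq_lt_one⟩
  have cmem : c ∈ Ioo (0 : ℝ) 1 := h.eq_mem
  have hG : saving p q g = 0 := S.saving_eq_zero h hc
  have hneg : ∀ w ∈ Ioo c 1, advantage p q lam V w < 0 := by
    intro w hw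
    by_contra hw2
    have hw' : w ∈ Ioo (0 : ℝ) 1 := ⟨h.eq_pos.trans hw.1, hw.2⟩
    have := S.min_lt_advantage h zmem hw' hz hw.1
    exact absurd ((le_min az (not_lt.1 hw2)).trans_lt this) (not_lt.2 hc)
  -- a point strictly between, where the advantage exceeds that at the equilibrium
  obtain ⟨y, hzy, hyc⟩ := exists_between hz
  have ymem : y ∈ Ioo (0 : ℝ) 1 := ⟨hz0.trans hzy, hyc.trans h.eq_lt_one⟩
  have ayc : advantage p q lam V c < advantage p q lam V y := by
    have := S.min_lt_advantage h zmem cmem hzy hyc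
    rwa [min_eq_right (hc.trans az)] at this
  set σ := (advantage p q lam V y - advantage p q lam V c) / (c - y) with hσ
  have σpos : 0 < σ := div_pos (sub_pos.2 ayc) (sub_pos.2 hyc)
  set m := tangentSlope p q * decay p q / (1 - decay p q) with hm
  set s := spread p q V - m with hs
  have qmem : 1 - q ∈ Ioo c 1 := ⟨by
    have := h.lt_one_sub_qStep 1; rwa [h.qStep_one] at this, h.q_mem.2⟩
  have hbq := S.value_eq_forever_of_right h hneg qmem
  set M := deficitConst p q / (1 - decay p q) with hM
  have M0 : 0 ≤ M := div_nonneg h.deficitConst_pos.le h.one_sub_decay_pos.le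
  have hslope : ∀ w ∈ Ioo c 1, σ - M * (w - c) ≤ s := by
    intro w hw
    have hw' : w ∈ Ioo (0 : ℝ) 1 := ⟨h.eq_pos.trans hw.1, hw.2⟩
    have hcw : 0 < w - c := sub_pos.2 hw.1
    have hev : evolve p q w ∈ Ioo c 1 := by
      refine ⟨?_, (h.evolve_mem hw').2⟩
      rw [h.evolve_eq, ← hcdef]; linarith [mul_pos h.decay_pos hcw]
    have e1 := S.value_eq_forever_of_right h hneg hev
    have e2 := h.passiveValue_evolve w
    have e3 := h.totalDeficit_le (h.evolve_mem hw')
    have e4 : (evolve p q w - c) ^ 2 ≤ (w - c) ^ 2 := by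
      rw [h.evolve_eq, ← hcdef, add_sub_cancel_left]
      nlinarith [h.decay_lt_one, h.decay_pos, mul_pos h.decay_pos hcw,
        mul_pos (sub_pos.2 h.decay_lt_one) hcw]
    have e5 := mul_le_mul_of_nonneg_left e4 M0
    have e6 : advantage p q lam V w - advantage p q lam V c
        = passiveValue p q (evolve p q w) - (w - c) * spread p q V := by
      rw [advantage, advantage, e1, sampleCost_eq, sampleCost_eq, h.evolve_equilibrium]
      ring
    -- three-slope inequality
    have e7 : (advantage p q lam V w - advantage p q lam V c) / (w - c)
        ≤ (advantage p q lam V c - advantage p q lam V y) / (c - y) :=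
      (S.strictConcaveOn_advantage h).concaveOn.slope_anti_adjacent ymem hw' hyc hw.1
    have e8 : (advantage p q lam V c - advantage p q lam V y) / (c - y) = -σ := by
      rw [hσ, ← neg_div, neg_sub]
    rw [e8, div_le_iff₀ hcw] at e7
    have e9 : (σ - M * (w - c)) * (w - c) ≤ s * (w - c) := by
      rw [← hcdef, ← hm] at e2
      rw [← hcdef, ← hM] at e3
      rw [hs]; nlinarith
    exact le_of_mul_le_mul_right e9 hcw
  have spos : 0 < s := by
    have ht : Tendsto (fun w => σ - M * (w - c)) (𝓝[>] c) (𝓝 (σ - M * (c - c))) :=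
      (Continuous.tendsto (by fun_prop) c).mono_left nhdsWithin_le_nhds
    have : σ - M * (c - c) ≤ s :=
      le_of_tendsto ht (by
        filter_upwards [Ioo_mem_nhdsGT h.eq_lt_one] with w hw using hslope w hw)
    linarith [this, mul_zero M, sub_self c, mul_comm M (c - c)]
  have hd := h.totalDeficit_p_le_q hpq
  have vq := h.passiveValue_q
  have vp := h.passiveValue_p
  rw [← hcdef, ← hm] at vq vp
  have hspread : V (1 - q) - V p = s + m := by rw [hs]; unfold spread; ring
  rcases S.dichotomyP h with ⟨L, hL, -, -, h0⟩ | ⟨-, -, h0⟩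
  · have e1 := h.passiveValue_pStep_succ L
    have e2 := h.totalDeficit_nonneg (h.pStep_mem (by omega : 1 ≤ L + 1))
    rw [← hcdef, ← hm] at e1
    have e3 : V c ≤ sampleCost p q lam V c := by
      have := sub_nonpos.1 hc
      rwa [h.evolve_equilibrium] at this
    rw [sampleCost_eq] at e3
    rw [slackP, hG] at h0
    have e4 : spread p q V = s + m := hspread
    rw [e4] at h0 e3
    have pL := (h.pStep_mem hL).1
    have c1 : 0 < 1 - c := sub_pos.2 h.eq_lt_one
    nlinarith [mul_pos pL spos, mul_pos c1 spos]
  · rw [← hcdef] at h0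
    linarith

end IsBellmanSolution

/-! ### Comparison of solutions for two service charges -/

namespace IsMonotonic

variable {p q : ℝ} (h : IsMonotonic p q)
include h

lemma one_sub_pow_pos {k : ℕ} (hk : 1 ≤ k) : 0 < 1 - decay p q ^ k := sub_pos.2 (h.pow_lt_one hk)

/-- Incompatible estimates on the change `d` of the average penalty and the change `y` of the spread,
when a cycle of `L` slots starts at distance `C` from the equilibrium and samples no earlier than at
distance `x`. -/
lemma no_crossing {C x y d : ℝ} {L : ℕ} (hL : 1 ≤ L) (hy : 0 ≤ y)
    (hx : x ≤ C * decay p q ^ (L - 1)) (h1 : C * (1 - decay p q ^ L) * y < L * d)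
    (h2 : d ≤ (1 - decay p q) * x * y) (hC : 0 < C) : False := by
  have e1 := mul_le_mul_of_nonneg_left (h.mul_pow_le hL) hC.le
  have e2 : (0 : ℝ) ≤ L * (1 - decay p q) * y :=
    mul_nonneg (mul_nonneg (Nat.cast_nonneg _) h.one_sub_decay_pos.le) hy
  have e3 := mul_le_mul_of_nonneg_left hx e2
  have e4 := mul_le_mul_of_nonneg_left h2 (Nat.cast_nonneg (α := ℝ) L)
  have e5 := mul_le_mul_of_nonneg_right e1 hy
  nlinarith

/-- Every fundamental domain `[evolve w, w]` above the equilibrium meets the orbit of `1 - q`. -/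
lemma exists_orbit_point {w : ℝ} (hcw : equilibrium p q < w) (hw1 : w < 1) :
    ∃ k, 1 ≤ k ∧ 1 - qStep p q k ≤ w ∧ evolve p q w ≤ 1 - qStep p q k ∧
      w - equilibrium p q ≤ (1 - equilibrium p q) * decay p q ^ (k - 1) := by
  classical
  have hex : ∃ k, 1 - qStep p q (k + 1) ≤ w := by
    have h1 := h.tendsto_iterate (1 - q)
    obtain ⟨k, hk⟩ := (h1.eventually (gt_mem_nhds hcw)).exists
    rw [h.iterate_q] at hk
    exact ⟨k, hk.le⟩
  have hdist : w - equilibrium p q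
      ≤ (1 - equilibrium p q) * decay p q ^ (Nat.find hex) := by
    rcases Nat.eq_zero_or_pos (Nat.find hex) with h0 | h0
    · rw [h0, pow_zero]; linarith
    · have := not_le.1 (Nat.find_min hex (Nat.sub_lt h0 one_pos))
      rw [Nat.sub_add_cancel (Nat.one_le_iff_ne_zero.2 h0.ne')] at this
      rw [← h.qStep_sub_eq]; linarith
  refine ⟨Nat.find hex + 1, by omega, Nat.find_spec hex, ?_, by simpa using hdist⟩
  have e1 := h.qStep_sub_eq (Nat.find hex + 1)
  have e2 := mul_le_mul_of_nonneg_left hdist h.decay_pos.le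
  rw [h.evolve_eq]
  rw [pow_succ] at e1
  linarith

end IsMonotonic

lemma slackP_sub (p q lam G D lam' G' D' : ℝ) (n : ℕ) :
    slackP p q lam' G' D' n - slackP p q lam G D n
      = n * (G' - G) + (lam' - lam) + pStep p q n * (D' - D) := by
  unfold slackP; ring

lemma slackQ_sub (p q lam G D lam' G' D' : ℝ) (n : ℕ) :
    slackQ p q lam' G' D' n - slackQ p q lam G D n
      = n * (G' - G) + (lam' - lam) - qStep p q n * (D' - D) := by
  unfold slackQ; ring

/-- The spread of the relative values under permanent passivity. -/
noncomputable def passiveSpread (p q : ℝ) : ℝ := passiveValue p q (1 - q) - passiveValue p q p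

namespace IsBellmanSolution

section single

variable {p q lam g : ℝ} {V : ℝ → ℝ}
variable (h : IsMonotonic p q) (S : IsBellmanSolution p q lam g V)
include h S

lemma exists_stopP (hG : 0 < saving p q g) :
    ∃ L, 1 ≤ L ∧ (∀ k, 1 ≤ k → k < L → advantage p q lam V (pStep p q k) < 0) ∧
      0 ≤ advantage p q lam V (pStep p q L) ∧
      slackP p q lam (saving p q g) (spread p q V) L = 0 := by
  rcases S.dichotomyP h with h1 | ⟨-, h1, -⟩
  · exact h1
  · exact absurd h1 hG.ne'

lemma exists_stopQ (hG : 0 < saving p q g) :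
    ∃ K, 1 ≤ K ∧ (∀ k, 1 ≤ k → k < K → advantage p q lam V (1 - qStep p q k) < 0) ∧
      0 ≤ advantage p q lam V (1 - qStep p q K) ∧
      slackQ p q lam (saving p q g) (spread p q V) K = 0 := by
  rcases S.dichotomyQ h with h1 | ⟨-, h1, -⟩
  · exact h1
  · exact absurd h1 hG.ne'

lemma saving_pos_or : 0 < saving p q g ∨
    (saving p q g = 0 ∧ advantage p q lam V (equilibrium p q) ≤ 0) := by
  rcases lt_or_ge 0 (advantage p q lam V (equilibrium p q)) with h1 | h1
  · exact Or.inl ((S.advantage_eq_pos_iff h).1 h1)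
  · exact Or.inr ⟨S.saving_eq_zero h h1, h1⟩

lemma value_p_of_saving_eq_zero (hpq : p ≤ q) (hG : saving p q g = 0) :
    V p = passiveValue p q p + V (equilibrium p q) := by
  rcases S.saving_pos_or h with h1 | ⟨-, h1⟩
  · exact absurd hG h1.ne'
  refine (S.value_eq_forever h h.p_mem fun n => ?_).2
  rw [h.iterate_p]
  exact (S.advantage_neg_of_lt_eq h hpq h1 (h.pStep_mem (by omega)).1 (h.pStep_lt _)).le

lemma spread_le_passiveSpread (hpq : p ≤ q) (hG : saving p q g = 0) :
    spread p q V ≤ passiveSpread p q := by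
  have h1 := S.value_p_of_saving_eq_zero h hpq hG
  have h2 := S.value_le_forever h hG h.q_mem
  unfold spread passiveSpread; linarith

lemma spread_eq_or (hpq : p ≤ q) (hG : saving p q g = 0) : spread p q V = passiveSpread p q ∨
    ∃ K, 1 ≤ K ∧ slackQ p q lam 0 (spread p q V) K = 0 := by
  rcases S.dichotomyQ h with ⟨K, hK, -, -, h1⟩ | ⟨-, -, h1⟩
  · right; rw [hG] at h1; exact ⟨K, hK, h1⟩
  · left
    have h2 := S.value_p_of_saving_eq_zero h hpq hG
    unfold spread passiveSpread; linarith

lemma forever_eq (hpq : p ≤ q) (hG : saving p q g = 0) (w : ℝ) :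
    V (equilibrium p q) - sampleCost p q lam V w
      = -passiveValue p q p - lam - w * spread p q V := by
  rw [sampleCost_eq, S.value_p_of_saving_eq_zero h hpq hG]; ring

lemma advantage_le_forever (hpq : p ≤ q) (hG : saving p q g = 0) {w : ℝ}
    (hw : w ∈ Ioo (0 : ℝ) 1) : advantage p q lam V w
      ≤ passiveValue p q (evolve p q w) - passiveValue p q p - lam - w * spread p q V := by
  have h1 := S.value_le_forever h hG (h.evolve_mem hw)
  have h2 := S.forever_eq h hpq hG w
  unfold advantage; linarith

lemma advantage_equilibrium (hpq : p ≤ q) (hG : saving p q g = 0) :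
    advantage p q lam V (equilibrium p q)
      = -passiveValue p q p - lam - equilibrium p q * spread p q V := by
  rw [advantage, h.evolve_equilibrium, S.forever_eq h hpq hG]

end single

section pair

variable {p q lam g lam' g' : ℝ} {V V' : ℝ → ℝ}
variable (h : IsMonotonic p q) (S : IsBellmanSolution p q lam g V)
  (S' : IsBellmanSolution p q lam' g' V')
include h S S'

omit S' in
lemma stopP_ineq {L : ℕ} (hL : 1 ≤ L)
    (h0 : slackP p q lam' (saving p q g') (spread p q V') L = 0) :
    (lam' - lam) + pStep p q L * (spread p q V' - spread p q V)
      ≤ L * (saving p q g - saving p q g') := by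
  have h1 := S.slackP_nonneg h hL
  have h2 := slackP_sub p q lam (saving p q g) (spread p q V) lam' (saving p q g')
    (spread p q V') L
  linarith

omit S' in
lemma stopQ_ineq {K : ℕ} (hK : 1 ≤ K)
    (h0 : slackQ p q lam' (saving p q g') (spread p q V') K = 0) :
    (lam' - lam) - qStep p q K * (spread p q V' - spread p q V)
      ≤ K * (saving p q g - saving p q g') := by
  have h1 := S.slackQ_nonneg h hK
  have h2 := slackQ_sub p q lam (saving p q g) (spread p q V) lam' (saving p q g')
    (spread p q V') K
  linarith

lemma mul_sub_le_saving_sub (hG' : 0 < saving p q g') :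
    ∃ L : ℕ, 1 ≤ L ∧ lam' - lam ≤ L * (saving p q g - saving p q g') := by
  obtain ⟨L, hL, -, -, hL0⟩ := S'.exists_stopP h hG'
  obtain ⟨K, hK, -, -, hK0⟩ := S'.exists_stopQ h hG'
  have h1 := S.stopP_ineq h hL hL0
  have h2 := S.stopQ_ineq h hK hK0
  rcases le_total 0 (spread p q V' - spread p q V) with h3 | h3
  · exact ⟨L, hL, by nlinarith [mul_nonneg (h.pStep_mem hL).1.le h3]⟩
  · have : 0 ≤ qStep p q K := h.hq.le.trans (h.q_le_qStep hK)
    exact ⟨K, hK, by nlinarith [mul_nonneg this (neg_nonneg.2 h3)]⟩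

lemma saving_antitone (hlam : lam ≤ lam') : saving p q g' ≤ saving p q g := by
  rcases S'.saving_pos_or h with hG' | ⟨hG', -⟩
  · obtain ⟨L, hL, h1⟩ := S.mul_sub_le_saving_sub h S' hG'
    have hL' : (0 : ℝ) < L := by exact_mod_cast hL
    by_contra hcon
    nlinarith [mul_pos hL' (sub_pos.2 (not_le.1 hcon))]
  · rw [hG']; exact S.saving_nonneg h

lemma saving_strictAnti (hlam : lam < lam') (hG' : 0 < saving p q g') :
    saving p q g' < saving p q g := by
  obtain ⟨L, hL, h1⟩ := S.mul_sub_le_saving_sub h S' hG'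
  have hL' : (0 : ℝ) < L := by exact_mod_cast hL
  by_contra hcon
  nlinarith [mul_nonneg hL'.le (sub_nonneg.2 (not_lt.1 hcon))]

/-- The average penalty and the spread are Lipschitz functions of the service charge. -/
lemma lipschitz (hpq : p ≤ q) (hlam : lam ≤ lam') :
    p * |spread p q V' - spread p q V| ≤ lam' - lam ∧
      p * (saving p q g - saving p q g') ≤ 2 * (lam' - lam) := by
  have hp := h.hp
  have hp1 := h.p_mem.2
  have h0 := S.saving_antitone h S' hlam
  rcases S.saving_pos_or h with hG | ⟨hG, -⟩
  · obtain ⟨L, hL, -, -, hL0⟩ := S.exists_stopP h hG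
    obtain ⟨K, hK, -, -, hK0⟩ := S.exists_stopQ h hG
    have h1 := S'.stopP_ineq h hL hL0
    have h2 := S'.stopQ_ineq h hK hK0
    have hL' : (1 : ℝ) ≤ L := by exact_mod_cast hL
    have hK' : (1 : ℝ) ≤ K := by exact_mod_cast hK
    have hpL := h.p_le_pStep hL
    have hpL1 := (h.pStep_mem hL).2
    have hqK := hpq.trans (h.q_le_qStep hK)
    have hqK1 := h.qStep_lt_one K
    set dD := spread p q V' - spread p q V
    set dG := saving p q g - saving p q g' with hdG
    have hdG0 : 0 ≤ dG := sub_nonneg.2 h0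
    have a1 := mul_le_mul_of_nonneg_right hL' hdG0
    have a2 := mul_le_mul_of_nonneg_right hK' hdG0
    rcases le_total 0 dD with hd | hd
    · rw [abs_of_nonneg hd]
      have a3 := mul_le_mul_of_nonneg_right hqK hd
      have a4 := mul_nonneg (hp.le.trans hqK) hd
      exact ⟨by nlinarith, by nlinarith⟩
    · rw [abs_of_nonpos hd]
      have a3 := mul_le_mul_of_nonneg_right hpL (neg_nonneg.2 hd)
      have a4 := mul_nonneg (hp.le.trans hpL) (neg_nonneg.2 hd)
      exact ⟨by nlinarith, by nlinarith⟩
  · have hG' : saving p q g' = 0 := le_antisymm (hG ▸ h0) (S'.saving_nonneg h)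
    have hd0 : 0 ≤ spread p q V' - spread p q V := by
      rcases S'.spread_eq_or h hpq hG' with h1 | ⟨K, hK, h1⟩
      · rw [h1]; exact sub_nonneg.2 (S.spread_le_passiveSpread h hpq hG)
      · have h2 := S.stopQ_ineq h hK (by rwa [hG'])
        rw [hG, hG'] at h2
        have hqK := h.hq.trans_le (h.q_le_qStep hK)
        by_contra hcon
        nlinarith [mul_pos hqK (neg_pos.2 (not_le.1 hcon))]
    rw [hG, hG', abs_of_nonneg hd0]
    refine ⟨?_, by linarith⟩
    rcases S.spread_eq_or h hpq hG with h1 | ⟨K, hK, h1⟩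
    · have := S'.spread_le_passiveSpread h hpq hG'
      nlinarith
    · have h2 := S'.stopQ_ineq h hK (by rwa [hG])
      rw [hG, hG'] at h2
      have hqK := hpq.trans (h.q_le_qStep hK)
      nlinarith [mul_le_mul_of_nonneg_right hqK hd0]

omit S in
/-- Transfer of the bound that results from sampling after `k` slots. -/
lemma advantage_sub_le {k : ℕ} (hk : 1 ≤ k) {w : ℝ} (hw : w ∈ Ioo (0 : ℝ) 1)
    (h1 : advantage p q lam V w = k * saving p q g + passiveValue p q (evolve p q w)
        - passiveValue p q ((evolve p q)^[k + 1] w)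
        - (1 - decay p q ^ k) * (w - equilibrium p q) * spread p q V) :
    advantage p q lam' V' w ≤ advantage p q lam V w - k * (saving p q g - saving p q g')
      - (1 - decay p q ^ k) * (w - equilibrium p q) * (spread p q V' - spread p q V) := by
  have := S'.advantage_le h hk hw
  rw [h1]; linarith

end pair

/-- For a given service charge, all solutions agree on the advantage of sampling. -/
lemma advantage_unique {p q lam g g' : ℝ} {V V' : ℝ → ℝ} (h : IsMonotonic p q) (hpq : p ≤ q)
    (S : IsBellmanSolution p q lam g V) (S' : IsBellmanSolution p q lam g' V') {w : ℝ}
    (hw : w ∈ Ioo (0 : ℝ) 1) : advantage p q lam V w = advantage p q lam V' w := by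
  have key : ∀ {g g' : ℝ} {V V' : ℝ → ℝ}, IsBellmanSolution p q lam g V →
      IsBellmanSolution p q lam g' V' → advantage p q lam V' w ≤ advantage p q lam V w := by
    intro g g' V V' S S'
    have h1 := (S.lipschitz h S' hpq le_rfl).1
    have h2 : saving p q g = saving p q g' :=
      le_antisymm (S'.saving_antitone h S le_rfl) (S.saving_antitone h S' le_rfl)
    have h3 : spread p q V' - spread p q V = 0 := by
      rw [sub_self] at h1
      exact abs_nonpos_iff.1 (nonpos_of_mul_nonpos_right h1 h.hp)
    rcases S.advantage_dichotomy h hw with ⟨k, hk, -, h4⟩ | ⟨hG, h4⟩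
    · have := S'.advantage_sub_le h hk hw h4
      rw [h3, h2] at this
      linarith
    · have h5 := S'.advantage_le_forever h hpq (h2 ▸ hG) hw
      have h6 := S.forever_eq h hpq hG w
      rw [sub_eq_zero.1 h3] at h5
      linarith
  exact le_antisymm (key S' S) (key S S')

end IsBellmanSolution

/-! ### Beliefs leave the sampling region for good -/

namespace IsBellmanSolution

variable {p q lam g lam' g' : ℝ} {V V' : ℝ → ℝ}

section single
variable (h : IsMonotonic p q) (S : IsBellmanSolution p q lam g V)
include h S

/-- If sampling is optimal at `w` and at the first orbit point of `1 - q` where it is, then `w` is no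
further from the equilibrium than the previous orbit point. -/
lemma dist_le_of_stopQ {K : ℕ} (hK : 1 ≤ K)
    (hfirst : ∀ k, 1 ≤ k → k < K → advantage p q lam V (1 - qStep p q k) < 0)
    (hact : 0 ≤ advantage p q lam V (1 - qStep p q K)) {w : ℝ} (hw : w ∈ Ioo (0 : ℝ) 1)
    (aw : 0 ≤ advantage p q lam V w) :
    w - equilibrium p q ≤ (1 - equilibrium p q) * decay p q ^ (K - 1) := by
  rcases Nat.eq_or_lt_of_le hK with rfl | hK1
  · simpa using hw.2.le
  · by_contra hcon
    rw [← h.qStep_sub_eq] at hcon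
    have hKK := h.qStep_strictMono (show K - 1 < K by omega)
    have := S.advantage_nonneg_of_between h (h.qStep_mem hK) hw (z := 1 - qStep p q (K - 1))
      (by linarith) (by linarith) hact aw
    exact absurd this (not_le.2 (hfirst (K - 1) (by omega) (by omega)))

lemma dist_le_of_stopP {L : ℕ} (hL : 1 ≤ L)
    (hfirst : ∀ k, 1 ≤ k → k < L → advantage p q lam V (pStep p q k) < 0)
    (hact : 0 ≤ advantage p q lam V (pStep p q L)) {w : ℝ} (hw : w ∈ Ioo (0 : ℝ) 1)
    (aw : 0 ≤ advantage p q lam V w) :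
    equilibrium p q - w ≤ equilibrium p q * decay p q ^ (L - 1) := by
  rcases Nat.eq_or_lt_of_le hL with rfl | hL1
  · simpa using hw.1.le
  · by_contra hcon
    rw [← h.eq_sub_pStep] at hcon
    have hLL := h.pStep_strictMono (show L - 1 < L by omega)
    have := S.advantage_nonneg_of_between h hw (h.pStep_mem hL) (z := pStep p q (L - 1))
      (by linarith) (by linarith) aw hact
    exact absurd this (not_le.2 (hfirst (L - 1) (by omega) (by omega)))

/-- If sampling is optimal at `w` but at no orbit point of `1 - q`, then it is not optimal anywhere on
the later passive orbit of `w`. -/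
lemma advantage_iterate_neg
    (hnone : ∀ k, 1 ≤ k → advantage p q lam V (1 - qStep p q k) < 0) {w : ℝ}
    (hcw : equilibrium p q < w) (hw1 : w < 1) (aw : 0 ≤ advantage p q lam V w) {j : ℕ}
    (hj : 1 ≤ j) : advantage p q lam V ((evolve p q)^[j] w) < 0 := by
  have hw : w ∈ Ioo (0 : ℝ) 1 := ⟨h.eq_pos.trans hcw, hw1⟩
  obtain ⟨k, hk, h1, h2, -⟩ := h.exists_orbit_point hcw hw1
  by_contra hcon
  have h3 : (evolve p q)^[j] w ≤ evolve p q w := by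
    have : decay p q ^ j ≤ decay p q :=
      pow_le_of_le_one h.decay_pos.le h.decay_lt_one.le (by omega)
    rw [h.iterate_eq, h.evolve_eq]
    linarith [mul_le_mul_of_nonneg_right this (sub_pos.2 hcw).le]
  have := S.advantage_nonneg_of_between h (h.iterate_mem j hw) hw (h3.trans h2) h1
    (not_lt.1 hcon) aw
  exact absurd this (not_le.2 (hnone k hk))

end single

variable (h : IsMonotonic p q) (S : IsBellmanSolution p q lam g V)
  (S' : IsBellmanSolution p q lam' g' V')
include h S S'

/-- The consequence for the average penalty and the spread of a belief that is passive for the lower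
charge and active for the higher one. -/
lemma saving_sub_le_of_crossing {w : ℝ} (hw : w ∈ Ioo (0 : ℝ) 1) (hG : 0 < saving p q g)
    (aw : advantage p q lam V w ≤ 0) (aw' : 0 ≤ advantage p q lam' V' w)
    (hd : 0 < saving p q g - saving p q g') :
    0 < (equilibrium p q - w) * (spread p q V' - spread p q V) ∧
    saving p q g - saving p q g' ≤
      (1 - decay p q) * ((equilibrium p q - w) * (spread p q V' - spread p q V)) := by
  rcases S.advantage_dichotomy h hw with ⟨k, hk, -, h4⟩ | ⟨h1, -⟩
  swap
  · exact absurd h1 hG.ne'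
  have h5 := S'.advantage_sub_le h hk hw h4
  have hk0 : (0 : ℝ) < k := by exact_mod_cast hk
  have h6 := h.one_sub_pow_pos hk
  have h7 := h.one_sub_pow_le k
  set dG := saving p q g - saving p q g'
  set X := (equilibrium p q - w) * (spread p q V' - spread p q V) with hX
  have h8 : k * dG ≤ (1 - decay p q ^ k) * X := by rw [hX]; linarith
  have hX0 : 0 < X := pos_of_mul_pos_right ((mul_pos hk0 hd).trans_le h8) h6.le
  refine ⟨hX0, ?_⟩
  have h9 := mul_le_mul_of_nonneg_right h7 hX0.le
  exact le_of_mul_le_mul_left (by linarith) hk0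

/-- A passive belief becomes strictly passive: the case that the equilibrium is strictly active for
both charges. The cycle on the same side of the equilibrium as `w` limits how much the average
penalty can change, and this is too little for `w` to become active. -/
lemma advantage_neg_of_eq_active (hlam : lam < lam')
    (ac : 0 < advantage p q lam' V' (equilibrium p q)) {w : ℝ} (hw : w ∈ Ioo (0 : ℝ) 1)
    (aw : advantage p q lam V w ≤ 0) : advantage p q lam' V' w < 0 := by
  by_contra hcon
  have aw' := not_lt.1 hcon
  have hG' := (S'.advantage_eq_pos_iff h).1 ac
  have hd := sub_pos.2 (S.saving_strictAnti h S' hlam hG')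
  have hG : 0 < saving p q g := by linarith
  obtain ⟨h1, h2⟩ := S.saving_sub_le_of_crossing h S' hw hG aw aw' hd
  obtain ⟨L, hL, L1, L2, hL0⟩ := S'.exists_stopP h hG'
  obtain ⟨K, hK, K1, K2, hK0⟩ := S'.exists_stopQ h hG'
  have h3 := S.stopP_ineq h hL hL0
  have h4 := S.stopQ_ineq h hK hK0
  rw [h.pStep_eq] at h3
  rw [h.qStep_eq] at h4
  rcases lt_trichotomy w (equilibrium p q) with hwc | rfl | hwc
  · have hy := pos_of_mul_pos_right h1 (sub_pos.2 hwc).le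
    exact h.no_crossing (d := saving p q g - saving p q g') hL hy.le
      (S'.dist_le_of_stopP h hL L1 L2 hw aw') (by linarith) (by linarith) h.eq_pos
  · simp at h1
  · have hy : 0 < -(spread p q V' - spread p q V) :=
      pos_of_mul_pos_right (a := w - equilibrium p q) (by linarith) (sub_pos.2 hwc).le
    exact h.no_crossing (d := saving p q g - saving p q g') hK hy.le
      (S'.dist_le_of_stopQ h hK K1 K2 hw aw') (by linarith) (by linarith) (sub_pos.2 h.eq_lt_one)

/-- A passive belief becomes strictly passive: the case that the equilibrium is passive for both
charges. Both savings vanish, and the spread does not decrease. -/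
lemma advantage_neg_of_eq_passive (hpq : p ≤ q) (hlam : lam < lam')
    (ac : advantage p q lam V (equilibrium p q) ≤ 0)
    (ac' : advantage p q lam' V' (equilibrium p q) ≤ 0) {w : ℝ} (hw : w ∈ Ioo (0 : ℝ) 1)
    (aw : advantage p q lam V w ≤ 0) : advantage p q lam' V' w < 0 := by
  rcases lt_or_ge w (equilibrium p q) with hwc | hwc
  · exact S'.advantage_neg_of_lt_eq h hpq ac' hw.1 hwc
  have hG := S.saving_eq_zero h ac
  have hG' := S'.saving_eq_zero h ac'
  have hd0 : 0 ≤ spread p q V' - spread p q V ∧ ((∃ K, 1 ≤ K ∧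
      0 ≤ advantage p q lam' V' (1 - qStep p q K)) → 0 < spread p q V' - spread p q V) := by
    rcases S'.dichotomyQ h with ⟨K, hK, -, -, h1⟩ | ⟨h0, -, h1⟩
    · have h2 := S.stopQ_ineq h hK h1
      rw [hG, hG'] at h2
      have hqK := h.hq.trans_le (h.q_le_qStep hK)
      have : 0 < spread p q V' - spread p q V := by
        by_contra hcon
        nlinarith [mul_nonneg hqK.le (neg_nonneg.2 (not_lt.1 hcon))]
      exact ⟨this.le, fun _ => this⟩
    · have h2 := S'.value_p_of_saving_eq_zero h hpq hG'
      have h3 := S.spread_le_passiveSpread h hpq hG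
      refine ⟨?_, fun ⟨K, hK, h4⟩ => absurd (h0 K hK) (not_lt.2 h4)⟩
      unfold spread passiveSpread at *; linarith
  obtain ⟨hd, hdpos⟩ := hd0
  rcases hwc.eq_or_lt with rfl | hwc
  · rw [S.advantage_equilibrium h hpq hG] at aw
    rw [S'.advantage_equilibrium h hpq hG']
    linarith [mul_nonneg h.eq_pos.le hd]
  rcases S.advantage_dichotomy h hw with ⟨k, hk, -, h4⟩ | ⟨-, h4⟩
  · have hpos := mul_pos (h.one_sub_pow_pos hk) (sub_pos.2 hwc)
    have h5 := S'.advantage_sub_le h hk hw h4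
    rw [hG, hG', sub_zero, mul_zero, sub_zero] at h5
    by_cases hex : ∃ K, 1 ≤ K ∧ 0 ≤ advantage p q lam' V' (1 - qStep p q K)
    · linarith [mul_pos hpos (hdpos hex)]
    · push Not at hex
      by_contra hcon
      have h6 := S'.advantage_lt h hk hw
        (S'.advantage_iterate_neg h hex hwc hw.2 (not_lt.1 hcon) hk)
      rw [hG] at h4
      rw [hG'] at h6
      have h7 := mul_nonneg hpos.le hd
      linarith [not_lt.1 hcon]
  · have h5 := S'.advantage_le_forever h hpq hG' hw
    have h6 := S.forever_eq h hpq hG w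
    have h7 := mul_nonneg hw.1.le hd
    linarith

/-- A passive belief becomes strictly passive: the case that the equilibrium is strictly active for
the lower charge and passive for the higher one. -/
lemma advantage_neg_of_eq_change (hpq : p ≤ q) (hlam : lam < lam')
    (ac : 0 < advantage p q lam V (equilibrium p q))
    (ac' : advantage p q lam' V' (equilibrium p q) ≤ 0) {w : ℝ} (hw : w ∈ Ioo (0 : ℝ) 1)
    (aw : advantage p q lam V w ≤ 0) : advantage p q lam' V' w < 0 := by
  rcases lt_trichotomy w (equilibrium p q) with hwc | rfl | hwc
  · exact S'.advantage_neg_of_lt_eq h hpq ac' hw.1 hwc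
  · exact absurd aw (not_le.2 ac)
  by_contra hcon
  have aw' := not_lt.1 hcon
  have hG := (S.advantage_eq_pos_iff h).1 ac
  have hG' := S'.saving_eq_zero h ac'
  obtain ⟨h1, h2⟩ := S.saving_sub_le_of_crossing h S' hw hG aw aw' (by linarith)
  have hy : 0 < -(spread p q V' - spread p q V) :=
    pos_of_mul_pos_right (a := w - equilibrium p q) (by linarith) (sub_pos.2 hwc).le
  have key : ∃ k, 1 ≤ k ∧ w - equilibrium p q ≤ (1 - equilibrium p q) * decay p q ^ (k - 1) ∧
      qStep p q k * (-(spread p q V' - spread p q V)) < k * (saving p q g - saving p q g') := by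
    rcases S'.dichotomyQ h with ⟨K, hK, K1, K2, hK0⟩ | ⟨hnone, -, h0⟩
    · exact ⟨K, hK, S'.dist_le_of_stopQ h hK K1 K2 hw aw', by linarith [S.stopQ_ineq h hK hK0]⟩
    obtain ⟨k, hk, k1, -, k3⟩ := h.exists_orbit_point hwc hw.2
    refine ⟨k, hk, k3, ?_⟩
    have hp0 := S'.value_p_of_saving_eq_zero h hpq hG'
    have hD' : spread p q V' = passiveSpread p q := by
      unfold spread passiveSpread; linarith
    -- the charge is below the advantage of sampling at the equilibrium under permanent passivity
    have hlt : lam < -passiveValue p q p - equilibrium p q * spread p q V' := by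
      obtain ⟨L, hL, -, -, hL0⟩ := S.exists_stopP h hG
      have hL' : (0 : ℝ) < L := by exact_mod_cast hL
      rw [slackP, h.passiveValue_pStep_succ] at hL0
      have e1 := h.totalDeficit_nonneg (h.pStep_mem (by omega : 1 ≤ L + 1))
      have e2 := h.totalDeficit_p_le_q hpq
      have e3 := h.passiveValue_p
      have e4 := h.passiveValue_q
      have e5 := mul_pos hL' hG
      have e6 := mul_pos (h.pStep_mem hL).1 hy
      have e7 : spread p q V' ≤ tangentSlope p q * decay p q / (1 - decay p q) := by
        rw [hD', passiveSpread, e3, e4]; linarith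
      have e8 := mul_le_mul_of_nonneg_left e7 (sub_pos.2 (h.pStep_lt L)).le
      linarith
    have hyk : 1 - qStep p q k ∈ Ioo (0 : ℝ) 1 := h.qStep_mem hk
    have hadv : advantage p q lam' V' (equilibrium p q)
        ≤ advantage p q lam' V' (1 - qStep p q k) := by
      rcases k1.eq_or_lt with k1 | k1
      · rw [k1]; exact ac'.trans aw'
      · have := S'.min_lt_advantage h h.eq_mem hw (h.lt_one_sub_qStep k) k1
        rw [min_eq_left (ac'.trans aw')] at this
        exact this.le
    have hval : advantage p q lam' V' (1 - qStep p q k)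
        ≤ passiveValue p q (1 - qStep p q (k + 1)) - passiveValue p q p - lam'
          - (1 - qStep p q k) * spread p q V' := by
      have := S'.advantage_le_forever h hpq hG' hyk
      rwa [show evolve p q (1 - qStep p q k) = 1 - qStep p q (k + 1) from
        h.iterate_qStep 1 k] at this
    rw [S'.advantage_equilibrium h hpq hG'] at hadv
    have hs := S.slackQ_nonneg h hk
    rw [slackQ] at hs
    rw [hG']
    have hq' : spread p q V' = passiveValue p q (1 - q) - passiveValue p q p := hD'
    linarith
  obtain ⟨k, hk, k1, k2⟩ := key
  rw [h.qStep_eq] at k2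
  exact h.no_crossing hk hy.le k1 k2 (by linarith) (sub_pos.2 h.eq_lt_one)

/-- A belief at which passivity is optimal is strictly passive for every higher service charge. -/
theorem advantage_neg_of_lt (hpq : p ≤ q) (hlam : lam < lam') {w : ℝ} (hw : w ∈ Ioo (0 : ℝ) 1)
    (aw : advantage p q lam V w ≤ 0) : advantage p q lam' V' w < 0 := by
  rcases lt_or_ge 0 (advantage p q lam' V' (equilibrium p q)) with ac' | ac'
  · exact S.advantage_neg_of_eq_active h S' hlam ac' hw aw
  rcases lt_or_ge 0 (advantage p q lam V (equilibrium p q)) with ac | ac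
  · exact S.advantage_neg_of_eq_change h S' hpq hlam ac ac' hw aw
  · exact S.advantage_neg_of_eq_passive h S' hpq hlam ac ac' hw aw

end IsBellmanSolution

/-! ### Existence of solutions -/

lemma continuous_iSup_of_lipschitz {u : ℝ → ℕ → ℝ} (hb : ∀ D, BddAbove (range (u D)))
    (hu : ∀ D D' n, u D n ≤ u D' n + |D - D'|) : Continuous fun D => ⨆ n, u D n := by
  have key : ∀ D D', (⨆ n, u D n) ≤ (⨆ n, u D' n) + |D - D'| := fun D D' =>
    ciSup_le fun n => (hu D D' n).trans (by linarith [le_ciSup (hb D') n])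
  refine (LipschitzWith.of_dist_le_mul (K := 1) fun D D' => ?_).continuous
  rw [NNReal.coe_one, one_mul, Real.dist_eq, Real.dist_eq, abs_le]
  have h1 := key D D'
  have h2 := key D' D
  rw [abs_sub_comm] at h2
  constructor <;> linarith

lemma continuous_iInf_of_lipschitz {u : ℝ → ℕ → ℝ} (hb : ∀ D, BddBelow (range (u D)))
    (hu : ∀ D D' n, u D n ≤ u D' n + |D - D'|) : Continuous fun D => ⨅ n, u D n := by
  have key : ∀ D D', (⨅ n, u D n) ≤ (⨅ n, u D' n) + |D - D'| := fun D D' => by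
    rw [← sub_le_iff_le_add]
    exact le_ciInf fun n => by linarith [hu D D' n, ciInf_le (hb D) n]
  refine (LipschitzWith.of_dist_le_mul (K := 1) fun D D' => ?_).continuous
  rw [NNReal.coe_one, one_mul, Real.dist_eq, Real.dist_eq, abs_le]
  have h1 := key D D'
  have h2 := key D' D
  rw [abs_sub_comm] at h2
  constructor <;> linarith

/-- A positive supremum of a sequence that tends to zero is attained. -/
lemma exists_eq_iSup_of_tendsto_zero {u : ℕ → ℝ} (hu : Tendsto u atTop (𝓝 0))
    (hpos : 0 < ⨆ n, u n) : ∃ n, u n = ⨆ n, u n := by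
  have hb : BddAbove (range u) := hu.bddAbove_range
  obtain ⟨N, hN⟩ := eventually_atTop.1 (hu.eventually (gt_mem_nhds (half_pos hpos)))
  obtain ⟨m, -, hm⟩ := Finset.exists_max_image (Finset.range (N + 1)) u ⟨0, by simp⟩
  refine ⟨m, le_antisymm (le_ciSup hb m) ?_⟩
  have h1 : (⨆ n, u n) ≤ max (u m) ((⨆ n, u n) / 2) := ciSup_le fun n => by
    rcases lt_or_ge n (N + 1) with h2 | h2
    · exact (hm n (Finset.mem_range.2 h2)).trans (le_max_left _ _)
    · exact (hN n (by omega)).le.trans (le_max_right _ _)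
  rcases le_max_iff.1 h1 with h2 | h2
  · exact h2
  · linarith

lemma exists_tendsto_zero_of_bound {u : ℕ → ℝ} {C : ℝ} (hu : ∀ n, |u n| ≤ C / (n + 1)) :
    Tendsto u atTop (𝓝 0) :=
  squeeze_zero_norm hu (tendsto_const_nhds.div_atTop
    (tendsto_atTop_add_const_right _ _ tendsto_natCast_atTop_atTop))

/-- The cost, relative to average penalty `g`, of being passive for `n` slots from `w` and then
sampling, when the beliefs `p` and `1 - q` are valued `0` and `D`. -/
noncomputable def delayCost (p q lam g D : ℝ) (n : ℕ) (w : ℝ) : ℝ :=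
  ∑ j ∈ Finset.range (n + 1), (entropy ((evolve p q)^[j] w) - g) + (lam + (evolve p q)^[n] w * D)

/-- The optimal cost among the policies that sample eventually. -/
noncomputable def stoppedValue (p q lam g D w : ℝ) : ℝ := ⨅ n, delayCost p q lam g D n w

namespace IsMonotonic

variable {p q : ℝ} (h : IsMonotonic p q)
include h

lemma slackP_bound {lam : ℝ} (hlam : 0 ≤ lam) (D : ℝ) (n : ℕ) :
    |slackP p q lam 0 D (n + 1)| ≤ 2 * passiveConst p q + lam + |D| := by
  have h1 := abs_le.1 (h.abs_passiveValue_le_const h.p_mem)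
  have h2 := abs_le.1 (h.abs_passiveValue_le_const (h.pStep_mem (by omega : 1 ≤ n + 1 + 1)))
  have h3 : |pStep p q (n + 1) * D| ≤ |D| := by
    have := h.pStep_mem (by omega : 1 ≤ n + 1)
    rw [abs_mul, abs_of_pos this.1]
    exact mul_le_of_le_one_left (abs_nonneg _) this.2.le
  have h4 := abs_le.1 h3
  rw [slackP, mul_zero, abs_le]
  constructor <;> linarith

lemma slackQ_bound {lam : ℝ} (hlam : 0 ≤ lam) (D : ℝ) (n : ℕ) :
    |slackQ p q lam 0 D (n + 1)| ≤ 2 * passiveConst p q + lam + |D| := by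
  have h1 := abs_le.1 (h.abs_passiveValue_le_const h.q_mem)
  have h2 := abs_le.1 (h.abs_passiveValue_le_const (h.qStep_mem (by omega : 1 ≤ n + 1 + 1)))
  have h3 : |qStep p q (n + 1) * D| ≤ |D| := by
    have h5 := h.hq.trans_le (h.q_le_qStep (by omega : 1 ≤ n + 1))
    rw [abs_mul, abs_of_pos h5]
    exact mul_le_of_le_one_left (abs_nonneg _) (h.qStep_lt_one _).le
  have h4 := abs_le.1 h3
  rw [slackQ, mul_zero, abs_le]
  constructor <;> linarith

lemma slackP_lipschitz (lam D D' : ℝ) (n : ℕ) :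
    |slackP p q lam 0 D (n + 1) - slackP p q lam 0 D' (n + 1)| ≤ |D - D'| := by
  have := h.pStep_mem (by omega : 1 ≤ n + 1)
  rw [slackP_sub, sub_self, sub_self, mul_zero, zero_add, zero_add, abs_mul, abs_of_pos this.1]
  exact mul_le_of_le_one_left (abs_nonneg _) this.2.le

lemma slackQ_lipschitz (lam D D' : ℝ) (n : ℕ) :
    |slackQ p q lam 0 D (n + 1) - slackQ p q lam 0 D' (n + 1)| ≤ |D - D'| := by
  have h5 := h.hq.trans_le (h.q_le_qStep (by omega : 1 ≤ n + 1))
  rw [slackQ_sub, sub_self, sub_self, mul_zero, zero_add, zero_sub, abs_neg, abs_mul,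
    abs_of_pos h5]
  exact mul_le_of_le_one_left (abs_nonneg _) (h.qStep_lt_one _).le

/-- The saving and the spread of a solution: both reset cycles have nonnegative slack, and if the
saving is positive, then the slacks vanish for some cycle lengths. The cycle from `p` determines the
saving as a decreasing function of the spread and the cycle from `1 - q` as an increasing one; their
graphs cross. -/
lemma exists_saving_spread {lam : ℝ} (hlam : 0 ≤ lam) : ∃ G D : ℝ, 0 ≤ G ∧
    (∀ n, 0 ≤ slackP p q lam G D (n + 1)) ∧ (∀ n, 0 ≤ slackQ p q lam G D (n + 1)) ∧
    (0 < G → (∃ n, slackP p q lam G D (n + 1) = 0) ∧ ∃ n, slackQ p q lam G D (n + 1) = 0) := by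
  have general : ∀ s : ℝ → ℕ → ℝ, (∀ D n, |s D n| ≤ 2 * passiveConst p q + lam + |D|) →
      (∀ D D' n, |s D n - s D' n| ≤ |D - D'|) →
      Continuous (fun D => ⨆ n : ℕ, -s D n / (n + 1)) ∧ ∀ D, 0 ≤ (⨆ n : ℕ, -s D n / (n + 1)) ∧
        (∀ n : ℕ, -s D n / (n + 1) ≤ ⨆ n : ℕ, -s D n / (n + 1)) ∧
        (0 < (⨆ n : ℕ, -s D n / (n + 1)) →
          ∃ n : ℕ, -s D n / (n + 1) = ⨆ n : ℕ, -s D n / (n + 1)) := by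
    intro s hs hs'
    have h0 : ∀ n : ℕ, (0 : ℝ) < n + 1 := fun n => by positivity
    have ht : ∀ D, Tendsto (fun n : ℕ => -s D n / (n + 1)) atTop (𝓝 0) := fun D =>
      exists_tendsto_zero_of_bound (C := 2 * passiveConst p q + lam + |D|) fun n => by
        rw [abs_div, abs_neg, abs_of_pos (h0 n)]
        exact div_le_div_of_nonneg_right (hs D n) (h0 n).le
    have hb : ∀ D, BddAbove (range fun n : ℕ => -s D n / (n + 1)) := fun D => (ht D).bddAbove_range
    refine ⟨continuous_iSup_of_lipschitz hb fun D D' n => ?_, fun D => ⟨?_, le_ciSup (hb D),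
      exists_eq_iSup_of_tendsto_zero (ht D)⟩⟩
    · have h1 := (abs_le.1 (hs' D D' n)).1
      have h2 : (-s D n + s D' n) / (n + 1) ≤ |D - D'| := by
        rw [div_le_iff₀ (h0 n)]
        nlinarith [abs_nonneg (D - D'), Nat.cast_nonneg (α := ℝ) n,
          mul_nonneg (abs_nonneg (D - D')) (Nat.cast_nonneg (α := ℝ) n)]
      have h3 : -s D n / (n + 1) = -s D' n / (n + 1) + (-s D n + s D' n) / ((n : ℝ) + 1) := by
        field_simp; ring
      rw [h3]; linarith
    · exact le_of_tendsto' (ht D) (le_ciSup (hb D))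
  obtain ⟨cP, gP⟩ := general (fun D n => slackP p q lam 0 D (n + 1))
    (fun D n => h.slackP_bound hlam D n) (fun D D' n => h.slackP_lipschitz lam D D' n)
  obtain ⟨cQ, gQ⟩ := general (fun D n => slackQ p q lam 0 D (n + 1))
    (fun D n => h.slackQ_bound hlam D n) (fun D D' n => h.slackQ_lipschitz lam D D' n)
  set GP : ℝ → ℝ := fun D => ⨆ n : ℕ, -slackP p q lam 0 D (n + 1) / (n + 1) with hGP
  set GQ : ℝ → ℝ := fun D => ⨆ n : ℕ, -slackQ p q lam 0 D (n + 1) / (n + 1) with hGQ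
  set R := passiveConst p q with hR
  have R0 : 0 ≤ R := h.passiveConst_nonneg
  set T := (lam + 4 * R) * (p⁻¹ + q⁻¹) with hT
  have T1 : lam + 4 * R ≤ p * T := by
    have : p * (p⁻¹ + q⁻¹) = 1 + p * q⁻¹ := by have := h.hp; field_simp
    have h2 : 0 ≤ p * q⁻¹ := mul_nonneg h.hp.le (inv_nonneg.2 h.hq.le)
    nlinarith
  have T2 : lam + 4 * R ≤ q * T := by
    have : q * (p⁻¹ + q⁻¹) = 1 + q * p⁻¹ := by have := h.hq; field_simp; ring
    have h2 : 0 ≤ q * p⁻¹ := mul_nonneg h.hq.le (inv_nonneg.2 h.hp.le)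
    nlinarith
  have T0 : 0 ≤ T := mul_nonneg (by linarith)
    (add_nonneg (inv_nonneg.2 h.hp.le) (inv_nonneg.2 h.hq.le))
  have small : ∀ (n : ℕ) (x : ℝ), -(2 * R) ≤ x → -x / (n + 1) ≤ 2 * R := fun n x hx => by
    rw [div_le_iff₀ (by positivity)]
    nlinarith [mul_nonneg R0 (Nat.cast_nonneg (α := ℝ) n)]
  have bP : ∀ n, |passiveValue p q (pStep p q (n + 1))| ≤ R := fun n =>
    h.abs_passiveValue_le_const (h.pStep_mem (by omega))
  have bQ : ∀ n, |passiveValue p q (1 - qStep p q (n + 1))| ≤ R := fun n =>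
    h.abs_passiveValue_le_const (h.qStep_mem (by omega))
  have bp := abs_le.1 (h.abs_passiveValue_le_const h.p_mem)
  have bq := abs_le.1 (h.abs_passiveValue_le_const h.q_mem)
  rw [← hR] at bp bq
  have left : GQ (-T) ≤ GP (-T) := by
    have h1 : GQ (-T) ≤ 2 * R := ciSup_le fun n => small n _ (by
      have := abs_le.1 (bQ (n + 1))
      have h5 := mul_nonneg (h.hq.le.trans (h.q_le_qStep (by omega : 1 ≤ n + 1))) T0
      rw [slackQ]; linarith)
    have h2 : _ ≤ GP (-T) := (gP (-T)).2.1 0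
    rw [Nat.cast_zero, zero_add, zero_add, div_one, slackP, mul_zero, h.pStep_one] at h2
    have h3 := abs_le.1 (bP 1)
    refine h1.trans (le_trans ?_ h2)
    linarith
  have right : GP T ≤ GQ T := by
    have h1 : GP T ≤ 2 * R := ciSup_le fun n => small n _ (by
      have := abs_le.1 (bP (n + 1))
      have h5 := mul_nonneg (h.hp.le.trans (h.p_le_pStep (by omega : 1 ≤ n + 1))) T0
      rw [slackP]; linarith)
    have h2 : _ ≤ GQ T := (gQ T).2.1 0
    rw [Nat.cast_zero, zero_add, zero_add, div_one, slackQ, mul_zero, h.qStep_one] at h2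
    have h3 := abs_le.1 (bQ 1)
    refine h1.trans (le_trans ?_ h2)
    linarith
  obtain ⟨D, -, hD⟩ := intermediate_value_Icc (by linarith : -T ≤ T)
    ((cQ.sub cP).continuousOn) (show (0 : ℝ) ∈ Icc _ _ from
      ⟨sub_nonpos.2 left, sub_nonneg.2 right⟩)
  have hD' : GQ D = GP D := sub_eq_zero.1 hD
  have eP : ∀ n, slackP p q lam (GP D) D (n + 1)
      = (n + 1) * GP D + slackP p q lam 0 D (n + 1) := fun n => by
    simp only [slackP]; push_cast; ring
  have eQ : ∀ n, slackQ p q lam (GP D) D (n + 1)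
      = (n + 1) * GP D + slackQ p q lam 0 D (n + 1) := fun n => by
    simp only [slackQ]; push_cast; ring
  refine ⟨GP D, D, (gP D).1, fun n => ?_, fun n => ?_, fun hpos => ⟨?_, ?_⟩⟩
  · have h1 := (gP D).2.1 n
    rw [div_le_iff₀ (by positivity)] at h1
    rw [eP]; linarith
  · have h1 := (gQ D).2.1 n
    rw [div_le_iff₀ (by positivity)] at h1
    rw [eQ, ← hD']; linarith
  · obtain ⟨n, hn⟩ := (gP D).2.2 hpos
    rw [div_eq_iff (by positivity)] at hn
    exact ⟨n, by rw [eP]; linarith⟩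
  · obtain ⟨n, hn⟩ := (gQ D).2.2 (show 0 < GQ D from hD' ▸ hpos)
    rw [div_eq_iff (by positivity)] at hn
    exact ⟨n, by rw [eQ, ← hD']; linarith⟩

variable {lam G D : ℝ}

lemma delayCost_eq (n : ℕ) {w : ℝ} (hw : w ∈ Ioo (0 : ℝ) 1) :
    delayCost p q lam (entropy (equilibrium p q) - G) D n w = (n + 1) * G + passiveValue p q w
      - passiveValue p q ((evolve p q)^[n + 1] w) + (lam + (evolve p q)^[n] w * D) := by
  rw [delayCost, h.sum_entropy_iterate _ _ hw]; push_cast; ring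

lemma delayCost_p (n : ℕ) : delayCost p q lam (entropy (equilibrium p q) - G) D n p
    = slackP p q lam G D (n + 1) := by
  rw [h.delayCost_eq n h.p_mem, h.iterate_p, h.iterate_p, slackP]; push_cast; ring

lemma delayCost_q (n : ℕ) : delayCost p q lam (entropy (equilibrium p q) - G) D n (1 - q)
    = D + slackQ p q lam G D (n + 1) := by
  rw [h.delayCost_eq n h.q_mem, h.iterate_q, h.iterate_q, slackQ]; push_cast; ring

omit h in
lemma delayCost_succ (g : ℝ) (n : ℕ) (w : ℝ) : delayCost p q lam g D (n + 1) w
    = entropy w - g + delayCost p q lam g D n (evolve p q w) := by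
  rw [delayCost, delayCost, Finset.sum_range_succ']
  simp only [Function.iterate_succ_apply, Function.iterate_zero, id]
  ring

lemma delayCost_ge (hlam : 0 ≤ lam) (hG : 0 ≤ G) (n : ℕ) {w : ℝ} (hw : w ∈ Ioo (0 : ℝ) 1) :
    -(2 * passiveConst p q + |D|)
      ≤ delayCost p q lam (entropy (equilibrium p q) - G) D n w := by
  have h1 := abs_le.1 (h.abs_passiveValue_le_const hw)
  have h2 := abs_le.1 (h.abs_passiveValue_le_const (h.iterate_mem (n + 1) hw))
  have h3 := h.iterate_mem n hw
  have h4 : |(evolve p q)^[n] w * D| ≤ |D| := by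
    rw [abs_mul, abs_of_pos h3.1]; exact mul_le_of_le_one_left (abs_nonneg _) h3.2.le
  have h5 := abs_le.1 h4
  have h6 : 0 ≤ ((n : ℝ) + 1) * G := by positivity
  rw [h.delayCost_eq n hw]
  linarith

lemma bddBelow_delayCost (hlam : 0 ≤ lam) (hG : 0 ≤ G) {w : ℝ} (hw : w ∈ Ioo (0 : ℝ) 1) :
    BddBelow (range fun n => delayCost p q lam (entropy (equilibrium p q) - G) D n w) :=
  ⟨-(2 * passiveConst p q + |D|), by
    rintro _ ⟨n, rfl⟩; exact h.delayCost_ge hlam hG n hw⟩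

lemma stoppedValue_eq (hlam : 0 ≤ lam) (hG : 0 ≤ G) {w : ℝ} (hw : w ∈ Ioo (0 : ℝ) 1) :
    stoppedValue p q lam (entropy (equilibrium p q) - G) D w
      = entropy w - (entropy (equilibrium p q) - G)
        + min (lam + w * D)
          (stoppedValue p q lam (entropy (equilibrium p q) - G) D (evolve p q w)) := by
  set g := entropy (equilibrium p q) - G with hg
  have b1 := h.bddBelow_delayCost (D := D) hlam hG hw
  have b2 := h.bddBelow_delayCost (D := D) hlam hG (h.evolve_mem hw)
  rw [← hg] at b1 b2
  have e0 : delayCost p q lam g D 0 w = entropy w - g + (lam + w * D) := by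
    simp [delayCost]
  refine le_antisymm ?_ (le_ciInf fun n => ?_)
  · rw [← sub_le_iff_le_add']
    refine le_min ?_ (le_ciInf fun n => ?_)
    · have := ciInf_le b1 0
      rw [e0] at this
      unfold stoppedValue; linarith
    · have := ciInf_le b1 (n + 1)
      rw [delayCost_succ] at this
      unfold stoppedValue; linarith
  · cases n with
    | zero =>
      have := min_le_left (lam + w * D) (stoppedValue p q lam g D (evolve p q w))
      rw [e0]; linarith
    | succ n =>
      rw [delayCost_succ]
      have h1 : stoppedValue p q lam g D (evolve p q w)
        ≤ delayCost p q lam g D n (evolve p q w) := ciInf_le b2 n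
      linarith [min_le_right (lam + w * D) (stoppedValue p q lam g D (evolve p q w))]

lemma concaveOn_stoppedValue (hlam : 0 ≤ lam) (hG : 0 ≤ G) : ConcaveOn ℝ (Ioo 0 1)
    (stoppedValue p q lam (entropy (equilibrium p q) - G) D) := by
  refine ⟨convex_Ioo 0 1, fun x hx y hy a b ha hb hab => le_ciInf fun n => ?_⟩
  have hc : ConcaveOn ℝ (Ioo 0 1) (delayCost p q lam (entropy (equilibrium p q) - G) D n) := by
    refine (h.concaveOn_sum_entropy _ _).add (h.concaveOn_comp_iterate (f := fun x => lam + x * D)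
      ⟨convex_Ioo 0 1, fun x _ y _ a b _ _ hab => le_of_eq ?_⟩ n)
    simp only [smul_eq_mul]; linear_combination lam * hab
  refine le_trans ?_ (hc.2 hx hy ha hb hab)
  have h1 := ciInf_le (h.bddBelow_delayCost (D := D) hlam hG hx) n
  have h2 := ciInf_le (h.bddBelow_delayCost (D := D) hlam hG hy) n
  simp only [smul_eq_mul]
  exact add_le_add (mul_le_mul_of_nonneg_left h1 ha) (mul_le_mul_of_nonneg_left h2 hb)

lemma stoppedValue_bounded (hlam : 0 ≤ lam) (hG : 0 ≤ G) : ∃ C, ∀ w ∈ Ioo (0 : ℝ) 1,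
    |stoppedValue p q lam (entropy (equilibrium p q) - G) D w| ≤ C := by
  refine ⟨2 * passiveConst p q + |D| + (G + 2 * passiveConst p q + lam + |D|), fun w hw => ?_⟩
  have h0 : -(2 * passiveConst p q + |D|)
      ≤ stoppedValue p q lam (entropy (equilibrium p q) - G) D w :=
    le_ciInf fun n => h.delayCost_ge hlam hG n hw
  have h1 : stoppedValue p q lam (entropy (equilibrium p q) - G) D w ≤ _ :=
    ciInf_le (h.bddBelow_delayCost (D := D) hlam hG hw) 0
  rw [h.delayCost_eq 0 hw] at h1
  have h2 := abs_le.1 (h.abs_passiveValue_le_const hw)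
  have h3 := abs_le.1 (h.abs_passiveValue_le_const (h.iterate_mem (0 + 1) hw))
  have h4 : |w * D| ≤ |D| := by
    rw [abs_mul, abs_of_pos hw.1]; exact mul_le_of_le_one_left (abs_nonneg _) hw.2.le
  have h5 := abs_le.1 h4
  have h6 := h.passiveConst_nonneg
  simp only [Nat.cast_zero, zero_add, one_mul, Function.iterate_zero, id] at h1
  rw [abs_le]
  constructor <;> linarith [abs_nonneg D]

omit h in
/-- Criterion for a solution that is normalised to vanish at `p`. -/
lemma isBellmanSolution_of {g : ℝ} {V : ℝ → ℝ} (hc : ConcaveOn ℝ (Ioo 0 1) V)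
    (hb : ∃ C, ∀ w ∈ Ioo (0 : ℝ) 1, |V w| ≤ C) (hVp : V p = 0) (hVq : V (1 - q) = D)
    (hV : ∀ w ∈ Ioo (0 : ℝ) 1, V w = entropy w - g + min (lam + w * D) (V (evolve p q w))) :
    IsBellmanSolution p q lam g V where
  continuousOn := hc.continuousOn isOpen_Ioo
  bounded := hb
  bellman w hw := by rw [hV w hw, hVp, hVq, mul_zero, add_zero]; ring

lemma exists_solution_of_saving_pos (hlam : 0 ≤ lam) (hG : 0 < G)
    (hP : ∀ n, 0 ≤ slackP p q lam G D (n + 1)) (hQ : ∀ n, 0 ≤ slackQ p q lam G D (n + 1))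
    (hP0 : ∃ n, slackP p q lam G D (n + 1) = 0) (hQ0 : ∃ n, slackQ p q lam G D (n + 1) = 0) :
    ∃ g V, IsBellmanSolution p q lam g V := by
  refine ⟨entropy (equilibrium p q) - G, stoppedValue p q lam (entropy (equilibrium p q) - G) D,
    isBellmanSolution_of (h.concaveOn_stoppedValue hlam hG.le)
    (h.stoppedValue_bounded hlam hG.le) (le_antisymm ?_ ?_) (le_antisymm ?_ ?_)
    fun w hw => h.stoppedValue_eq hlam hG.le hw⟩
  · obtain ⟨n, hn⟩ := hP0
    have : stoppedValue p q lam (entropy (equilibrium p q) - G) D p ≤ _ :=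
      ciInf_le (h.bddBelow_delayCost (D := D) hlam hG.le h.p_mem) n
    rwa [h.delayCost_p, hn] at this
  · exact le_ciInf fun n => by rw [h.delayCost_p]; exact hP n
  · obtain ⟨n, hn⟩ := hQ0
    have : stoppedValue p q lam (entropy (equilibrium p q) - G) D (1 - q) ≤ _ :=
      ciInf_le (h.bddBelow_delayCost (D := D) hlam hG.le h.q_mem) n
    rwa [h.delayCost_q, hn, add_zero] at this
  · exact le_ciInf fun n => by rw [h.delayCost_q]; linarith [hQ n]

/-- Solutions with zero saving: permanent passivity attains the optimal average penalty, so it is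
one of the policies to be minimised over, with `v` the relative value of the equilibrium. -/
lemma exists_solution_of_forever (hlam : 0 ≤ lam) (v : ℝ)
    (hP : min (⨅ n, slackP p q lam 0 D (n + 1)) (passiveValue p q p + v) = 0)
    (hQ : min (⨅ n, (D + slackQ p q lam 0 D (n + 1))) (passiveValue p q (1 - q) + v) = D) :
    ∃ g V, IsBellmanSolution p q lam g V := by
  set U := stoppedValue p q lam (entropy (equilibrium p q) - 0) D with hU
  have eP : U p = ⨅ n, slackP p q lam 0 D (n + 1) := iInf_congr fun n => h.delayCost_p n
  have eQ : U (1 - q) = ⨅ n, (D + slackQ p q lam 0 D (n + 1)) :=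
    iInf_congr fun n => h.delayCost_q n
  refine ⟨entropy (equilibrium p q) - 0, fun w => min (U w) (passiveValue p q w + v),
    isBellmanSolution_of (D := D) ((h.concaveOn_stoppedValue hlam le_rfl).inf
      (h.concaveOn_passiveValue.add (concaveOn_const v (convex_Ioo 0 1)))) ?_
    (by rw [eP]; exact hP) (by rw [eQ]; exact hQ) fun w hw => ?_⟩
  · obtain ⟨C, hC⟩ := h.stoppedValue_bounded (D := D) hlam le_rfl
    refine ⟨C + (passiveConst p q + |v|), fun w hw => ?_⟩
    have h1 := abs_le.1 (hC w hw)
    have h2 := abs_le.1 (h.abs_passiveValue_le_const hw)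
    have h3 := neg_abs_le v
    have h4 := le_abs_self v
    rw [← hU] at h1
    rw [abs_le]
    exact ⟨le_min (by linarith) (by linarith), (min_le_left _ _).trans (by linarith)⟩
  · have h1 := h.stoppedValue_eq (D := D) hlam le_rfl hw
    rw [← hU] at h1
    rw [sub_zero] at h1 ⊢
    rw [h1, h.passiveValue_step hw, ← min_assoc, add_assoc _ _ v, min_add_add_left]

lemma exists_solution_of_saving_zero (hlam : 0 ≤ lam)
    (hP : ∀ n, 0 ≤ slackP p q lam 0 D (n + 1)) (hQ : ∀ n, 0 ≤ slackQ p q lam 0 D (n + 1)) :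
    ∃ g V, IsBellmanSolution p q lam g V := by
  have bP : ∀ D, BddBelow (range fun n => slackP p q lam 0 D (n + 1)) := fun D =>
    ⟨_, by rintro _ ⟨n, rfl⟩; exact (abs_le.1 (h.slackP_bound hlam D n)).1⟩
  have bQ : ∀ D, BddBelow (range fun n => slackQ p q lam 0 D (n + 1)) := fun D =>
    ⟨_, by rintro _ ⟨n, rfl⟩; exact (abs_le.1 (h.slackQ_bound hlam D n)).1⟩
  have cP : Continuous fun D => ⨅ n, slackP p q lam 0 D (n + 1) :=
    continuous_iInf_of_lipschitz bP fun D D' n => by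
      linarith [(abs_le.1 (h.slackP_lipschitz lam D D' n)).2]
  have cQ : Continuous fun D => ⨅ n, slackQ p q lam 0 D (n + 1) :=
    continuous_iInf_of_lipschitz bQ fun D D' n => by
      linarith [(abs_le.1 (h.slackQ_lipschitz lam D D' n)).2]
  have eQ : ∀ D, (⨅ n, (D + slackQ p q lam 0 D (n + 1)))
      = D + ⨅ n, slackQ p q lam 0 D (n + 1) := fun D => (add_ciInf (bQ D) D).symm
  set E := passiveSpread p q with hE
  have hEdef : E = passiveValue p q (1 - q) - passiveValue p q p := rfl
  have hP' : 0 ≤ ⨅ n, slackP p q lam 0 D (n + 1) := le_ciInf hP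
  have hQ' : 0 ≤ ⨅ n, slackQ p q lam 0 D (n + 1) := le_ciInf hQ
  rcases le_total D E with hDE | hDE
  · have hPE : ∀ D', D ≤ D' → 0 ≤ ⨅ n, slackP p q lam 0 D' (n + 1) := fun D' hD' =>
      le_ciInf fun n => by
        have h1 := slackP_sub p q lam 0 D lam 0 D' (n + 1)
        have h2 := mul_nonneg (h.pStep_mem (by omega : 1 ≤ n + 1)).1.le (sub_nonneg.2 hD')
        linarith [hP n]
    have : ∃ D', D ≤ D' ∧ D' ≤ E ∧
        min (D' + ⨅ n, slackQ p q lam 0 D' (n + 1)) E = D' := by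
      rcases le_or_gt 0 (⨅ n, slackQ p q lam 0 E (n + 1)) with h1 | h1
      · exact ⟨E, hDE, le_rfl, min_eq_right (by linarith)⟩
      · obtain ⟨D', ⟨h2, h3⟩, h4⟩ := intermediate_value_Icc' hDE cQ.continuousOn
          (show (0 : ℝ) ∈ Icc _ _ from ⟨h1.le, hQ'⟩)
        simp only at h4
        exact ⟨D', h2, h3, by rw [h4, add_zero, min_eq_left h3]⟩
    obtain ⟨D', h1, h2, h3⟩ := this
    refine h.exists_solution_of_forever (D := D') hlam (-passiveValue p q p) ?_ ?_
    · rw [add_neg_cancel]; exact min_eq_right (hPE D' h1)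
    · rw [eQ, ← sub_eq_add_neg]; exact h3
  · have hQE : ∀ D', D' ≤ D → 0 ≤ ⨅ n, slackQ p q lam 0 D' (n + 1) := fun D' hD' =>
      le_ciInf fun n => by
        have h1 := slackQ_sub p q lam 0 D lam 0 D' (n + 1)
        have h2 := mul_nonneg (h.hq.le.trans (h.q_le_qStep (by omega : 1 ≤ n + 1)))
          (sub_nonneg.2 hD')
        linarith [hQ n]
    have : ∃ D', D' ≤ D ∧ E ≤ D' ∧
        min (⨅ n, slackP p q lam 0 D' (n + 1)) (D' - E) = 0 := by
      rcases le_or_gt 0 (⨅ n, slackP p q lam 0 E (n + 1)) with h1 | h1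
      · exact ⟨E, hDE, le_rfl, by rw [sub_self]; exact min_eq_right h1⟩
      · obtain ⟨D', ⟨h2, h3⟩, h4⟩ := intermediate_value_Icc hDE cP.continuousOn
          (show (0 : ℝ) ∈ Icc _ _ from ⟨h1.le, hP'⟩)
        simp only at h4
        exact ⟨D', h3, h2, by rw [h4]; exact min_eq_left (by linarith)⟩
    obtain ⟨D', h1, h2, h3⟩ := this
    refine h.exists_solution_of_forever (D := D') hlam (D' - passiveValue p q (1 - q)) ?_ ?_
    · rw [show passiveValue p q p + (D' - passiveValue p q (1 - q)) = D' - E by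
        rw [hEdef]; ring]
      exact h3
    · rw [eQ, add_sub_cancel]; exact min_eq_right (by linarith [hQE D' h1])

theorem exists_solution (hlam : 0 ≤ lam) : ∃ g V, IsBellmanSolution p q lam g V := by
  obtain ⟨G, D, hG, hP, hQ, h0⟩ := h.exists_saving_spread hlam
  rcases hG.eq_or_lt with rfl | hG
  · exact h.exists_solution_of_saving_zero hlam hP hQ
  · exact h.exists_solution_of_saving_pos hlam hG hP hQ (h0 hG).1 (h0 hG).2

/-- For a large service charge permanent passivity is optimal. -/
lemma isBellmanSolution_passiveValue (hlam : 2 * passiveConst p q ≤ lam) :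
    IsBellmanSolution p q lam (entropy (equilibrium p q)) (passiveValue p q) ∧
      ∀ w ∈ Ioo (0 : ℝ) 1, advantage p q lam (passiveValue p q) w ≤ 0 := by
  have h1 : ∀ w ∈ Ioo (0 : ℝ) 1, passiveValue p q (evolve p q w)
      ≤ lam + w * passiveValue p q (1 - q) + (1 - w) * passiveValue p q p := fun w hw => by
    have a1 := abs_le.1 (h.abs_passiveValue_le_const (h.evolve_mem hw))
    have a2 := abs_le.1 (h.abs_passiveValue_le_const h.p_mem)
    have a3 := abs_le.1 (h.abs_passiveValue_le_const h.q_mem)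
    have a4 := mul_le_mul_of_nonneg_left a3.1 hw.1.le
    have a5 := mul_le_mul_of_nonneg_left a2.1 (sub_pos.2 hw.2).le
    linarith
  refine ⟨⟨h.concaveOn_passiveValue.continuousOn isOpen_Ioo,
    ⟨_, fun w hw => h.abs_passiveValue_le_const hw⟩, fun w hw => ?_⟩, fun w hw => ?_⟩
  · rw [min_eq_right (h1 w hw), h.passiveValue_step hw]; ring
  · exact sub_nonpos.2 (h1 w hw)

end IsMonotonic

/-! ### Continuity in the service charge, indexability and the Whittle index -/

lemma advantage_nonpos_iff {p q lam : ℝ} {V : ℝ → ℝ} {w : ℝ} :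
    advantage p q lam V w ≤ 0 ↔ V (evolve p q w) ≤ lam + w * V (1 - q) + (1 - w) * V p :=
  sub_nonpos

namespace IsBellmanSolution

variable {p q : ℝ} (h : IsMonotonic p q) (hpq : p ≤ q)
include h hpq

omit hpq in
lemma abs_coeff_le {w : ℝ} (hw : w ∈ Ioo (0 : ℝ) 1) (k : ℕ) (x : ℝ) :
    |(1 - decay p q ^ k) * (w - equilibrium p q) * x| ≤ |x| := by
  have h1 : |1 - decay p q ^ k| ≤ 1 := by
    rw [abs_of_nonneg (sub_nonneg.2 (h.pow_le_one k))]; linarith [h.pow_pos k]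
  rw [abs_mul, abs_mul]
  exact mul_le_of_le_one_left (abs_nonneg _)
    (mul_le_one₀ h1 (abs_nonneg _) (h.abs_sub_eq_le_one hw))

lemma abs_spread_sub_le {lam lam' g g' : ℝ} {V V' : ℝ → ℝ} (S : IsBellmanSolution p q lam g V)
    (S' : IsBellmanSolution p q lam' g' V') (hlam : lam ≤ lam') :
    |spread p q V' - spread p q V| ≤ (lam' - lam) / p := by
  rw [le_div_iff₀ h.hp, mul_comm]; exact (S.lipschitz h S' hpq hlam).1

lemma saving_sub_le {lam lam' g g' : ℝ} {V V' : ℝ → ℝ} (S : IsBellmanSolution p q lam g V)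
    (S' : IsBellmanSolution p q lam' g' V') (hlam : lam ≤ lam') :
    saving p q g - saving p q g' ≤ 2 * ((lam' - lam) / p) := by
  rw [← mul_div_assoc, le_div_iff₀ h.hp, mul_comm]; exact (S.lipschitz h S' hpq hlam).2

/-- If passivity is optimal at `w` for all higher charges, then also for the charge itself. -/
lemma advantage_nonpos_of_right {lam g : ℝ} {V : ℝ → ℝ} (hlam : 0 ≤ lam)
    (S : IsBellmanSolution p q lam g V) {w : ℝ} (hw : w ∈ Ioo (0 : ℝ) 1)
    (hright : ∀ lam' g' V', lam < lam' → IsBellmanSolution p q lam' g' V' →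
      advantage p q lam' V' w ≤ 0) : advantage p q lam V w ≤ 0 := by
  have key : ∃ C δ₀ : ℝ, 0 < δ₀ ∧ ∀ δ ∈ Ioo 0 δ₀, advantage p q lam V w ≤ C * (δ / p) := by
    rcases S.saving_pos_or h with hG | ⟨hG, -⟩
    · set B := 2 * passiveConst p q + |spread p q V| + saving p q g with hB
      refine ⟨2 * (2 * B / saving p q g) + 1, p * saving p q g / 4,
        div_pos (mul_pos h.hp hG) four_pos, fun δ hδ => ?_⟩
      obtain ⟨g', V', S'⟩ := h.exists_solution (lam := lam + δ) (by linarith [hδ.1])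
      have hle : lam ≤ lam + δ := by linarith [hδ.1]
      have e1 := abs_spread_sub_le h hpq S S' hle
      have e2 := saving_sub_le h hpq S S' hle
      rw [add_sub_cancel_left] at e1 e2
      have e3 : δ / p ≤ saving p q g / 4 := by
        rw [div_le_iff₀ h.hp]; linarith [hδ.2]
      have e4 : 0 ≤ δ / p := div_nonneg hδ.1.le h.hp.le
      have e5 := hright _ _ _ (by linarith [hδ.1]) S'
      rcases S'.advantage_dichotomy h hw with ⟨k, hk, -, h4⟩ | ⟨h1, -⟩
      swap
      · linarith
      have f1 := S.advantage_sub_le h hk hw h4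
      have f2 := abs_le.1 (abs_coeff_le h hw k (spread p q V - spread p q V'))
      rw [abs_sub_comm] at f2
      have f3 := abs_le.1 (abs_coeff_le h hw k (spread p q V'))
      have f4 := abs_le.1 (h.abs_passiveValue_le_const (h.evolve_mem hw))
      have f5 := abs_le.1 (h.abs_passiveValue_le_const (h.iterate_mem (k + 1) hw))
      have f6 : |spread p q V'| ≤ |spread p q V| + saving p q g / 4 := by
        have := abs_sub_abs_le_abs_sub (spread p q V') (spread p q V); linarith
      have hk0 : (0 : ℝ) ≤ k := Nat.cast_nonneg k
      have f7 : (k : ℝ) * (saving p q g / 2) ≤ k * saving p q g' :=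
        mul_le_mul_of_nonneg_left (by linarith) hk0
      have f8 : (k : ℝ) ≤ 2 * B / saving p q g := by
        rw [le_div_iff₀ hG]; linarith
      have f9 := mul_le_mul_of_nonneg_left e2 hk0
      have f10 := mul_le_mul_of_nonneg_right f8 e4
      linarith
    · refine ⟨2, 1, one_pos, fun δ hδ => ?_⟩
      obtain ⟨g', V', S'⟩ := h.exists_solution (lam := lam + δ) (by linarith [hδ.1])
      have hle : lam ≤ lam + δ := by linarith [hδ.1]
      have e1 := abs_spread_sub_le h hpq S S' hle
      have e2 : saving p q g' = 0 :=
        le_antisymm (hG ▸ S.saving_antitone h S' hle) (S'.saving_nonneg h)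
      rw [add_sub_cancel_left] at e1
      have e4 : 0 ≤ δ / p := div_nonneg hδ.1.le h.hp.le
      have e5 := hright _ _ _ (by linarith [hδ.1]) S'
      rcases S'.advantage_dichotomy h hw with ⟨k, hk, -, h4⟩ | ⟨-, h4⟩
      · have f1 := S.advantage_sub_le h hk hw h4
        have f2 := abs_le.1 (abs_coeff_le h hw k (spread p q V - spread p q V'))
        rw [abs_sub_comm] at f2
        rw [hG, e2] at f1
        linarith
      · have f1 := S.advantage_le_forever h hpq hG hw
        have f2 := S'.forever_eq h hpq e2 w
        have f3 : w * (spread p q V' - spread p q V) ≤ |spread p q V' - spread p q V| :=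
          (mul_le_mul_of_nonneg_left (le_abs_self _) hw.1.le).trans
            (mul_le_of_le_one_left (abs_nonneg _) hw.2.le)
        have f4 : δ ≤ δ / p := by
          rw [le_div_iff₀ h.hp]
          exact mul_le_of_le_one_right hδ.1.le h.p_mem.2.le
        linarith
  obtain ⟨C, δ₀, hδ₀, hC⟩ := key
  have ht : Tendsto (fun δ : ℝ => C * (δ / p)) (𝓝[>] 0) (𝓝 (C * (0 / p))) :=
    (Continuous.tendsto (by fun_prop) 0).mono_left nhdsWithin_le_nhds
  have := ge_of_tendsto ht (by filter_upwards [Ioo_mem_nhdsGT hδ₀] with δ hδ using hC δ hδ)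
  simpa using this

/-- If sampling is strictly better at `w` for all lower charges, then it is still optimal for the
charge itself. -/
lemma advantage_nonneg_of_left {lam' g' : ℝ} {V' : ℝ → ℝ} (hlam' : 0 < lam')
    (S' : IsBellmanSolution p q lam' g' V') {w : ℝ} (hw : w ∈ Ioo (0 : ℝ) 1)
    (hleft : ∀ lam g V, 0 ≤ lam → lam < lam' → IsBellmanSolution p q lam g V →
      0 < advantage p q lam V w) : 0 ≤ advantage p q lam' V' w := by
  by_contra hneg
  rw [not_le] at hneg
  -- sampling after `k` slots is better than sampling at `w`, and stays so for slightly lower charges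
  have finite : ∀ k : ℕ, 1 ≤ k → ¬ (k * saving p q g' + passiveValue p q (evolve p q w)
        - passiveValue p q ((evolve p q)^[k + 1] w)
        - (1 - decay p q ^ k) * (w - equilibrium p q) * spread p q V' < 0) := by
    intro k hk hlt
    set T := k * saving p q g' + passiveValue p q (evolve p q w)
        - passiveValue p q ((evolve p q)^[k + 1] w)
        - (1 - decay p q ^ k) * (w - equilibrium p q) * spread p q V' with hT
    have key : ∀ δ ∈ Ioo 0 lam', 0 ≤ T + (2 * k + 1) * (δ / p) := by
      intro δ hδ
      obtain ⟨g, V, S⟩ := h.exists_solution (lam := lam' - δ) (by linarith [hδ.2])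
      have hle : lam' - δ ≤ lam' := by linarith [hδ.1]
      have e1 := abs_spread_sub_le h hpq S S' hle
      have e2 := saving_sub_le h hpq S S' hle
      rw [sub_sub_cancel] at e1 e2
      have e3 := hleft _ _ _ (by linarith [hδ.2]) (by linarith [hδ.1]) S
      have e4 := S.advantage_le h hk hw
      have e5 := abs_le.1 (abs_coeff_le h hw k (spread p q V' - spread p q V))
      have e6 := mul_le_mul_of_nonneg_left e2 (Nat.cast_nonneg (α := ℝ) k)
      linarith
    have ht : Tendsto (fun δ : ℝ => T + (2 * k + 1) * (δ / p)) (𝓝[>] 0)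
        (𝓝 (T + (2 * k + 1) * (0 / p))) :=
      (Continuous.tendsto (by fun_prop) 0).mono_left nhdsWithin_le_nhds
    have := ge_of_tendsto ht (by filter_upwards [Ioo_mem_nhdsGT hlam'] with δ hδ using key δ hδ)
    simp only [zero_div, mul_zero, add_zero] at this
    linarith
  rcases S'.advantage_dichotomy h hw with ⟨k, hk, -, h4⟩ | ⟨hG, h4⟩
  · exact finite k hk (h4 ▸ hneg)
  have ac : advantage p q lam' V' (equilibrium p q) ≤ 0 := by
    by_contra hcon
    exact ((S'.advantage_eq_pos_iff h).1 (not_le.1 hcon)).ne' hG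
  have hforever := S'.forever_eq h hpq hG w
  rcases ac.eq_or_lt with ac | ac
  · -- sampling at the equilibrium is as good as permanent passivity
    rw [S'.advantage_equilibrium h hpq hG] at ac
    have ht : Tendsto (fun k : ℕ => k * saving p q g' + passiveValue p q (evolve p q w)
        - passiveValue p q ((evolve p q)^[k + 1] w)
        - (1 - decay p q ^ k) * (w - equilibrium p q) * spread p q V') atTop
        (𝓝 (0 + passiveValue p q (evolve p q w) - 0
        - (1 - 0) * (w - equilibrium p q) * spread p q V')) := by
      simp only [hG, mul_zero]
      exact (((tendsto_const_nhds.add tendsto_const_nhds).sub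
        ((tendsto_add_atTop_iff_nat 1).2 (h.tendsto_passiveValue_iterate hw)))).sub
        (((tendsto_const_nhds.sub h.tendsto_pow).mul_const _).mul_const _)
    have hlim : 0 + passiveValue p q (evolve p q w) - 0
        - (1 - 0) * (w - equilibrium p q) * spread p q V' < 0 := by linarith
    obtain ⟨k, hk1, hk2⟩ :=
      ((ht.eventually (gt_mem_nhds hlim)).and (eventually_ge_atTop 1)).exists
    exact finite k hk2 hk1
  · -- the orbit of `p` stays strictly passive for slightly lower charges
    obtain ⟨μ, hμ, hμ'⟩ : ∃ μ > 0, ∀ k, 1 ≤ k → advantage p q lam' V' (pStep p q k) ≤ -μ := by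
      have hsub : Icc p (equilibrium p q) ⊆ Ioo (0 : ℝ) 1 := fun z hz =>
        ⟨h.hp.trans_le hz.1, hz.2.trans_lt h.eq_lt_one⟩
      have hpc : p ≤ equilibrium p q := by
        have := h.pStep_lt 1; rw [h.pStep_one] at this; exact this.le
      obtain ⟨z, hz, hmax⟩ := isCompact_Icc.exists_isMaxOn ⟨p, left_mem_Icc.2 hpc⟩
        (fun z hz => (S'.continuousAt_advantage h (hsub hz)).continuousWithinAt)
      refine ⟨-advantage p q lam' V' z, ?_, fun k hk => ?_⟩
      · rcases hz.2.eq_or_lt with rfl | h1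
        · linarith
        · linarith [S'.advantage_neg_of_lt_eq h hpq ac.le (hsub hz).1 h1]
      · rw [neg_neg]
        exact hmax ⟨h.p_le_pStep hk, (h.pStep_lt k).le⟩
    have key : ∀ δ ∈ Ioo 0 lam', min μ (-advantage p q lam' V' w) ≤ δ + δ / p := by
      intro δ hδ
      obtain ⟨g, V, S⟩ := h.exists_solution (lam := lam' - δ) (by linarith [hδ.2])
      have hle : lam' - δ ≤ lam' := by linarith [hδ.1]
      have e1 := abs_spread_sub_le h hpq S S' hle
      rw [sub_sub_cancel] at e1
      have e3 := hleft _ _ _ (by linarith [hδ.2]) (by linarith [hδ.1]) S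
      rcases S.saving_pos_or h with hG1 | ⟨hG1, -⟩
      · obtain ⟨L, hL, -, -, hL0⟩ := S.exists_stopP h hG1
        have f1 := S'.slackP_eq_max h hL fun k hk _ => by linarith [hμ' k hk]
        have f2 := slackP_sub p q (lam' - δ) (saving p q g) (spread p q V) lam' (saving p q g')
          (spread p q V') L
        have f3 : pStep p q L * (spread p q V' - spread p q V)
            ≤ |spread p q V' - spread p q V| :=
          (mul_le_mul_of_nonneg_left (le_abs_self _) (h.pStep_mem hL).1.le).trans
            (mul_le_of_le_one_left (abs_nonneg _) (h.pStep_mem hL).2.le)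
        have f4 := mul_nonneg (Nat.cast_nonneg (α := ℝ) L) hG1.le
        have f5 := le_max_right 0 (-advantage p q lam' V' (pStep p q L))
        refine (min_le_left _ _).trans ?_
        rw [f1, hL0, hG] at f2
        linarith [hμ' L hL]
      · have f1 := S.advantage_le_forever h hpq hG1 hw
        have f3 : w * (spread p q V' - spread p q V) ≤ |spread p q V' - spread p q V| :=
          (mul_le_mul_of_nonneg_left (le_abs_self _) hw.1.le).trans
            (mul_le_of_le_one_left (abs_nonneg _) hw.2.le)
        refine (min_le_right _ _).trans ?_
        linarith
    have ht : Tendsto (fun δ : ℝ => δ + δ / p) (𝓝[>] 0) (𝓝 (0 + 0 / p)) :=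
      (Continuous.tendsto (by fun_prop) 0).mono_left nhdsWithin_le_nhds
    have := ge_of_tendsto ht (by filter_upwards [Ioo_mem_nhdsGT hlam'] with δ hδ using key δ hδ)
    simp only [zero_div, add_zero] at this
    exact absurd this (not_le.2 (lt_min hμ (by linarith)))

lemma mem_passiveSet_iff {lam g : ℝ} {V : ℝ → ℝ} (S : IsBellmanSolution p q lam g V) {w : ℝ} :
    w ∈ passiveSet p q lam ↔ w ∈ Ioo (0 : ℝ) 1 ∧ advantage p q lam V w ≤ 0 := by
  constructor
  · rintro ⟨hw, g', V', S', h1⟩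
    refine ⟨hw, ?_⟩
    rw [advantage_unique h hpq S S' hw]
    exact advantage_nonpos_iff.2 h1
  · rintro ⟨hw, h1⟩
    exact ⟨hw, g, V, S, advantage_nonpos_iff.1 h1⟩

lemma samplingRegion_eq {lam g : ℝ} {V : ℝ → ℝ} (S : IsBellmanSolution p q lam g V) :
    samplingRegion p q lam = {w | w ∈ Ioo (0 : ℝ) 1 ∧ 0 < advantage p q lam V w} := by
  ext w
  rw [samplingRegion, Set.mem_sdiff, mem_passiveSet_iff h hpq S, mem_ofPred_eq]
  constructor
  · rintro ⟨h1, h2⟩; exact ⟨h1, not_le.1 fun h3 => h2 ⟨h1, h3⟩⟩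
  · rintro ⟨h1, h2⟩; exact ⟨h1, fun h3 => absurd h3.2 (not_le.2 h2)⟩

end IsBellmanSolution

section

variable {p q : ℝ} (h : IsMonotonic p q) (hpq : p ≤ q)
include h hpq

theorem indexable : Indexable p q where
  empty := by
    obtain ⟨g, V, S⟩ := h.exists_solution (le_refl 0)
    refine eq_empty_of_forall_notMem fun w hw => ?_
    obtain ⟨hw', h1⟩ := (S.mem_passiveSet_iff h hpq).1 hw
    linarith [S.neg_charge_lt_advantage h hw']
  monotone := by
    intro lam hlam lam' hlam' hle
    rcases hle.eq_or_lt with rfl | hlt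
    · exact le_rfl
    obtain ⟨g, V, S⟩ := h.exists_solution hlam
    obtain ⟨g', V', S'⟩ := h.exists_solution hlam'
    intro w hw
    obtain ⟨hw', h1⟩ := (S.mem_passiveSet_iff h hpq).1 hw
    exact (S'.mem_passiveSet_iff h hpq).2 ⟨hw', (S.advantage_neg_of_lt h S' hpq hlt hw' h1).le⟩
  whole := by
    refine ⟨2 * passiveConst p q, fun lam hlam => ?_⟩
    obtain ⟨S, hS⟩ := h.isBellmanSolution_passiveValue hlam
    ext w
    rw [S.mem_passiveSet_iff h hpq]
    exact ⟨fun h1 => h1.1, fun h1 => ⟨h1, hS w h1⟩⟩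

lemma passive_charges_nonempty {w : ℝ} (hw : w ∈ Ioo (0 : ℝ) 1) :
    2 * passiveConst p q ∈ {lam : ℝ | 0 ≤ lam ∧ w ∈ passiveSet p q lam} := by
  obtain ⟨S, hS⟩ := h.isBellmanSolution_passiveValue le_rfl
  exact ⟨by linarith [h.passiveConst_nonneg], (S.mem_passiveSet_iff h hpq).2 ⟨hw, hS w hw⟩⟩

omit h hpq in
lemma bddBelow_passive_charges (p q w : ℝ) :
    BddBelow {lam : ℝ | 0 ≤ lam ∧ w ∈ passiveSet p q lam} := ⟨0, fun _ h1 => h1.1⟩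

omit h hpq in
lemma whittleIndex_nonneg (p q w : ℝ) : 0 ≤ whittleIndex p q w :=
  Real.sInf_nonneg fun _ h1 => h1.1

lemma whittleIndex_le_const {w : ℝ} (hw : w ∈ Ioo (0 : ℝ) 1) :
    whittleIndex p q w ≤ 2 * passiveConst p q :=
  csInf_le (bddBelow_passive_charges p q w) (passive_charges_nonempty h hpq hw)

variable {lam g : ℝ} {V : ℝ → ℝ} (hlam : 0 ≤ lam) (S : IsBellmanSolution p q lam g V) {w : ℝ}
  (hw : w ∈ Ioo (0 : ℝ) 1)
include hlam S hw

theorem whittleIndex_le_iff : whittleIndex p q w ≤ lam ↔ advantage p q lam V w ≤ 0 := by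
  constructor
  · intro h1
    have hlt : ∀ lam' g' V', whittleIndex p q w < lam' → IsBellmanSolution p q lam' g' V' →
        advantage p q lam' V' w ≤ 0 := by
      intro lam' g' V' h2 S'
      obtain ⟨lam₁, ⟨-, hmem⟩, h3⟩ := exists_lt_of_csInf_lt ⟨_, passive_charges_nonempty h hpq hw⟩ h2
      obtain ⟨-, g₁, V₁, S₁, h4⟩ := hmem
      exact (S₁.advantage_neg_of_lt h S' hpq h3 hw (advantage_nonpos_iff.2 h4)).le
    exact IsBellmanSolution.advantage_nonpos_of_right h hpq hlam S hw fun lam' g' V' h2 S' =>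
      hlt _ _ _ (h1.trans_lt h2) S'
  · intro h1
    exact csInf_le (bddBelow_passive_charges p q w) ⟨hlam, (S.mem_passiveSet_iff h hpq).2 ⟨hw, h1⟩⟩

theorem le_whittleIndex_iff : lam ≤ whittleIndex p q w ↔ 0 ≤ advantage p q lam V w := by
  constructor
  · intro h1
    rcases hlam.eq_or_lt with rfl | hpos
    · linarith [S.neg_charge_lt_advantage h hw]
    refine IsBellmanSolution.advantage_nonneg_of_left h hpq hpos S hw fun lam' g' V' h2 h3 S' => ?_
    by_contra hcon
    exact absurd ((whittleIndex_le_iff h hpq h2 S' hw).2 (not_lt.1 hcon)) (not_le.2 (h3.trans_le h1))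
  · intro h1
    refine le_csInf ⟨_, passive_charges_nonempty h hpq hw⟩ ?_
    rintro lam' ⟨h2, -, g', V', S', h4⟩
    by_contra hcon
    have := S'.advantage_neg_of_lt h S hpq (not_le.1 hcon) hw (advantage_nonpos_iff.2 h4)
    linarith

end

/-! ### The truncated belief space -/

lemma mem_beliefStates {p q : ℝ} {F : ℕ} {s : ℝ} : s ∈ beliefStates p q F ↔
    s = equilibrium p q ∨ (∃ k, 1 ≤ k ∧ k ≤ F ∧ s = pStep p q k) ∨
      ∃ k, 1 ≤ k ∧ k ≤ F ∧ s = 1 - qStep p q k := by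
  unfold beliefStates
  constructor
  · rintro ((h1 | ⟨k, hk, h1⟩) | ⟨k, hk, h1⟩)
    · exact Or.inl h1
    · exact Or.inr (Or.inl ⟨k, hk.1, hk.2, h1.symm⟩)
    · exact Or.inr (Or.inr ⟨k, hk.1, hk.2, h1.symm⟩)
  · rintro (h1 | ⟨k, hk1, hk2, h1⟩ | ⟨k, hk1, hk2, h1⟩)
    · exact Or.inl (Or.inl h1)
    · exact Or.inl (Or.inr ⟨k, ⟨hk1, hk2⟩, h1.symm⟩)
    · exact Or.inr ⟨k, ⟨hk1, hk2⟩, h1.symm⟩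

lemma sum_Icc_one (f : ℕ → ℝ) (n : ℕ) :
    ∑ k ∈ Finset.Icc 1 n, f k = ∑ j ∈ Finset.range n, f (j + 1) := by
  induction n with
  | zero => simp
  | succ n ih => rw [Finset.sum_Icc_succ_top (by omega), ih, Finset.sum_range_succ]

lemma hittingTime_eq {p q : ℝ} {F : ℕ} {w : ℝ} {A : Set ℝ} {m : ℕ}
    (hm : (truncEvolve p q F)^[m] w ∈ A) (hlt : ∀ k < m, (truncEvolve p q F)^[k] w ∉ A) :
    hittingTime p q F w A = m :=
  le_antisymm (iInf₂_le m hm) (le_iInf₂ fun k hk => by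
    exact_mod_cast not_lt.1 fun hkm => hlt k hkm hk)

/-- The first visit to `A` of an orbit of the truncated space that runs through `s 1, …, s F` and
then stays at the equilibrium. -/
lemma exists_hittingTime {p q : ℝ} {F : ℕ} {w : ℝ} {A : Set ℝ} {s : ℕ → ℝ}
    (hs : ∀ k < F, (truncEvolve p q F)^[k] w = s (k + 1))
    (hF : (truncEvolve p q F)^[F] w = equilibrium p q)
    (hA : equilibrium p q ∈ A ∨ ∃ k, 1 ≤ k ∧ k ≤ F ∧ s k ∈ A) :
    ∃ L : ℕ, 1 ≤ L ∧ L ≤ F + 1 ∧ hittingTime p q F w A + 1 = L ∧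
      (∀ k, 1 ≤ k → k < L → s k ∉ A) ∧ (L ≤ F → s L ∈ A) ∧
      (L = F + 1 → equilibrium p q ∈ A) := by
  classical
  have hex : ∃ m, m ≤ F ∧ (truncEvolve p q F)^[m] w ∈ A := by
    rcases hA with h1 | ⟨k, hk1, hk2, h1⟩
    · exact ⟨F, le_rfl, by rwa [hF]⟩
    · refine ⟨k - 1, by omega, ?_⟩
      rwa [hs _ (by omega), Nat.sub_add_cancel hk1]
  obtain ⟨h1, h2⟩ := Nat.find_spec hex
  have h3 : ∀ k < Nat.find hex, (truncEvolve p q F)^[k] w ∉ A := fun k hk hk' =>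
    Nat.find_min hex hk ⟨by omega, hk'⟩
  refine ⟨Nat.find hex + 1, by omega, by omega, ?_, fun k hk1 hk2 => ?_, fun hL => ?_, fun hL => ?_⟩
  · rw [hittingTime_eq h2 h3]; push_cast; rfl
  · have := h3 (k - 1) (by omega)
    rwa [hs _ (by omega), Nat.sub_add_cancel hk1] at this
  · rwa [hs _ (by omega)] at h2
  · rwa [show Nat.find hex = F by omega, hF] at h2

namespace IsMonotonic

variable {p q : ℝ} (h : IsMonotonic p q) {F : ℕ}
include h

lemma beliefStates_subset : beliefStates p q F ⊆ Ioo 0 1 := by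
  intro s hs
  rcases mem_beliefStates.1 hs with rfl | ⟨k, hk, -, rfl⟩ | ⟨k, hk, -, rfl⟩
  · exact h.eq_mem
  · exact h.pStep_mem hk
  · exact h.qStep_mem hk

lemma truncEvolve_pStep {k : ℕ} (hk : k < F) (hk1 : 1 ≤ k) :
    truncEvolve p q F (pStep p q k) = pStep p q (k + 1) := by
  have h1 : evolve p q (pStep p q k) = pStep p q (k + 1) := h.iterate_pStep 1 k
  rw [truncEvolve, h1, if_pos]
  exact mem_beliefStates.2 (Or.inr (Or.inl ⟨k + 1, by omega, hk, rfl⟩))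

lemma truncEvolve_qStep {k : ℕ} (hk : k < F) (hk1 : 1 ≤ k) :
    truncEvolve p q F (1 - qStep p q k) = 1 - qStep p q (k + 1) := by
  have h1 : evolve p q (1 - qStep p q k) = 1 - qStep p q (k + 1) := h.iterate_qStep 1 k
  rw [truncEvolve, h1, if_pos]
  exact mem_beliefStates.2 (Or.inr (Or.inr ⟨k + 1, by omega, hk, rfl⟩))

lemma truncEvolve_pStep_last : truncEvolve p q F (pStep p q F) = equilibrium p q := by
  have h1 : evolve p q (pStep p q F) = pStep p q (F + 1) := h.iterate_pStep 1 F
  rw [truncEvolve, h1, if_neg]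
  intro hmem
  rcases mem_beliefStates.1 hmem with h2 | ⟨k, -, hk, h2⟩ | ⟨k, -, -, h2⟩
  · exact (h.pStep_lt _).ne h2
  · have := h.pStep_strictMono.injective h2; omega
  · exact ((h.pStep_lt _).trans (h.lt_one_sub_qStep _)).ne h2

lemma truncEvolve_qStep_last : truncEvolve p q F (1 - qStep p q F) = equilibrium p q := by
  have h1 : evolve p q (1 - qStep p q F) = 1 - qStep p q (F + 1) := h.iterate_qStep 1 F
  rw [truncEvolve, h1, if_neg]
  intro hmem
  rcases mem_beliefStates.1 hmem with h2 | ⟨k, -, -, h2⟩ | ⟨k, -, hk, h2⟩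
  · exact (h.lt_one_sub_qStep _).ne' h2
  · exact ((h.pStep_lt _).trans (h.lt_one_sub_qStep _)).ne' h2
  · have := h.qStep_strictMono.injective (sub_right_injective h2); omega

lemma iterate_truncEvolve_p {k : ℕ} (hk : k < F) :
    (truncEvolve p q F)^[k] p = pStep p q (k + 1) := by
  induction k with
  | zero => exact h.pStep_one.symm
  | succ k ih =>
    rw [Function.iterate_succ_apply', ih (by omega), h.truncEvolve_pStep (by omega) (by omega)]

lemma iterate_truncEvolve_q {k : ℕ} (hk : k < F) :
    (truncEvolve p q F)^[k] (1 - q) = 1 - qStep p q (k + 1) := by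
  induction k with
  | zero => rw [zero_add, h.qStep_one]; rfl
  | succ k ih =>
    rw [Function.iterate_succ_apply', ih (by omega), h.truncEvolve_qStep (by omega) (by omega)]

lemma iterate_truncEvolve_p_last (hF : 1 ≤ F) : (truncEvolve p q F)^[F] p = equilibrium p q := by
  obtain ⟨m, rfl⟩ := Nat.exists_eq_add_of_le' hF
  rw [Function.iterate_succ_apply', h.iterate_truncEvolve_p (by omega), h.truncEvolve_pStep_last]

lemma iterate_truncEvolve_q_last (hF : 1 ≤ F) :
    (truncEvolve p q F)^[F] (1 - q) = equilibrium p q := by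
  obtain ⟨m, rfl⟩ := Nat.exists_eq_add_of_le' hF
  rw [Function.iterate_succ_apply', h.iterate_truncEvolve_q (by omega), h.truncEvolve_qStep_last]

lemma sumP_eq (L : ℕ) : sumP p q L = L * entropy (equilibrium p q)
    + (passiveValue p q p - passiveValue p q (pStep p q (L + 1))) := by
  have h1 := h.sum_entropy_iterate 0 L h.p_mem
  simp only [h.iterate_p, sub_zero] at h1
  rw [sumP, sum_Icc_one, h1]; ring

lemma sumQ_eq (K : ℕ) : sumQ p q K = K * entropy (equilibrium p q)
    + (passiveValue p q (1 - q) - passiveValue p q (1 - qStep p q (K + 1))) := by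
  have h1 := h.sum_entropy_iterate 0 K h.q_mem
  simp only [h.iterate_q, sub_zero] at h1
  rw [sumQ, sum_Icc_one, h1]; ring

end IsMonotonic

namespace IsWhittleOrdering

variable {p q : ℝ} {F : ℕ} {x : Fin (2 * F + 1) → ℝ} (hx : IsWhittleOrdering p q F x)
include hx

lemma mem_states (i : Fin (2 * F + 1)) : x i ∈ beliefStates p q F := by
  rw [← hx.range_eq]; exact mem_range_self i

lemma mem_Ioo (h : IsMonotonic p q) (i : Fin (2 * F + 1)) : x i ∈ Ioo (0 : ℝ) 1 :=
  h.beliefStates_subset (hx.mem_states i)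

lemma mem_activeStates_iff {n i : Fin (2 * F + 1)} : x i ∈ activeStates x n ↔ n ≤ i := by
  rw [activeStates, hx.injective.mem_set_image, mem_Ici]

/-- At the charge `W (x n)`, sampling is optimal in the active states and passivity in the others. -/
lemma advantage_facts (h : IsMonotonic p q) (hpq : p ≤ q) {n : Fin (2 * F + 1)} {g : ℝ} {V : ℝ → ℝ}
    (S : IsBellmanSolution p q (whittleIndex p q (x n)) g V) :
    (∀ s ∈ activeStates x n, 0 ≤ advantage p q (whittleIndex p q (x n)) V s) ∧
    (∀ s ∈ beliefStates p q F, s ∉ activeStates x n →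
      advantage p q (whittleIndex p q (x n)) V s ≤ 0) ∧
    advantage p q (whittleIndex p q (x n)) V (x n) = 0 := by
  have h0 := whittleIndex_nonneg p q (x n)
  refine ⟨?_, ?_, le_antisymm ?_ ?_⟩
  · rintro _ ⟨i, hi, rfl⟩
    exact (le_whittleIndex_iff h hpq h0 S (hx.mem_Ioo h i)).1 (hx.monotone hi)
  · intro s hs hsn
    rw [← hx.range_eq] at hs
    obtain ⟨i, rfl⟩ := hs
    rw [hx.mem_activeStates_iff, not_le] at hsn
    exact (whittleIndex_le_iff h hpq h0 S (hx.mem_Ioo h i)).1 (hx.monotone hsn.le)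
  · exact (whittleIndex_le_iff h hpq h0 S (hx.mem_Ioo h n)).1 le_rfl
  · exact (le_whittleIndex_iff h hpq h0 S (hx.mem_Ioo h n)).1 le_rfl

end IsWhittleOrdering

/-! ### The index while the equilibrium is sampled -/

namespace IsBellmanSolution

variable {p q lam g : ℝ} {V : ℝ → ℝ} (h : IsMonotonic p q) (S : IsBellmanSolution p q lam g V)
include h S

/-- If sampling is optimal at the equilibrium, then it is almost optimal late on the orbit of `p`:
the advantage is concave and at least `-lam` at `p`. -/
lemma neg_advantage_pStep_le (hc : 0 ≤ advantage p q lam V (equilibrium p q))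
    {n : ℕ} (hn : 1 ≤ n) : -advantage p q lam V (pStep p q n) ≤ lam * decay p q ^ (n - 1) := by
  have h1 := (S.strictConcaveOn_advantage h).concaveOn.2 h.eq_mem h.p_mem
    (sub_nonneg.2 (h.pow_le_one (n - 1))) (h.pow_pos (n - 1)).le (by ring)
  have h2 : (1 - decay p q ^ (n - 1)) • equilibrium p q + decay p q ^ (n - 1) • p
      = pStep p q n := by
    obtain ⟨m, rfl⟩ := Nat.exists_eq_add_of_le' hn
    have e1 := h.pStep_eq (m + 1)
    rw [Nat.add_sub_cancel, smul_eq_mul, smul_eq_mul, e1, pow_succ]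
    linear_combination decay p q ^ m * h.p_eq
  rw [h2] at h1
  simp only [smul_eq_mul] at h1
  have h3 := mul_nonneg (sub_nonneg.2 (h.pow_le_one (n - 1))) hc
  have h4 := mul_le_mul_of_nonneg_left (S.neg_charge_le_advantage h h.p_mem) (h.pow_pos (n - 1)).le
  linarith

lemma neg_advantage_qStep_le (hc : 0 ≤ advantage p q lam V (equilibrium p q))
    {n : ℕ} (hn : 1 ≤ n) :
    -advantage p q lam V (1 - qStep p q n) ≤ lam * decay p q ^ (n - 1) := by
  have h1 := (S.strictConcaveOn_advantage h).concaveOn.2 h.eq_mem h.q_mem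
    (sub_nonneg.2 (h.pow_le_one (n - 1))) (h.pow_pos (n - 1)).le (by ring)
  have h2 : (1 - decay p q ^ (n - 1)) • equilibrium p q + decay p q ^ (n - 1) • (1 - q)
      = 1 - qStep p q n := by
    obtain ⟨m, rfl⟩ := Nat.exists_eq_add_of_le' hn
    have e1 := h.qStep_eq (m + 1)
    rw [Nat.add_sub_cancel, smul_eq_mul, smul_eq_mul, e1, pow_succ]
    linear_combination -decay p q ^ m * h.q_eq
  rw [h2] at h1
  simp only [smul_eq_mul] at h1
  have h3 := mul_nonneg (sub_nonneg.2 (h.pow_le_one (n - 1))) hc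
  have h4 := mul_le_mul_of_nonneg_left (S.neg_charge_le_advantage h h.q_mem) (h.pow_pos (n - 1)).le
  linarith

/-- At a belief where both actions are optimal and whose successor is sampled, sampling now or in
the next slot costs the same. -/
lemma entropy_evolve_sub {w : ℝ} (hw : w ∈ Ioo (0 : ℝ) 1) (aw : advantage p q lam V w = 0)
    (aw' : 0 ≤ advantage p q lam V (evolve p q w)) :
    entropy (evolve p q w) - g = (w - evolve p q w) * spread p q V := by
  have h1 := S.value_eq_active (h.evolve_mem hw) aw'
  rw [advantage, h1, sampleCost_eq, sampleCost_eq] at aw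
  linarith

/-- Cramer's rule for the two cycle equations and the equation at the threshold `w`, with the slacks
of the cycle equations as error terms. -/
lemma charge_mul_eq {w : ℝ} (hw : w ∈ Ioo (0 : ℝ) 1) (aw : advantage p q lam V w = 0)
    (aw' : 0 ≤ advantage p q lam V (evolve p q w)) (L K : ℕ) :
    lam * ((w - evolve p q w) * ((L : ℝ) - K) + qStep p q K + pStep p q L)
      = (coeffB p q L K * entropy (evolve p q w) - coeffG p q L K
          - (w - evolve p q w) * coeffC p q L K)
        + (pStep p q L + (w - evolve p q w) * L) * slackQ p q lam (saving p q g) (spread p q V) K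
        + (qStep p q K - (w - evolve p q w) * K)
          * slackP p q lam (saving p q g) (spread p q V) L := by
  have h1 := S.entropy_evolve_sub h hw aw aw'
  have h2 : slackP p q lam (saving p q g) (spread p q V) L
      = sumP p q L - L * g + lam + pStep p q L * spread p q V := by
    rw [slackP, h.sumP_eq, saving]; ring
  have h3 : slackQ p q lam (saving p q g) (spread p q V) K
      = sumQ p q K - K * g + lam - qStep p q K * spread p q V := by
    rw [slackQ, h.sumQ_eq, saving]; ring
  rw [h2, h3, coeffB, coeffG, coeffC, show entropy (evolve p q w)
    = g + (w - evolve p q w) * spread p q V by linarith]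
  ring

end IsBellmanSolution

namespace IsMonotonic

variable {p q : ℝ} (h : IsMonotonic p q)
include h

lemma sub_evolve (w : ℝ) : w - evolve p q w = (1 - decay p q) * (w - equilibrium p q) := by
  rw [h.evolve_eq]; ring

lemma abs_sub_evolve_le {w : ℝ} (hw : w ∈ Ioo (0 : ℝ) 1) : |w - evolve p q w| ≤ 1 := by
  rw [h.sub_evolve, abs_mul, abs_of_pos h.one_sub_decay_pos]
  exact mul_le_one₀ (by linarith [h.decay_pos]) (abs_nonneg _) (h.abs_sub_eq_le_one hw)

/-- The common form of the two estimates on the denominator of `centralIndex`. -/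
lemma mul_pow_le_of_le {L j : ℕ} (hL : 1 ≤ L) (hLj : L ≤ j) :
    (1 - decay p q) * decay p q ^ j * L ≤ 1 - decay p q ^ L := by
  refine le_trans ?_ (h.mul_pow_le hL)
  have h1 : decay p q ^ j ≤ decay p q ^ (L - 1) :=
    pow_le_pow_of_le_one h.decay_pos.le h.decay_lt_one.le (by omega)
  have h2 := mul_le_mul_of_nonneg_left h1
    (mul_nonneg h.one_sub_decay_pos.le (Nat.cast_nonneg (α := ℝ) L))
  linarith

/-- The denominator of `centralIndex` is bounded away from zero. At `w = pStep j` the cycle from `p`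
ends at `w` or earlier, and at `w = 1 - qStep j` the cycle from `1 - q` does. -/
lemma le_denominator (hpq : p ≤ q) {L K : ℕ} (hL : 1 ≤ L) (hK : 1 ≤ K) {w : ℝ}
    (hw : w = equilibrium p q ∨ (∃ j, L ≤ j ∧ w = pStep p q j) ∨
      ∃ j, K ≤ j ∧ w = 1 - qStep p q j) :
    p ≤ (w - evolve p q w) * ((L : ℝ) - K) + qStep p q K + pStep p q L := by
  have h1 := h.p_le_pStep hL
  have h2 := h.q_le_qStep hK
  have h3 := h.hp
  have hK0 : (0 : ℝ) ≤ K := Nat.cast_nonneg K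
  have hL0 : (0 : ℝ) ≤ L := Nat.cast_nonneg L
  rw [h.sub_evolve]
  rcases hw with rfl | ⟨j, hj, rfl⟩ | ⟨j, hj, rfl⟩
  · rw [sub_self, mul_zero, zero_mul]; linarith
  · have h4 := mul_le_mul_of_nonneg_left (h.mul_pow_le_of_le hL hj) h.eq_pos.le
    have h5 := h.pStep_eq L
    have h6 := h.eq_sub_pStep j
    have h7 : 0 ≤ (1 - decay p q) * (equilibrium p q * decay p q ^ j) * K :=
      mul_nonneg (mul_nonneg h.one_sub_decay_pos.le
        (mul_nonneg h.eq_pos.le (h.pow_pos j).le)) hK0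
    rw [show pStep p q j - equilibrium p q = -(equilibrium p q * decay p q ^ j) by linarith]
    linarith
  · have h4 := mul_le_mul_of_nonneg_left (h.mul_pow_le_of_le hK hj) (sub_pos.2 h.eq_lt_one).le
    have h5 := h.qStep_eq K
    have h6 := h.qStep_sub_eq j
    have h7 : 0 ≤ (1 - decay p q) * ((1 - equilibrium p q) * decay p q ^ j) * L :=
      mul_nonneg (mul_nonneg h.one_sub_decay_pos.le
        (mul_nonneg (sub_pos.2 h.eq_lt_one).le (h.pow_pos j).le)) hL0
    rw [h6]
    linarith

end IsMonotonic

/-- A bound on the truncation error of `centralIndex`. -/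
noncomputable def centralError (p q : ℝ) (F : ℕ) : ℝ :=
  2 * (F + 2) * (2 * passiveConst p q * decay p q ^ F) / p

namespace IsWhittleOrdering

variable {p q : ℝ} {F : ℕ} {x : Fin (2 * F + 1) → ℝ} (hx : IsWhittleOrdering p q F x)
include hx

/-- While the equilibrium is sampled, both orbits reach the active set. A cycle that ends within the
truncation has slack zero; one that is cut off ends in the equilibrium, and its slack is small by
`neg_advantage_pStep_le` or `neg_advantage_qStep_le`. -/
theorem whittleIndex_central (h : IsMonotonic p q) (hpq : p ≤ q) (hF : 1 ≤ F)
    {e n : Fin (2 * F + 1)} (he : x e = equilibrium p q) (hn : n ≤ e) :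
    ∃ L K : ℕ, cycleL p q x n = L ∧ cycleK p q x n = K ∧
      (L ≤ F → K ≤ F → whittleIndex p q (x n) = centralIndex p q L K (x n)) ∧
      |whittleIndex p q (x n) - centralIndex p q L K (x n)| ≤ centralError p q F := by
  have hlam := whittleIndex_nonneg p q (x n)
  have hlamC := whittleIndex_le_const h hpq (hx.mem_Ioo h n)
  obtain ⟨g, V, S⟩ := h.exists_solution hlam
  obtain ⟨act, pas, a0⟩ := hx.advantage_facts h hpq S
  set lam := whittleIndex p q (x n) with hlamdef
  set A := activeStates x n with hA
  have hcA : equilibrium p q ∈ A := by rw [← he]; exact hx.mem_activeStates_iff.2 hn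
  have hxA : x n ∈ A := hx.mem_activeStates_iff.2 le_rfl
  have ac := act _ hcA
  obtain ⟨L, hL, hLF, hL1, hL2, hL3, -⟩ := exists_hittingTime (A := A) (s := pStep p q)
    (fun k hk => h.iterate_truncEvolve_p hk) (h.iterate_truncEvolve_p_last hF) (Or.inl hcA)
  obtain ⟨K, hK, hKF, hK1, hK2, hK3, -⟩ := exists_hittingTime (A := A)
    (s := fun k => 1 - qStep p q k)
    (fun k hk => h.iterate_truncEvolve_q hk) (h.iterate_truncEvolve_q_last hF) (Or.inl hcA)
  have sP := S.slackP_eq_max h hL fun k hk hkL => pas _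
    (mem_beliefStates.2 (Or.inr (Or.inl ⟨k, hk, by omega, rfl⟩))) (hL2 k hk hkL)
  have sQ := S.slackQ_eq_max h hK fun k hk hkK => pas _
    (mem_beliefStates.2 (Or.inr (Or.inr ⟨k, hk, by omega, rfl⟩))) (hK2 k hk hkK)
  have aτ : 0 ≤ advantage p q lam V (evolve p q (x n)) := by
    have e1 := h.evolve_eq (x n)
    rcases le_total (x n) (equilibrium p q) with h1 | h1
    · exact S.advantage_nonneg_of_between h (hx.mem_Ioo h n) h.eq_mem
        (by nlinarith [h.decay_lt_one]) (by nlinarith [h.decay_pos]) a0.ge ac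
    · exact S.advantage_nonneg_of_between h h.eq_mem (hx.mem_Ioo h n)
        (by nlinarith [h.decay_pos]) (by nlinarith [h.decay_lt_one]) ac a0.ge
  have cramer := S.charge_mul_eq h (hx.mem_Ioo h n) a0 aτ L K
  have hd : p ≤ (x n - evolve p q (x n)) * ((L : ℝ) - K) + qStep p q K + pStep p q L := by
    refine h.le_denominator hpq hL hK ?_
    rcases mem_beliefStates.1 (hx.mem_states n) with h1 | ⟨j, hj, -, h1⟩ | ⟨j, hj, -, h1⟩
    · exact Or.inl h1
    · refine Or.inr (Or.inl ⟨j, not_lt.1 fun h2 => hL2 j hj h2 (h1 ▸ hxA), h1⟩)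
    · refine Or.inr (Or.inr ⟨j, not_lt.1 fun h2 => hK2 j hj h2 (h1 ▸ hxA), h1⟩)
  have hd0 := h.hp.trans_le hd
  refine ⟨L, K, hL1, hK1, fun h1 h2 => ?_, ?_⟩
  · rw [max_eq_left (neg_nonpos.2 (act _ (hL3 h1)))] at sP
    rw [max_eq_left (neg_nonpos.2 (act _ (hK3 h2)))] at sQ
    rw [sP, sQ] at cramer
    rw [centralIndex, eq_div_iff hd0.ne']
    linarith
  · have rP : slackP p q lam (saving p q g) (spread p q V) L
        ≤ 2 * passiveConst p q * decay p q ^ F := by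
      have hβ := (h.pow_pos F).le
      have hC := h.passiveConst_nonneg
      rw [sP]
      refine max_le (by positivity) ?_
      rcases hLF.lt_or_eq with h1 | rfl
      · exact (neg_nonpos.2 (act _ (hL3 (by omega)))).trans (by positivity)
      · refine (S.neg_advantage_pStep_le h ac hL).trans ?_
        exact mul_le_mul_of_nonneg_right hlamC hβ
    have rQ : slackQ p q lam (saving p q g) (spread p q V) K
        ≤ 2 * passiveConst p q * decay p q ^ F := by
      have hβ := (h.pow_pos F).le
      have hC := h.passiveConst_nonneg
      rw [sQ]
      refine max_le (by positivity) ?_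
      rcases hKF.lt_or_eq with h1 | rfl
      · exact (neg_nonpos.2 (act _ (hK3 (by omega)))).trans (by positivity)
      · refine (S.neg_advantage_qStep_le h ac hK).trans ?_
        exact mul_le_mul_of_nonneg_right hlamC hβ
    have rP0 := S.slackP_nonneg h hL
    have rQ0 := S.slackQ_nonneg h hK
    set d := (x n - evolve p q (x n)) * ((L : ℝ) - K) + qStep p q K + pStep p q L with hddef
    set N := coeffB p q L K * entropy (evolve p q (x n)) - coeffG p q L K
      - (x n - evolve p q (x n)) * coeffC p q L K with hN
    set B := 2 * passiveConst p q * decay p q ^ F with hB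
    have hy := h.abs_sub_evolve_le (hx.mem_Ioo h n)
    set y := x n - evolve p q (x n) with hydef
    have hLF' : (L : ℝ) ≤ F + 1 := by exact_mod_cast hLF
    have hKF' : (K : ℝ) ≤ F + 1 := by exact_mod_cast hKF
    have b1 : |pStep p q L + y * L| ≤ F + 2 := by
      refine (abs_add_le _ _).trans ?_
      rw [abs_of_pos (h.pStep_mem hL).1, abs_mul, Nat.abs_cast]
      have := mul_le_of_le_one_left (Nat.cast_nonneg (α := ℝ) L) hy
      linarith [(h.pStep_mem hL).2]
    have b2 : |qStep p q K - y * K| ≤ F + 2 := by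
      refine (abs_sub _ _).trans ?_
      rw [abs_of_pos (h.hq.trans_le (h.q_le_qStep hK)), abs_mul, Nat.abs_cast]
      have := mul_le_of_le_one_left (Nat.cast_nonneg (α := ℝ) K) hy
      linarith [h.qStep_lt_one K]
    have hF0 : (0 : ℝ) ≤ F + 2 := by positivity
    have hB0 : 0 ≤ B := rP0.trans rP
    have b3 : |(pStep p q L + y * L) * slackQ p q lam (saving p q g) (spread p q V) K|
        ≤ (F + 2) * B := by
      rw [abs_mul, abs_of_nonneg rQ0]; exact mul_le_mul b1 rQ rQ0 hF0
    have b4 : |(qStep p q K - y * K) * slackP p q lam (saving p q g) (spread p q V) L|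
        ≤ (F + 2) * B := by
      rw [abs_mul, abs_of_nonneg rP0]; exact mul_le_mul b2 rP rP0 hF0
    have e1 : lam - centralIndex p q L K (x n) = (lam * d - N) / d := by
      have e0 : centralIndex p q L K (x n) = N / d := rfl
      rw [e0, eq_div_iff hd0.ne', sub_mul, div_mul_cancel₀ _ hd0.ne']
    rw [e1, abs_div, abs_of_pos hd0, centralError]
    refine div_le_div₀ (mul_nonneg (mul_nonneg two_pos.le hF0) hB0) ?_ h.hp hd
    rw [cramer, add_assoc, add_sub_cancel_left]
    exact (abs_add_le _ _).trans (by linarith)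

end IsWhittleOrdering

/-! ### The index once the equilibrium is passive -/

namespace IsMonotonic

variable {p q : ℝ} (h : IsMonotonic p q)
include h

lemma sumQ_sub (K : ℕ) :
    ∑ k ∈ Finset.Icc 1 K, (entropy (1 - qStep p q k) - entropy (equilibrium p q))
      = passiveValue p q (1 - q) - passiveValue p q (1 - qStep p q (K + 1)) := by
  have h1 := h.sumQ_eq K
  rw [sumQ] at h1
  rw [Finset.sum_sub_distrib, h1, Finset.sum_const, Nat.card_Icc, Nat.add_sub_cancel, nsmul_eq_mul]
  ring

lemma sum_iterate_sub_pStep (F : ℕ) {w : ℝ} (hw : w ∈ Ioo (0 : ℝ) 1) :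
    ∑ k ∈ Finset.Icc 1 F, (entropy ((evolve p q)^[k] w) - entropy (pStep p q k))
      = passiveValue p q (evolve p q w) - passiveValue p q ((evolve p q)^[F + 1] w)
        - (passiveValue p q p - passiveValue p q (pStep p q (F + 1))) := by
  have h1 := h.sum_entropy_iterate 0 F (h.evolve_mem hw)
  simp only [sub_zero, ← Function.iterate_succ_apply] at h1
  have h2 := h.sumP_eq F
  rw [sumP] at h2
  rw [Finset.sum_sub_distrib, h2, sum_Icc_one, h1]
  ring

end IsMonotonic

/-- A bound on the truncation error of `lowerIndex`. -/
noncomputable def lowerError (p q : ℝ) (F : ℕ) : ℝ :=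
  10 * passiveConst p q / p * decay p q ^ F / q

namespace IsBellmanSolution

variable {p q lam g : ℝ} {V : ℝ → ℝ} (h : IsMonotonic p q) (hpq : p ≤ q)
  (S : IsBellmanSolution p q lam g V) (hG : saving p q g = 0)
include h hpq S hG

/-- On the orbit of `1 - q`, the relative value approaches that of permanent passivity. -/
lemma value_qStep_bounds (hlam : lam ≤ 2 * passiveConst p q) (n : ℕ) :
    V (1 - qStep p q (n + 1)) - V (equilibrium p q) - passiveValue p q (1 - qStep p q (n + 1)) ≤ 0 ∧
    -(6 * passiveConst p q / p * decay p q ^ n) ≤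
      V (1 - qStep p q (n + 1)) - V (equilibrium p q)
        - passiveValue p q (1 - qStep p q (n + 1)) := by
  have hmem := h.qStep_mem (by omega : 1 ≤ n + 1)
  refine ⟨by linarith [S.value_le_forever h hG hmem], ?_⟩
  have h1 := (S.concaveOn h).2 h.eq_mem h.q_mem
    (sub_nonneg.2 (h.pow_le_one n)) (h.pow_pos n).le (by ring)
  have h2 : (1 - decay p q ^ n) • equilibrium p q + decay p q ^ n • (1 - q)
      = 1 - qStep p q (n + 1) := by
    have e1 := h.qStep_eq (n + 1)
    rw [smul_eq_mul, smul_eq_mul, e1, pow_succ]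
    linear_combination -decay p q ^ n * h.q_eq
  rw [h2] at h1
  simp only [smul_eq_mul] at h1
  have h3 := S.slackP_nonneg h le_rfl
  have h4 := abs_le.1 (h.abs_passiveValue_le_const h.p_mem)
  have h5 := abs_le.1 (h.abs_passiveValue_le_const (h.pStep_mem (by omega : 1 ≤ 1 + 1)))
  have h6 := abs_le.1 (h.abs_passiveValue_iterate_le n h.q_mem)
  rw [h.iterate_q] at h6
  have h7 := S.value_p_of_saving_eq_zero h hpq hG
  rw [slackP, hG, h.pStep_one] at h3
  have hR := h.passiveConst_nonneg
  have hp := h.hp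
  have h8 : -(4 * passiveConst p q / p) ≤ spread p q V := by
    rw [← neg_div, div_le_iff₀ hp]; linarith
  have h9 : V (1 - q) - V (equilibrium p q) = spread p q V + passiveValue p q p := by
    unfold spread; linarith
  have h10 : passiveConst p q ≤ passiveConst p q / p := by
    rw [le_div_iff₀ hp]; exact mul_le_of_le_one_right hR h.p_mem.2.le
  have h11 : -(5 * passiveConst p q / p) ≤ V (1 - q) - V (equilibrium p q) := by
    rw [h9]
    have : 5 * passiveConst p q / p = 4 * passiveConst p q / p + passiveConst p q / p := by ring
    linarith
  have h12 := mul_le_mul_of_nonneg_left h11 (h.pow_pos n).le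
  have h13 := mul_le_mul_of_nonneg_right h10 (h.pow_pos n).le
  have : 6 * passiveConst p q / p * decay p q ^ n
      = decay p q ^ n * (5 * passiveConst p q / p)
        + passiveConst p q / p * decay p q ^ n := by ring
  linarith

/-- The equations for the charge at a lower threshold `w`, with all truncation errors. -/
lemma charge_mul_eq_lower {w : ℝ} (hw : w ∈ Ioo (0 : ℝ) 1) (aw : advantage p q lam V w = 0)
    (F K : ℕ) : lam * (qStep p q K + w) = (qStep p q K *
        ∑ k ∈ Finset.Icc 1 F, (entropy ((evolve p q)^[k] w) - entropy (pStep p q k))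
      - w * ∑ k ∈ Finset.Icc 1 K, (entropy (1 - qStep p q k) - entropy (equilibrium p q)))
      + qStep p q K * (V (evolve p q w) - V (equilibrium p q) - passiveValue p q (evolve p q w)
        + passiveValue p q ((evolve p q)^[F + 1] w) - passiveValue p q (pStep p q (F + 1)))
      + w * slackQ p q lam (saving p q g) (spread p q V) K := by
  have h1 := S.value_p_of_saving_eq_zero h hpq hG
  rw [advantage, sampleCost_eq, h1] at aw
  have h2 : V (evolve p q w)
      = lam + (passiveValue p q p + V (equilibrium p q)) + w * spread p q V := by linarith
  rw [h.sumQ_sub, h.sum_iterate_sub_pStep F hw, slackQ, hG, h2]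
  ring

lemma abs_sub_lowerIndex_le {w : ℝ} (hw : w ∈ Ioo (0 : ℝ) 1)
    (aw : advantage p q lam V w = 0) {F K : ℕ} (hK : 1 ≤ K)
    (hv : V (evolve p q w) - V (equilibrium p q) - passiveValue p q (evolve p q w) ≤ 0 ∧
      -(6 * passiveConst p q / p * decay p q ^ F)
        ≤ V (evolve p q w) - V (equilibrium p q) - passiveValue p q (evolve p q w))
    (hQ : slackQ p q lam (saving p q g) (spread p q V) K
      ≤ 2 * passiveConst p q * decay p q ^ F) :
    |lam - lowerIndex p q F K w| ≤ lowerError p q F := by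
  have h1 := S.charge_mul_eq_lower h hpq hG hw aw F K
  have hq := h.q_le_qStep hK
  have hd : q ≤ qStep p q K + w := by linarith [hw.1]
  have hd0 := h.hq.trans_le hd
  have hQ0 := S.slackQ_nonneg h hK
  have e1 := abs_le.1 (h.abs_passiveValue_iterate_le (F + 1) hw)
  have e2 := abs_le.1 (h.abs_passiveValue_iterate_le F h.p_mem)
  rw [h.iterate_p] at e2
  have hβ := h.pow_pos F
  have e3 : decay p q ^ (F + 1) ≤ decay p q ^ F :=
    pow_le_pow_of_le_one h.decay_pos.le h.decay_lt_one.le (by omega)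
  have hR := h.passiveConst_nonneg
  have e4 := mul_le_mul_of_nonneg_left e3 hR
  have e5 : passiveConst p q * decay p q ^ F ≤ passiveConst p q / p * decay p q ^ F := by
    refine mul_le_mul_of_nonneg_right ?_ hβ.le
    rw [le_div_iff₀ h.hp]; exact mul_le_of_le_one_right hR h.p_mem.2.le
  set N := qStep p q K *
        ∑ k ∈ Finset.Icc 1 F, (entropy ((evolve p q)^[k] w) - entropy (pStep p q k))
      - w * ∑ k ∈ Finset.Icc 1 K, (entropy (1 - qStep p q k) - entropy (equilibrium p q)) with hN
  have e0 : lowerIndex p q F K w = N / (qStep p q K + w) := rfl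
  set B := passiveConst p q / p * decay p q ^ F with hB
  have hB0 : 0 ≤ B := mul_nonneg (div_nonneg hR h.hp.le) hβ.le
  rw [show 6 * passiveConst p q / p * decay p q ^ F = 6 * B by rw [hB]; ring] at hv
  set ρ := V (evolve p q w) - V (equilibrium p q) - passiveValue p q (evolve p q w)
        + passiveValue p q ((evolve p q)^[F + 1] w) - passiveValue p q (pStep p q (F + 1)) with hρ
  have e6 : |ρ| ≤ 8 * B := by rw [abs_le]; constructor <;> linarith
  have e7 : |qStep p q K * ρ| ≤ 8 * B := by
    rw [abs_mul, abs_of_pos (h.hq.trans_le hq)]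
    exact (mul_le_of_le_one_left (abs_nonneg _) (h.qStep_lt_one K).le).trans e6
  have e8 : |w * slackQ p q lam (saving p q g) (spread p q V) K| ≤ 2 * B := by
    rw [abs_mul, abs_of_pos hw.1, abs_of_nonneg hQ0]
    exact (mul_le_of_le_one_left hQ0 hw.2.le).trans (by linarith)
  rw [e0, show lam - N / (qStep p q K + w) = (lam * (qStep p q K + w) - N) / (qStep p q K + w) by
    rw [eq_div_iff hd0.ne', sub_mul, div_mul_cancel₀ _ hd0.ne'], abs_div, abs_of_pos hd0,
    lowerError, show 10 * passiveConst p q / p * decay p q ^ F = 10 * B by rw [hB]; ring]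
  refine div_le_div₀ (by linarith) ?_ h.hq hd
  rw [h1, add_assoc, add_sub_cancel_left]
  exact (abs_add_le _ _).trans (by linarith)

omit hpq in
/-- At an upper threshold whose successor is sampled, the index formula is exact. -/
lemma eq_upperIndex {w : ℝ} (hw : w ∈ Ioo (0 : ℝ) 1) (hcw : equilibrium p q < w)
    (aw : advantage p q lam V w = 0) (aw' : 0 ≤ advantage p q lam V (evolve p q w)) {K : ℕ}
    (hQ : slackQ p q lam (saving p q g) (spread p q V) K = 0) :
    lam = upperIndex p q K w := by
  have h1 := S.entropy_evolve_sub h hw aw aw'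
  have hg : g = entropy (equilibrium p q) := (sub_eq_zero.1 hG).symm
  have hy : 0 < w - evolve p q w := by
    rw [h.sub_evolve]; exact mul_pos h.one_sub_decay_pos (sub_pos.2 hcw)
  rw [slackQ, hG] at hQ
  rw [upperIndex, eq_div_iff hy.ne', h.sumQ_sub, ← hg, h1]
  linear_combination (w - evolve p q w) * hQ

end IsBellmanSolution

namespace IsWhittleOrdering

variable {p q : ℝ} {F : ℕ} {x : Fin (2 * F + 1) → ℝ} (hx : IsWhittleOrdering p q F x)
include hx

section
variable (h : IsMonotonic p q) (hpq : p ≤ q) {e n : Fin (2 * F + 1)} (he : x e = equilibrium p q)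
  (hn : e ≤ n) {g : ℝ} {V : ℝ → ℝ} (S : IsBellmanSolution p q (whittleIndex p q (x n)) g V)
include h hpq he hn S

lemma advantage_equilibrium_nonpos :
    advantage p q (whittleIndex p q (x n)) V (equilibrium p q) ≤ 0 := by
  rw [← he]
  exact (whittleIndex_le_iff h hpq (whittleIndex_nonneg _ _ _) S (hx.mem_Ioo h e)).1
    (hx.monotone hn)

lemma active_cases {s : ℝ} (hs : s ∈ activeStates x n) :
    s = equilibrium p q ∨ ∃ k, 1 ≤ k ∧ k ≤ F ∧ s = 1 - qStep p q k := by
  have h1 := (hx.advantage_facts h hpq S).1 s hs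
  obtain ⟨i, -, rfl⟩ := hs
  rcases mem_beliefStates.1 (hx.mem_states i) with h2 | ⟨k, hk, -, h2⟩ | h2
  · exact Or.inl h2
  · rw [h2] at h1
    exact absurd (S.advantage_neg_of_lt_eq h hpq
      (hx.advantage_equilibrium_nonpos h hpq he hn S) (h.pStep_mem hk).1 (h.pStep_lt k))
      (not_lt.2 h1)
  · exact Or.inr h2

end

/-- Once the equilibrium is passive, `x n` is a point `1 - qStep j`, the cycle from `1 - q` ends
within the truncation, and the sampling region lies above the equilibrium. If `x n`
is its upper end, then the successor of `x n` is not below the last state, and so it is sampled; if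
`x n` is its lower end, then the value after `x n` is that of permanent passivity. -/
theorem whittleIndex_threshold (h : IsMonotonic p q) (hpq : p ≤ q) (hF : 1 ≤ F)
    {e n : Fin (2 * F + 1)} (he : x e = equilibrium p q) (hen : e < n) (hn : (n : ℕ) < 2 * F) :
    ∃ K : ℕ, cycleK p q x n = K ∧ ∃ ωl ωu : ℝ, ωl < ωu ∧
      samplingRegion p q (whittleIndex p q (x n)) = Ioo ωl ωu ∧ (x n = ωl ∨ x n = ωu) ∧
      (x n = ωu → whittleIndex p q (x n) = upperIndex p q K (x n)) ∧
      (x n = ωl → |whittleIndex p q (x n) - lowerIndex p q F K (x n)| ≤ lowerError p q F) := by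
  have hlam := whittleIndex_nonneg p q (x n)
  have hlamC := whittleIndex_le_const h hpq (hx.mem_Ioo h n)
  obtain ⟨g, V, S⟩ := h.exists_solution hlam
  obtain ⟨act, pas, a0⟩ := hx.advantage_facts h hpq S
  have ac := hx.advantage_equilibrium_nonpos h hpq he hen.le S
  have hG := S.saving_eq_zero h ac
  have hcA : equilibrium p q ∉ activeStates x n := by
    rw [← he, hx.mem_activeStates_iff]; exact not_le.2 hen
  have hform : ∀ s ∈ activeStates x n, ∃ k, 1 ≤ k ∧ k ≤ F ∧ s = 1 - qStep p q k := fun s hs =>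
    (hx.active_cases h hpq he hen.le S hs).resolve_left fun h1 => hcA (h1 ▸ hs)
  have hreg := S.samplingRegion_eq h hpq
  set lam := whittleIndex p q (x n) with hlamdef
  have hxA : x n ∈ activeStates x n := hx.mem_activeStates_iff.2 le_rfl
  have hxm := hx.mem_Ioo h n
  obtain ⟨j, hj, hjF, hxj⟩ := hform _ hxA
  have hcx : equilibrium p q < x n := by rw [hxj]; exact h.lt_one_sub_qStep j
  obtain ⟨K, hK, hKF, hK1, hK2, hK3, hK4⟩ := exists_hittingTime (A := activeStates x n)
    (s := fun k => 1 - qStep p q k) (fun k hk => h.iterate_truncEvolve_q hk)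
    (h.iterate_truncEvolve_q_last hF) (Or.inr ⟨j, hj, hjF, hxj ▸ hxA⟩)
  have hKF' : K ≤ F := by
    rcases hKF.lt_or_eq with h1 | h1
    · omega
    · exact absurd (hK4 h1) hcA
  have sQ := S.slackQ_eq_max h hK fun k hk hkK => pas _
    (mem_beliefStates.2 (Or.inr (Or.inr ⟨k, hk, by omega, rfl⟩))) (hK2 k hk hkK)
  rw [max_eq_left (neg_nonpos.2 (act _ (hK3 hKF')))] at sQ
  refine ⟨K, hK1, ?_⟩
  -- the last state is a second point where the advantage is nonnegative
  have hnl : n ≠ Fin.last (2 * F) := fun h1 => by rw [h1] at hn; exact hn.ne rfl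
  set y := x (Fin.last (2 * F)) with hy
  have hyA : y ∈ activeStates x n := hx.mem_activeStates_iff.2 (Fin.le_last n)
  have hym : y ∈ Ioo (0 : ℝ) 1 := hx.mem_Ioo h _
  have ay := act y hyA
  have hxy : x n ≠ y := fun h1 => hnl (hx.injective h1)
  have hconv : ∀ z₁ z₂ z₃ : ℝ, z₁ ∈ Ioo (0 : ℝ) 1 → z₃ ∈ Ioo (0 : ℝ) 1 → z₁ < z₂ → z₂ < z₃ →
      0 ≤ advantage p q lam V z₁ → 0 ≤ advantage p q lam V z₃ → 0 < advantage p q lam V z₂ :=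
    fun z₁ z₂ z₃ m1 m3 l1 l2 a1 a3 => (le_min a1 a3).trans_lt (S.min_lt_advantage h m1 m3 l1 l2)
  set R := samplingRegion p q lam with hR
  have hRmem : ∀ z, z ∈ R ↔ z ∈ Ioo (0 : ℝ) 1 ∧ 0 < advantage p q lam V z := fun z => by
    rw [hreg]; exact Iff.rfl
  have hbelow : BddBelow R := ⟨0, fun z hz => ((hRmem z).1 hz).1.1.le⟩
  have habove : BddAbove R := ⟨1, fun z hz => ((hRmem z).1 hz).1.2.le⟩
  have hne : R.Nonempty := by
    rcases lt_or_gt_of_ne hxy with h1 | h1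
    · obtain ⟨z, l1, l2⟩ := exists_between h1
      exact ⟨z, (hRmem z).2 ⟨⟨hxm.1.trans l1, l2.trans hym.2⟩,
        hconv _ _ _ hxm hym l1 l2 a0.ge ay⟩⟩
    · obtain ⟨z, l1, l2⟩ := exists_between h1
      exact ⟨z, (hRmem z).2 ⟨⟨hym.1.trans l1, l2.trans hxm.2⟩,
        hconv _ _ _ hym hxm l1 l2 ay a0.ge⟩⟩
  have hopen : IsOpen R := by
    rw [isOpen_iff_mem_nhds]
    intro z hz
    obtain ⟨z1, z2⟩ := (hRmem z).1 hz
    filter_upwards [isOpen_Ioo.mem_nhds z1,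
      (S.continuousAt_advantage h z1).eventually (lt_mem_nhds z2)] with w w1 w2
    exact (hRmem w).2 ⟨w1, w2⟩
  have hIoo : R = Ioo (sInf R) (sSup R) := by
    refine Subset.antisymm (fun z hz => ?_) fun z hz => ?_
    · obtain ⟨u, v, huv, hsub⟩ := mem_nhds_iff_exists_Ioo_subset.1 (hopen.mem_nhds hz)
      obtain ⟨a, a1, a2⟩ := exists_between huv.1
      obtain ⟨b, b1, b2⟩ := exists_between huv.2
      exact ⟨(csInf_le hbelow (hsub ⟨a1, a2.trans huv.2⟩)).trans_lt a2,
        b1.trans_le (le_csSup habove (hsub ⟨huv.1.trans b1, b2⟩))⟩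
    · obtain ⟨a, ha, a1⟩ := exists_lt_of_csInf_lt hne hz.1
      obtain ⟨b, hb, b1⟩ := exists_lt_of_lt_csSup hne hz.2
      obtain ⟨a2, a3⟩ := (hRmem a).1 ha
      obtain ⟨b2, b3⟩ := (hRmem b).1 hb
      exact (hRmem z).2 ⟨⟨a2.1.trans a1, b1.trans b2.2⟩, hconv _ _ _ a2 b2 a1 b1 a3.le b3.le⟩
  have hlu : sInf R < sSup R := by
    obtain ⟨z, hz⟩ := hne
    rw [hIoo] at hz
    exact hz.1.trans hz.2
  have hxR : x n ∉ R := fun h1 => ((hRmem _).1 h1).2.ne' a0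
  -- the sampling region lies on the side of `x n` where `y` lies
  have hcase : (x n < y ∧ x n = sInf R) ∨ (y < x n ∧ x n = sSup R) := by
    rcases lt_or_gt_of_ne hxy with h1 | h1
    · refine Or.inl ⟨h1, le_antisymm (le_csInf hne fun z hz => ?_) ?_⟩
      · by_contra hcon
        obtain ⟨z1, z2⟩ := (hRmem z).1 hz
        exact (hconv _ _ _ z1 hym (not_le.1 hcon) h1 z2.le ay).ne' a0
      · refine le_of_forall_gt_imp_ge_of_dense fun z hz => ?_
        obtain ⟨w, w1, w2⟩ := exists_between (lt_min hz h1)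
        refine (csInf_le hbelow ((hRmem w).2 ⟨⟨hxm.1.trans w1, ?_⟩, ?_⟩)).trans
          (w2.le.trans (min_le_left _ _))
        · exact (w2.trans_le (min_le_right _ _)).trans hym.2
        · exact hconv _ _ _ hxm hym w1 (w2.trans_le (min_le_right _ _)) a0.ge ay
    · refine Or.inr ⟨h1, le_antisymm ?_ (csSup_le hne fun z hz => ?_)⟩
      · refine le_of_forall_lt_imp_le_of_dense fun z hz => ?_
        obtain ⟨w, w1, w2⟩ := exists_between (max_lt hz h1)
        refine ((le_max_left _ _).trans w1.le).trans
          (le_csSup habove ((hRmem w).2 ⟨⟨?_, w2.trans hxm.2⟩, ?_⟩))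
        · exact hym.1.trans ((le_max_right _ _).trans_lt w1)
        · exact hconv _ _ _ hym hxm ((le_max_right _ _).trans_lt w1) w2 ay a0.ge
      · by_contra hcon
        obtain ⟨z1, z2⟩ := (hRmem z).1 hz
        exact (hconv _ _ _ hym z1 h1 (not_le.1 hcon) ay z2.le).ne' a0
  refine ⟨sInf R, sSup R, hlu, hIoo, hcase.imp (·.2) (·.2), fun hxu => ?_, fun hxl => ?_⟩
  · have hyx : y < x n := by
      rcases hcase with ⟨-, h1⟩ | ⟨h1, -⟩
      · exact absurd (h1.symm.trans hxu) hlu.ne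
      · exact h1
    obtain ⟨i, hi, -, hyi⟩ := hform _ hyA
    have hji : j + 1 ≤ i := by
      rw [hxj, hyi] at hyx
      have : qStep p q j < qStep p q i := by linarith
      exact h.qStep_strictMono.lt_iff_lt.1 this
    have hev : evolve p q (x n) = 1 - qStep p q (j + 1) := by
      rw [hxj]; exact h.iterate_qStep 1 j
    have h1 : y ≤ evolve p q (x n) := by
      rw [hev, hyi]; linarith [h.qStep_strictMono.monotone hji]
    have h2 : evolve p q (x n) ≤ x n := by
      have := h.sub_evolve (x n)
      nlinarith [h.one_sub_decay_pos]
    exact S.eq_upperIndex h hG hxm hcx a0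
      (S.advantage_nonneg_of_between h hym hxm h1 h2 ay a0.ge) sQ
  · have hpass : ∀ m, advantage p q lam V ((evolve p q)^[m] (evolve p q (x n))) ≤ 0 := by
      intro m
      rw [← Function.iterate_succ_apply]
      by_contra hcon
      have hmem := (hRmem _).2 ⟨h.iterate_mem (m + 1) hxm, not_le.1 hcon⟩
      have h1 := csInf_le hbelow hmem
      rw [← hxl, h.iterate_eq] at h1
      nlinarith [h.pow_lt_one (by omega : 1 ≤ m + 1)]
    have hv := (S.value_eq_forever h (h.evolve_mem hxm) hpass).2
    have hC := h.passiveConst_nonneg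
    have hβ := (h.pow_pos F).le
    have hp := h.hp
    refine S.abs_sub_lowerIndex_le h hpq hG hxm a0 hK ?_ ?_
    · rw [show V (evolve p q (x n)) - V (equilibrium p q) - passiveValue p q (evolve p q (x n)) = 0
        by rw [hv]; ring]
      exact ⟨le_rfl, neg_nonpos.2 (by positivity)⟩
    · rw [sQ]; positivity

/-- At the largest index of a listed state all other listed states are passive. Hence the value after
this state is that of permanent passivity, up to a small error if the state is `1 - qStep F`, whose
successor is not listed. -/
theorem whittleIndex_last (h : IsMonotonic p q) (hpq : p ≤ q) (hF : 1 ≤ F)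
    {e : Fin (2 * F + 1)} (he : x e = equilibrium p q) :
    ∃ K : ℕ, cycleK p q x (Fin.last (2 * F)) = K ∧
      |whittleIndex p q (x (Fin.last (2 * F))) - lowerIndex p q F K (x (Fin.last (2 * F)))|
        ≤ lowerError p q F := by
  set n := Fin.last (2 * F) with hndef
  have hen : e ≤ n := Fin.le_last e
  have hlam := whittleIndex_nonneg p q (x n)
  have hlamC := whittleIndex_le_const h hpq (hx.mem_Ioo h n)
  obtain ⟨g, V, S⟩ := h.exists_solution hlam
  obtain ⟨act, pas, a0⟩ := hx.advantage_facts h hpq S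
  have ac := hx.advantage_equilibrium_nonpos h hpq he hen S
  have hG := S.saving_eq_zero h ac
  have hxA : x n ∈ activeStates x n := hx.mem_activeStates_iff.2 le_rfl
  have honly : ∀ s ∈ activeStates x n, s = x n := by
    rintro _ ⟨i, hi, rfl⟩
    rw [le_antisymm (Fin.le_last i) hi]
  have hxm := hx.mem_Ioo h n
  have hcases := hx.active_cases h hpq he hen S hxA
  have hactive : equilibrium p q ∈ activeStates x n ∨
      ∃ k, 1 ≤ k ∧ k ≤ F ∧ 1 - qStep p q k ∈ activeStates x n := by
    rcases hcases with h1 | ⟨j, hj, hjF, h1⟩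
    · exact Or.inl (by rw [← h1]; exact hxA)
    · exact Or.inr ⟨j, hj, hjF, by rw [← h1]; exact hxA⟩
  set lam := whittleIndex p q (x n) with hlamdef
  have hC := h.passiveConst_nonneg
  have hβ := (h.pow_pos F).le
  have hp := h.hp
  obtain ⟨K, hK, hKF, hK1, hK2, hK3, hK4⟩ := exists_hittingTime (A := activeStates x n)
    (s := fun k => 1 - qStep p q k) (fun k hk => h.iterate_truncEvolve_q hk)
    (h.iterate_truncEvolve_q_last hF)
    hactive
  have sQ := S.slackQ_eq_max h hK fun k hk hkK => pas _
    (mem_beliefStates.2 (Or.inr (Or.inr ⟨k, hk, by omega, rfl⟩))) (hK2 k hk hkK)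
  refine ⟨K, hK1, S.abs_sub_lowerIndex_le h hpq hG hxm a0 hK ?_ ?_⟩
  · -- the value after `x n` is that of permanent passivity, unless `x n` is the last orbit point
    have hzero : V (evolve p q (x n))
        = passiveValue p q (evolve p q (x n)) + V (equilibrium p q) →
        V (evolve p q (x n)) - V (equilibrium p q) - passiveValue p q (evolve p q (x n)) ≤ 0 ∧
        -(6 * passiveConst p q / p * decay p q ^ F)
        ≤ V (evolve p q (x n)) - V (equilibrium p q) - passiveValue p q (evolve p q (x n)) := by
      intro hv
      rw [show V (evolve p q (x n)) - V (equilibrium p q) - passiveValue p q (evolve p q (x n)) = 0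
        by rw [hv]; ring]
      exact ⟨le_rfl, neg_nonpos.2 (by positivity)⟩
    rcases hcases with h1 | ⟨j, hj, hjF, h1⟩
    · refine hzero ?_
      rw [h1, h.evolve_equilibrium, h.passiveValue_equilibrium, zero_add]
    have hev : evolve p q (x n) = 1 - qStep p q (j + 1) := by
      rw [h1]; exact h.iterate_qStep 1 j
    rcases hjF.lt_or_eq with hjF | rfl
    · refine hzero (S.value_eq_forever h (h.evolve_mem hxm) fun m => ?_).2
      rw [hev, h.iterate_qStep]
      have hlt : 1 - qStep p q (j + 1) < x n := by
        rw [h1]; linarith [h.qStep_strictMono (Nat.lt_succ_self j)]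
      have a1 : advantage p q lam V (1 - qStep p q (j + 1)) ≤ 0 :=
        pas _ (mem_beliefStates.2 (Or.inr (Or.inr ⟨j + 1, by omega, hjF, rfl⟩)))
          fun hmem => hlt.ne (honly _ hmem)
      by_contra hcon
      rcases Nat.eq_zero_or_pos m with rfl | hm
      · exact hcon a1
      have hlt' : 1 - qStep p q (j + 1 + m) < 1 - qStep p q (j + 1) := by
        linarith [h.qStep_strictMono (show j + 1 < j + 1 + m by omega)]
      have := S.min_lt_advantage h (h.qStep_mem (by omega)) hxm hlt' hlt
      rw [a0, min_eq_right (not_le.1 hcon).le] at this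
      linarith
    · rw [hev]
      exact S.value_qStep_bounds h hpq hG hlamC j
  · rw [sQ]
    refine max_le (by positivity) ?_
    rcases hKF.lt_or_eq with h1 | h1
    · exact (neg_nonpos.2 (act _ (hK3 (by omega)))).trans (by positivity)
    · have hc := act _ (hK4 h1)
      rw [h1]
      exact (S.neg_advantage_qStep_le h hc (by omega)).trans (mul_le_mul_of_nonneg_right hlamC hβ)

end IsWhittleOrdering

/-! ### Vanishing truncation error -/

/-- Both error bounds vanish as `F` grows, and `F` is large if `pStep F` is close to the
equilibrium. -/
lemma IsMonotonic.exists_truncation {p q : ℝ} (h : IsMonotonic p q) {η : ℝ} (hη : 0 < η) :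
    ∃ ε : ℝ, 0 < ε ∧ ∀ F : ℕ, |pStep p q F - equilibrium p q| < ε →
      centralError p q F < η ∧ lowerError p q F < η := by
  have t1 : Tendsto (centralError p q) atTop (𝓝 0) := by
    have e1 : Tendsto (fun F : ℕ => (F : ℝ) * decay p q ^ F) atTop (𝓝 0) :=
      tendsto_self_mul_const_pow_of_lt_one h.decay_pos.le h.decay_lt_one
    have e2 := (e1.add (h.tendsto_pow.const_mul 2)).const_mul (4 * passiveConst p q / p)
    rw [mul_zero, add_zero, mul_zero] at e2
    refine e2.congr fun F => ?_
    unfold centralError; ring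
  have t2 : Tendsto (lowerError p q) atTop (𝓝 0) := by
    have := h.tendsto_pow.const_mul (10 * passiveConst p q / p / q)
    rw [mul_zero] at this
    refine this.congr fun F => ?_
    unfold lowerError; ring
  obtain ⟨N, hN⟩ := eventually_atTop.1
    ((t1.eventually (gt_mem_nhds hη)).and (t2.eventually (gt_mem_nhds hη)))
  refine ⟨equilibrium p q * decay p q ^ N, mul_pos h.eq_pos (h.pow_pos N), fun F hF => ?_⟩
  refine hN F (not_lt.1 fun hlt => ?_)
  rw [abs_sub_comm, h.eq_sub_pStep, abs_of_pos (mul_pos h.eq_pos (h.pow_pos F))] at hF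
  have := lt_of_mul_lt_mul_left hF h.eq_pos.le
  exact absurd (pow_le_pow_of_le_one h.decay_pos.le h.decay_lt_one.le hlt.le) (not_le.2 this)

end Bandit

theorem proposition4 (p q : ℝ) (hp : 0 < p) (hpq : p ≤ q) (hsum : p + q < 1) :
    -- the Whittle index is well defined
    Bandit.Indexable p q ∧
    -- structure for every truncation level, and exact formulas where the truncation plays no role
    (∀ F : ℕ, 1 ≤ F → ∀ x : Fin (2 * F + 1) → ℝ, Bandit.IsWhittleOrdering p q F x →
      ∀ e : Fin (2 * F + 1), x e = Bandit.equilibrium p q →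
        (∀ n : Fin (2 * F + 1), n ≤ e →
          ∃ L K : ℕ, Bandit.cycleL p q x n = L ∧ Bandit.cycleK p q x n = K ∧
            (L ≤ F → K ≤ F →
              Bandit.whittleIndex p q (x n) = Bandit.centralIndex p q L K (x n))) ∧
        (∀ n : Fin (2 * F + 1), e < n → (n : ℕ) < 2 * F →
          ∃ K : ℕ, Bandit.cycleK p q x n = K ∧
          ∃ ωl ωu : ℝ, ωl < ωu ∧
            Bandit.samplingRegion p q (Bandit.whittleIndex p q (x n)) = Set.Ioo ωl ωu ∧
            (x n = ωl ∨ x n = ωu) ∧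
            (x n = ωu →
              Bandit.whittleIndex p q (x n) = Bandit.upperIndex p q K (x n)))) ∧
    -- all formulas, up to an error that vanishes with the truncation
    (∀ η : ℝ, 0 < η → ∃ ε : ℝ, 0 < ε ∧
      ∀ F : ℕ, 1 ≤ F → |Bandit.pStep p q F - Bandit.equilibrium p q| < ε →
        |1 - Bandit.qStep p q F - Bandit.equilibrium p q| < ε →
      ∀ x : Fin (2 * F + 1) → ℝ, Bandit.IsWhittleOrdering p q F x →
      ∀ e : Fin (2 * F + 1), x e = Bandit.equilibrium p q →
        (∀ n : Fin (2 * F + 1), n ≤ e →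
          ∃ L K : ℕ, Bandit.cycleL p q x n = L ∧ Bandit.cycleK p q x n = K ∧
            |Bandit.whittleIndex p q (x n) - Bandit.centralIndex p q L K (x n)| < η) ∧
        (∀ n : Fin (2 * F + 1), e < n → (n : ℕ) < 2 * F →
          ∃ K : ℕ, Bandit.cycleK p q x n = K ∧
          ∃ ωl ωu : ℝ, ωl < ωu ∧
            Bandit.samplingRegion p q (Bandit.whittleIndex p q (x n)) = Set.Ioo ωl ωu ∧
            (x n = ωl →
              |Bandit.whittleIndex p q (x n) - Bandit.lowerIndex p q F K (x n)| < η) ∧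
            (x n = ωu →
              |Bandit.whittleIndex p q (x n) - Bandit.upperIndex p q K (x n)| < η)) ∧
        (∃ K : ℕ, Bandit.cycleK p q x (Fin.last (2 * F)) = K ∧
          |Bandit.whittleIndex p q (x (Fin.last (2 * F)))
            - Bandit.lowerIndex p q F K (x (Fin.last (2 * F)))| < η)) := by
  have h : Bandit.IsMonotonic p q := ⟨hp, hp.trans_le hpq, hsum⟩
  refine ⟨Bandit.indexable h hpq, fun F hF x hx e he => ⟨fun n hn => ?_, fun n hen hn => ?_⟩,
    fun η hη => ?_⟩
  · obtain ⟨L, K, h1, h2, h3, -⟩ := hx.whittleIndex_central h hpq hF he hn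
    exact ⟨L, K, h1, h2, h3⟩
  · obtain ⟨K, h1, ωl, ωu, h2, h3, h4, h5, -⟩ := hx.whittleIndex_threshold h hpq hF he hen hn
    exact ⟨K, h1, ωl, ωu, h2, h3, h4, h5⟩
  · obtain ⟨ε, hε, herr⟩ := h.exists_truncation hη
    refine ⟨ε, hε, fun F hF hpF _ x hx e he => ?_⟩
    obtain ⟨e1, e2⟩ := herr F hpF
    refine ⟨fun n hn => ?_, fun n hen hn => ?_, ?_⟩
    · obtain ⟨L, K, h1, h2, -, h3⟩ := hx.whittleIndex_central h hpq hF he hn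
      exact ⟨L, K, h1, h2, h3.trans_lt e1⟩
    · obtain ⟨K, h1, ωl, ωu, h2, h3, h4, h5, h6⟩ :=
        hx.whittleIndex_threshold h hpq hF he hen hn
      exact ⟨K, h1, ωl, ωu, h2, h3, fun hl => (h6 hl).trans_lt e2, fun hu => by
        rw [h5 hu, sub_self, abs_zero]; exact hη⟩
    · obtain ⟨K, h1, h2⟩ := hx.whittleIndex_last h hpq hF he
      exact ⟨K, h1, h2.trans_lt e2⟩
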